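/- Let $K$ be a field and let $(V,c)$ be a braided vector space over $K$: $V$ is a $K$-vector space and $c:V\otimes V\to V\otimes V$ is a $K$-linear map (not necessarily invertible) such that $c_1c_2c_1=c_2c_1c_2$ on $V^{\otimes 3}$, where $c_1=c\otimes V$ and $c_2=V\otimes c$. Let $T=T(V,c)$ be the tensor algebra with its standard braided bialgebra structure: its braiding $c_T$ is the extension of $c$ compatible with multiplication and unit, and its comultiplication $\Delta$ is multiplicative with respect to the product $(m\otimes m)(T\otimes c_T\otimes T)$ of $T\otimes T$, with the elements of $V$ primitive. Put $$E_2=E_2(V,c)=\ker(\Delta^{1,1})=\ker(c+\mathrm{Id}_{V\otimes V})\subseteq V\otimes V .$$ A *Qbracket* on $(V,c)$ is a $K$-linear map $\bar\beta:E_2\to V$ such that $$c(\bar\beta\otimes V)=(V\otimes\bar\beta)\,c_{E_2,V},\qquad c(V\otimes\bar\beta)=(\bar\beta\otimes V)\,c_{V,E_2},$$ where $c_{E_2,V}:E_2\otimes V\to V\otimes E_2$ and $c_{V,E_2}:V\otimes E_2\to E_2\otimes V$ are the maps induced by $c_{V\otimes V,V}=c_1c_2$ and $c_{V,V\otimes V}=c_2c_1$.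 For a Qbracket $\bar\beta$ put $$U_Q=U_Q(V,c,\bar\beta)=T(V,c)/\big((\mathrm{Id}-\bar\beta)[E_2]\big),$$ the quotient by a two-sided ideal. It is a braided bialgebra quotient of $T$; let $\pi:T\to U_Q$ be the projection, $i:V\to U_Q$ its restriction to $V$, and $P(U_Q)=\{x\in U_Q:\Delta(x)=x\otimes 1+1\otimes x\}$. Put $S_Q(V,c)=U_Q(V,c,0)=T(V,c)/(E_2)$, graded by the images of the $V^{\otimes n}$. Let $U'_n=\pi\big(\bigoplus_{t\le n}V^{\otimes t}\big)$, $U'_{-1}=0$, and let $\mathrm{gr}'(U_Q)=\bigoplus_n U'_n/U'_{n-1}$ be the associated graded braided bialgebra. Let $\theta:S_Q(V,c)\to\mathrm{gr}'(U_Q)$ be the canonical map, that is, the algebra map with $\theta(v)=\pi(v)+U'_0\in U'_1/U'_0$ for $v\in V$. Let $\Gamma:T(V,c)\to T^c(V,c)$ be the algebra homomorphism to the quantum shuffle algebra that restricts to the identity of $V$, and let $\mathcal B(V,c)=\mathrm{Im}\,\Gamma\simeq T/\ker\Gamma$ be the Nichols algebra, with the induced grading. Since $E_2\subseteq\ker\Gamma$,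 the map $\Gamma$ induces a canonical surjection $S_Q(V,c)\to\mathcal B(V,c)$; we write $S_Q(V,c)=\mathcal B(V,c)$ if it is bijective. A *quadratic algebra* is a graded $K$-algebra $A=\bigoplus_{n\in\mathbb N}A^n$ such that $A^0=K$, $A$ is generated by $A^1$, and the kernel of the natural map $T_K(A^1)\to A$ is generated as a two-sided ideal by its intersection with $A^1\otimes A^1$. **Theorem.** Let $\bar\beta:E_2(V,c)\to V$ be a Qbracket on a braided vector space $(V,c)$. Then $\mathcal B(V,c)$ is a quadratic algebra if and only if $S_Q(V,c)=\mathcal B(V,c)$. If this holds, the following assertions are equivalent: 1. $i:V\to U_Q(V,c,\bar\beta)$ is injective; 2. $V\cap\ker(\pi)=0$; 3. the canonical map $\theta:S_Q(V,c)\to\mathrm{gr}'(U_Q(V,c,\bar\beta))$ is an isomorphism of graded braided bialgebras; 4. $i$ induces an isomorphism between $V$ and $P(U_Q(V,c,\bar\beta))$. -/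

import Mathlib

open scoped TensorProduct DirectSum

namespace QLie

universe u v

variable {K : Type u} {V : Type v} [Field K] [AddCommGroup V] [Module K V]

/-- `c₁ = c ⊗ V` on `V ⊗ V ⊗ V`. -/
def leg₁ (c : V ⊗[K] V →ₗ[K] V ⊗[K] V) : V ⊗[K] (V ⊗[K] V) →ₗ[K] V ⊗[K] (V ⊗[K] V) :=
  (TensorProduct.assoc K V V V).toLinearMap ∘ₗ c.rTensor V ∘ₗ
    (TensorProduct.assoc K V V V).symm.toLinearMap

/-- `c₂ = V ⊗ c` on `V ⊗ V ⊗ V`. -/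
def leg₂ (c : V ⊗[K] V →ₗ[K] V ⊗[K] V) : V ⊗[K] (V ⊗[K] V) →ₗ[K] V ⊗[K] (V ⊗[K] V) :=
  c.lTensor V

variable (K V) in
/-- A braiding on `V`: a (not necessarily invertible) linear endomorphism of `V ⊗ V` which
satisfies the quantum Yang-Baxter equation. -/
structure Braiding where
  /-- The underlying linear map. -/
  map : V ⊗[K] V →ₗ[K] V ⊗[K] V
  yangBaxter : leg₁ map ∘ₗ leg₂ map ∘ₗ leg₁ map = leg₂ map ∘ₗ leg₁ map ∘ₗ leg₂ map

/-- `E₂(V,c) = ker (c + Id)`, a subspace of `V ⊗ V`. -/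
def E₂ (c : Braiding K V) : Submodule K (V ⊗[K] V) := LinearMap.ker (c.map + LinearMap.id)

theorem map_E₂ (c : Braiding K V) {z : V ⊗[K] V} (hz : z ∈ E₂ c) : c.map z = -z := by
  have h : c.map z + z = 0 := by simpa [E₂] using hz
  exact eq_neg_of_add_eq_zero_left h

/-- The braiding `c_{V ⊗ V, V} = c₁ c₂`. -/
def braidVVV (c : Braiding K V) : (V ⊗[K] V) ⊗[K] V →ₗ[K] V ⊗[K] (V ⊗[K] V) :=
  leg₁ c.map ∘ₗ leg₂ c.map ∘ₗ (TensorProduct.assoc K V V V).toLinearMap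

/-- The braiding `c_{V, V ⊗ V} = c₂ c₁`. -/
def braidVVV' (c : Braiding K V) : V ⊗[K] (V ⊗[K] V) →ₗ[K] (V ⊗[K] V) ⊗[K] V :=
  (TensorProduct.assoc K V V V).symm.toLinearMap ∘ₗ leg₂ c.map ∘ₗ leg₁ c.map

theorem lTensor_E₂_injective (c : Braiding K V) :
    Function.Injective ((E₂ c).subtype.lTensor V) :=
  Module.Flat.lTensor_preserves_injective_linearMap _ (E₂ c).injective_subtype

theorem rTensor_E₂_injective (c : Braiding K V) :
    Function.Injective ((E₂ c).subtype.rTensor V) :=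
  Module.Flat.rTensor_preserves_injective_linearMap _ (E₂ c).injective_subtype

theorem mem_range_lTensor_E₂ (c : Braiding K V) {y : V ⊗[K] (V ⊗[K] V)}
    (hy : leg₂ c.map y = -y) : y ∈ LinearMap.range ((E₂ c).subtype.lTensor V) := by
  have hex : Function.Exact (E₂ c).subtype ⇑(c.map + (LinearMap.id : V ⊗[K] V →ₗ[K] V ⊗[K] V)) :=
    LinearMap.exact_subtype_ker_map _
  have := (Module.Flat.lTensor_exact V hex y).1 (by
    rw [LinearMap.lTensor_add, LinearMap.lTensor_id, LinearMap.add_apply]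
    change leg₂ c.map y + y = 0
    rw [hy]; simp)
  exact this

theorem mem_range_rTensor_E₂ (c : Braiding K V) {y : (V ⊗[K] V) ⊗[K] V}
    (hy : c.map.rTensor V y = -y) : y ∈ LinearMap.range ((E₂ c).subtype.rTensor V) := by
  have hex : Function.Exact (E₂ c).subtype ⇑(c.map + (LinearMap.id : V ⊗[K] V →ₗ[K] V ⊗[K] V)) :=
    LinearMap.exact_subtype_ker_map _
  have := (Module.Flat.rTensor_exact V hex y).1 (by
    rw [LinearMap.rTensor_add, LinearMap.rTensor_id, LinearMap.add_apply, hy]; simp)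
  exact this

theorem braidVVV_mem (c : Braiding K V) (x : E₂ c ⊗[K] V) :
    braidVVV c ((E₂ c).subtype.rTensor V x) ∈ LinearMap.range ((E₂ c).subtype.lTensor V) := by
  apply mem_range_lTensor_E₂
  have h0 : c.map.rTensor V ((E₂ c).subtype.rTensor V x) = -((E₂ c).subtype.rTensor V x) := by
    induction x with
    | zero => simp
    | add a b ha hb => simp only [map_add, ha, hb, neg_add]
    | tmul z v => simp [map_E₂ c z.2, TensorProduct.neg_tmul]
  have h1 : leg₁ c.map (TensorProduct.assoc K V V V ((E₂ c).subtype.rTensor V x)) =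
      -TensorProduct.assoc K V V V ((E₂ c).subtype.rTensor V x) := by
    simp only [leg₁, LinearMap.comp_apply, LinearEquiv.coe_coe, LinearEquiv.symm_apply_apply, h0,
      map_neg]
  have h2 := LinearMap.congr_fun c.yangBaxter
    (TensorProduct.assoc K V V V ((E₂ c).subtype.rTensor V x))
  simp only [LinearMap.comp_apply, h1, map_neg] at h2
  simp only [braidVVV, LinearMap.comp_apply, LinearEquiv.coe_coe]
  exact h2.symm

theorem braidVVV'_mem (c : Braiding K V) (x : V ⊗[K] E₂ c) :
    braidVVV' c ((E₂ c).subtype.lTensor V x) ∈ LinearMap.range ((E₂ c).subtype.rTensor V) := by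
  apply mem_range_rTensor_E₂
  have h0 : leg₂ c.map ((E₂ c).subtype.lTensor V x) = -((E₂ c).subtype.lTensor V x) := by
    induction x with
    | zero => simp
    | add a b ha hb => simp only [map_add, ha, hb, neg_add]
    | tmul v z => simp [leg₂, map_E₂ c z.2, TensorProduct.tmul_neg]
  have h2 := LinearMap.congr_fun c.yangBaxter ((E₂ c).subtype.lTensor V x)
  simp only [LinearMap.comp_apply, h0, map_neg] at h2
  apply (TensorProduct.assoc K V V V).injective
  rw [map_neg]
  simpa only [braidVVV', leg₁, LinearMap.comp_apply, LinearEquiv.coe_coe,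
    LinearEquiv.apply_symm_apply] using h2

/-- The map `c_{E₂(V,c), V} : E₂ ⊗ V → V ⊗ E₂` induced by `c_{V ⊗ V, V}`. -/
noncomputable def braidE₂V (c : Braiding K V) : E₂ c ⊗[K] V →ₗ[K] V ⊗[K] E₂ c :=
  (LinearEquiv.ofInjective _ (lTensor_E₂_injective c)).symm.toLinearMap ∘ₗ
    (braidVVV c ∘ₗ (E₂ c).subtype.rTensor V).codRestrict _ (braidVVV_mem c)

/-- The map `c_{V, E₂(V,c)} : V ⊗ E₂ → E₂ ⊗ V` induced by `c_{V, V ⊗ V}`. -/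
noncomputable def braidVE₂ (c : Braiding K V) : V ⊗[K] E₂ c →ₗ[K] E₂ c ⊗[K] V :=
  (LinearEquiv.ofInjective _ (rTensor_E₂_injective c)).symm.toLinearMap ∘ₗ
    (braidVVV' c ∘ₗ (E₂ c).subtype.lTensor V).codRestrict _ (braidVVV'_mem c)

theorem incl_braidE₂V (c : Braiding K V) (x : E₂ c ⊗[K] V) :
    (E₂ c).subtype.lTensor V (braidE₂V c x) = braidVVV c ((E₂ c).subtype.rTensor V x) := by
  have := LinearEquiv.apply_symm_apply (LinearEquiv.ofInjective _ (lTensor_E₂_injective c))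
    ((braidVVV c ∘ₗ (E₂ c).subtype.rTensor V).codRestrict _ (braidVVV_mem c) x)
  exact congrArg Subtype.val this

theorem incl_braidVE₂ (c : Braiding K V) (x : V ⊗[K] E₂ c) :
    (E₂ c).subtype.rTensor V (braidVE₂ c x) = braidVVV' c ((E₂ c).subtype.lTensor V x) := by
  have := LinearEquiv.apply_symm_apply (LinearEquiv.ofInjective _ (rTensor_E₂_injective c))
    ((braidVVV' c ∘ₗ (E₂ c).subtype.lTensor V).codRestrict _ (braidVVV'_mem c) x)
  exact congrArg Subtype.val this

/-- A quadratic bracket (Qbracket) on a braided vector space `(V,c)`. -/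
structure QBracket (c : Braiding K V) where
  /-- The underlying linear map `E₂(V,c) → V`. -/
  map : E₂ c →ₗ[K] V
  left_compat : c.map ∘ₗ map.rTensor V = map.lTensor V ∘ₗ braidE₂V c
  right_compat : c.map ∘ₗ map.lTensor V = map.rTensor V ∘ₗ braidVE₂ c

/-- The zero Qbracket. -/
instance (c : Braiding K V) : Zero (QBracket c) where
  zero :=
    { map := 0
      left_compat := by simp
      right_compat := by simp }

theorem QBracket.zero_map (c : Braiding K V) : (0 : QBracket c).map = 0 := rfl

/-! ### Braiding and comultiplication on an algebra generated by `V` -/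

section Generic

variable {A : Type*} [Ring A] [Algebra K A]

/-- The map `V ⊗ V → A`, `v ⊗ w ↦ i v * i w`. -/
noncomputable def pairMul (i : V →ₗ[K] A) : V ⊗[K] V →ₗ[K] A :=
  LinearMap.mul' K A ∘ₗ TensorProduct.map i i

/-- `a ⊗ (w ⊗ v) ↦ (a * i w) ⊗ v`. -/
noncomputable def absorbLeft {M : Type*} {N : Type*} [AddCommGroup M] [Module K M]
    [AddCommGroup N] [Module K N] (i : M →ₗ[K] A) :
    A ⊗[K] (M ⊗[K] N) →ₗ[K] A ⊗[K] N :=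
  (LinearMap.mul' K A ∘ₗ i.lTensor A).rTensor N ∘ₗ
    (TensorProduct.assoc K A M N).symm.toLinearMap

/-- `(a ⊗ v) ⊗ b ↦ a ⊗ (i v * b)`. -/
noncomputable def absorbRight {M : Type*} [AddCommGroup M] [Module K M] (i : M →ₗ[K] A) :
    (A ⊗[K] M) ⊗[K] A →ₗ[K] A ⊗[K] A :=
  (LinearMap.mul' K A ∘ₗ i.rTensor A).lTensor A ∘ₗ
    (TensorProduct.assoc K A M A).toLinearMap

/-- For `w : V`, the operator `a ⊗ v ↦ (a ⊗ 1) (i ⊗ V) (c (v ⊗ w))` on `A ⊗ V`. -/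
noncomputable def moveV (c : Braiding K V) (i : V →ₗ[K] A) :
    V →ₗ[K] Module.End K (A ⊗[K] V) :=
  LinearMap.llcomp K (A ⊗[K] V) ((A ⊗[K] V) ⊗[K] V) (A ⊗[K] V)
      (absorbLeft i ∘ₗ c.map.lTensor A ∘ₗ (TensorProduct.assoc K A V V).toLinearMap) ∘ₗ
    (TensorProduct.mk K (A ⊗[K] V) V).flip

/-- The operators `moveV`, as elements of the opposite algebra. -/
noncomputable def opMoveV (c : Braiding K V) (i : V →ₗ[K] A) :
    V →ₗ[K] (Module.End K (A ⊗[K] V))ᵐᵒᵖ :=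
  (MulOpposite.opLinearEquiv K).toLinearMap ∘ₗ moveV c i

/-- The braiding `V ⊗ A → A ⊗ V`, `v ⊗ a ↦ κ a (1 ⊗ v)`, obtained from the action `κ` of `A` on
`A ⊗ V` (from the right) which extends `moveV`. -/
noncomputable def braidVOf (κ : A →ₐ[K] (Module.End K (A ⊗[K] V))ᵐᵒᵖ) :
    V →ₗ[K] A →ₗ[K] A ⊗[K] V :=
  LinearMap.flip
    ((LinearMap.lcomp K (A ⊗[K] V) (TensorProduct.mk K A V 1)) ∘ₗ
      (MulOpposite.opLinearEquiv K).symm.toLinearMap ∘ₗ κ.toLinearMap)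

/-- For `v : V`, the operator `a ⊗ b ↦ c (v ⊗ a) (1 ⊗ b)` on `A ⊗ A`. -/
noncomputable def crossV (i : V →ₗ[K] A) (γ : V →ₗ[K] A →ₗ[K] A ⊗[K] V) :
    V →ₗ[K] Module.End K (A ⊗[K] A) :=
  LinearMap.llcomp K (A ⊗[K] A) ((A ⊗[K] V) ⊗[K] A) (A ⊗[K] A) (absorbRight i) ∘ₗ
    LinearMap.rTensorHom A ∘ₗ γ

/-- For `v : V`, the operator on `A ⊗ A` of left multiplication by `v ⊗ 1 + 1 ⊗ v` with respect to
the braided product `(m ⊗ m) (A ⊗ c ⊗ A)`, that is `a ⊗ b ↦ v a ⊗ b + c (v ⊗ a) (1 ⊗ b)`. -/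
noncomputable def primV (i : V →ₗ[K] A) (γ : V →ₗ[K] A →ₗ[K] A ⊗[K] V) :
    V →ₗ[K] Module.End K (A ⊗[K] A) :=
  LinearMap.rTensorHom A ∘ₗ LinearMap.mul K A ∘ₗ i + crossV i γ

@[simp] theorem pairMul_tmul (i : V →ₗ[K] A) (v w : V) : pairMul i (v ⊗ₜ w) = i v * i w := rfl

@[simp] theorem absorbLeft_tmul {M : Type*} {N : Type*} [AddCommGroup M] [Module K M]
    [AddCommGroup N] [Module K N] (i : M →ₗ[K] A) (a : A) (m : M) (n : N) :
    absorbLeft i (a ⊗ₜ[K] (m ⊗ₜ[K] n)) = (a * i m) ⊗ₜ n := rfl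

@[simp] theorem absorbRight_tmul {M : Type*} [AddCommGroup M] [Module K M] (i : M →ₗ[K] A)
    (a : A) (m : M) (b : A) :
    absorbRight i ((a ⊗ₜ[K] m) ⊗ₜ[K] b) = a ⊗ₜ (i m * b) := rfl

@[simp] theorem moveV_tmul (c : Braiding K V) (i : V →ₗ[K] A) (w : V) (a : A) (v : V) :
    moveV c i w (a ⊗ₜ v) = absorbLeft i (a ⊗ₜ c.map (v ⊗ₜ w)) := rfl

theorem unop_opMoveV (c : Braiding K V) (i : V →ₗ[K] A) (w : V) :
    (opMoveV c i w).unop = moveV c i w := rfl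

theorem braidVOf_apply (κ : A →ₐ[K] (Module.End K (A ⊗[K] V))ᵐᵒᵖ) (v : V) (a : A) :
    braidVOf κ v a = (κ a).unop (1 ⊗ₜ v) := rfl

@[simp] theorem crossV_tmul (i : V →ₗ[K] A) (γ : V →ₗ[K] A →ₗ[K] A ⊗[K] V) (v : V) (a b : A) :
    crossV i γ v (a ⊗ₜ b) = absorbRight i (γ v a ⊗ₜ b) := rfl

@[simp] theorem primV_tmul (i : V →ₗ[K] A) (γ : V →ₗ[K] A →ₗ[K] A ⊗[K] V) (v : V) (a b : A) :
    primV i γ v (a ⊗ₜ b) = (i v * a) ⊗ₜ b + absorbRight i (γ v a ⊗ₜ b) := rfl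

/-- The braiding `x ⊗ z ↦ ρ x (z ⊗ 1)` of `A` obtained from the action `ρ` of `A` on `A ⊗ A` which
extends `crossV`. -/
noncomputable def braidOf (ρ : A →ₐ[K] Module.End K (A ⊗[K] A)) : A ⊗[K] A →ₗ[K] A ⊗[K] A :=
  TensorProduct.lift
    (LinearMap.lcomp K (A ⊗[K] A) ((TensorProduct.mk K A A).flip 1) ∘ₗ ρ.toLinearMap)

/-- The comultiplication `x ↦ Φ x (1 ⊗ 1)` of `A` obtained from the action `Φ` of `A` on `A ⊗ A`
which extends `primV`. -/
noncomputable def comulOf (Φ : A →ₐ[K] Module.End K (A ⊗[K] A)) : A →ₗ[K] A ⊗[K] A :=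
  LinearMap.applyₗ (1 ⊗ₜ[K] 1) ∘ₗ Φ.toLinearMap

@[simp] theorem braidOf_tmul (ρ : A →ₐ[K] Module.End K (A ⊗[K] A)) (x z : A) :
    braidOf ρ (x ⊗ₜ z) = ρ x (z ⊗ₜ 1) := rfl

@[simp] theorem comulOf_apply (Φ : A →ₐ[K] Module.End K (A ⊗[K] A)) (x : A) :
    comulOf Φ x = Φ x (1 ⊗ₜ 1) := rfl

end Generic

/-! ### The tensor algebra `T(V,c)` -/

/-- The right action of `T` on `T ⊗ V` given by `(a ⊗ v) x = (a ⊗ 1) c (v ⊗ x)`. -/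
noncomputable def moveT (c : Braiding K V) :
    TensorAlgebra K V →ₐ[K] (Module.End K (TensorAlgebra K V ⊗[K] V))ᵐᵒᵖ :=
  TensorAlgebra.lift K (opMoveV c (TensorAlgebra.ι K))

/-- The braiding `c_{V,T} : V ⊗ T → T ⊗ V`. -/
noncomputable def braidVT (c : Braiding K V) :
    V →ₗ[K] TensorAlgebra K V →ₗ[K] TensorAlgebra K V ⊗[K] V :=
  braidVOf (moveT c)

/-- The action of `T` on `T ⊗ T` given by `x (a ⊗ b) = c (x ⊗ a) (1 ⊗ b)`. -/
noncomputable def crossT (c : Braiding K V) :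
    TensorAlgebra K V →ₐ[K] Module.End K (TensorAlgebra K V ⊗[K] TensorAlgebra K V) :=
  TensorAlgebra.lift K (crossV (TensorAlgebra.ι K) (braidVT c))

/-- The action of `T` on `T ⊗ T` for which `v : V` acts as left multiplication by
`v ⊗ 1 + 1 ⊗ v` with respect to the braided product. -/
noncomputable def primT (c : Braiding K V) :
    TensorAlgebra K V →ₐ[K] Module.End K (TensorAlgebra K V ⊗[K] TensorAlgebra K V) :=
  TensorAlgebra.lift K (primV (TensorAlgebra.ι K) (braidVT c))

/-- The braiding of `T(V,c)`: the extension of `c` compatible with multiplication and unit. -/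
noncomputable def braidT (c : Braiding K V) :
    TensorAlgebra K V ⊗[K] TensorAlgebra K V →ₗ[K] TensorAlgebra K V ⊗[K] TensorAlgebra K V :=
  braidOf (crossT c)

/-- The comultiplication of `T(V,c)`: multiplicative for the braided product of `T ⊗ T`, with the
elements of `V` primitive. -/
noncomputable def comulT (c : Braiding K V) :
    TensorAlgebra K V →ₗ[K] TensorAlgebra K V ⊗[K] TensorAlgebra K V :=
  comulOf (primT c)

/-- The counit of `T(V,c)`. -/
noncomputable def counitT (_ : Braiding K V) : TensorAlgebra K V →ₐ[K] K :=
  TensorAlgebra.lift K 0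

/-! ### The quadratic universal enveloping algebra -/

/-- The two-sided ideal of `T(V,c)` generated by `(Id - β) [E₂(V,c)]`. -/
noncomputable def uqIdeal (c : Braiding K V) (β : QBracket c) : TwoSidedIdeal (TensorAlgebra K V) :=
  TwoSidedIdeal.span
    (Set.range fun z : E₂ c =>
      pairMul (TensorAlgebra.ι K) (z : V ⊗[K] V) - TensorAlgebra.ι K (β.map z))

/-- The quadratic universal enveloping algebra
`U_Q(V,c,β) = T(V,c) / ((Id - β) [E₂(V,c)])`. -/
def UQ (c : Braiding K V) (β : QBracket c) : Type (max u v) := (uqIdeal c β).ringCon.Quotient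

noncomputable instance (c : Braiding K V) (β : QBracket c) : Ring (UQ c β) :=
  inferInstanceAs (Ring (uqIdeal c β).ringCon.Quotient)

noncomputable instance (c : Braiding K V) (β : QBracket c) : Algebra K (UQ c β) :=
  inferInstanceAs (Algebra K (uqIdeal c β).ringCon.Quotient)

namespace UQ

variable (c : Braiding K V) (β : QBracket c)

/-- The canonical projection `π : T(V,c) → U_Q(V,c,β)`. -/
noncomputable def proj : TensorAlgebra K V →ₐ[K] UQ c β := (uqIdeal c β).ringCon.mkₐ (α := K)

/-- The canonical map `i : V → U_Q(V,c,β)`. -/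
noncomputable def incl : V →ₗ[K] UQ c β := (proj c β).toLinearMap ∘ₗ TensorAlgebra.ι K

theorem proj_ι (v : V) : proj c β (TensorAlgebra.ι K v) = incl c β v := rfl

theorem proj_surjective : Function.Surjective (proj c β) :=
  RingCon.mkₐ_surjective (α := K) (uqIdeal c β).ringCon

theorem pairMul_comp {A B : Type*} [Ring A] [Algebra K A] [Ring B] [Algebra K B]
    (f : A →ₐ[K] B) (i : V →ₗ[K] A) (z : V ⊗[K] V) :
    f (pairMul i z) = pairMul (f.toLinearMap ∘ₗ i) z := by
  induction z with
  | zero => simp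
  | add a b ha hb => simp only [map_add, ha, hb]
  | tmul v w => simp

theorem pairMul_incl (z : E₂ c) : pairMul (incl c β) (z : V ⊗[K] V) = incl c β (β.map z) := by
  have h : pairMul (TensorAlgebra.ι K) (z : V ⊗[K] V) - TensorAlgebra.ι K (β.map z) ∈
      uqIdeal c β := TwoSidedIdeal.subset_span ⟨z, rfl⟩
  have h2 : proj c β (pairMul (TensorAlgebra.ι K) (z : V ⊗[K] V)) =
      proj c β (TensorAlgebra.ι K (β.map z)) :=
    ((uqIdeal c β).ringCon.eq).2 ((TwoSidedIdeal.rel_iff _ _ _).2 h)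
  rw [pairMul_comp] at h2
  exact h2

variable {c β}

/-- The universal property of `U_Q(V,c,β)`. -/
noncomputable def lift {B : Type*} [Ring B] [Algebra K B] (f : V →ₗ[K] B)
    (hf : ∀ z : E₂ c, pairMul f (z : V ⊗[K] V) = f (β.map z)) : UQ c β →ₐ[K] B :=
  (uqIdeal c β).ringCon.liftₐ (TensorAlgebra.lift K f) (by
    have h : uqIdeal c β ≤ TwoSidedIdeal.ker (TensorAlgebra.lift K f) := by
      refine TwoSidedIdeal.span_le.2 ?_
      rintro _ ⟨z, rfl⟩
      rw [SetLike.mem_coe, TwoSidedIdeal.mem_ker, map_sub, pairMul_comp, TensorAlgebra.lift_ι_apply,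
        sub_eq_zero, ← hf z, TensorAlgebra.ι_comp_lift]
    intro x y hxy
    have := h ((TwoSidedIdeal.rel_iff _ _ _).1 hxy)
    rw [TwoSidedIdeal.mem_ker, map_sub, sub_eq_zero] at this
    exact this)

theorem lift_proj {B : Type*} [Ring B] [Algebra K B] (f : V →ₗ[K] B)
    (hf : ∀ z : E₂ c, pairMul f (z : V ⊗[K] V) = f (β.map z)) (t : TensorAlgebra K V) :
    lift (β := β) f hf (proj c β t) = TensorAlgebra.lift K f t := rfl

@[simp] theorem lift_incl {B : Type*} [Ring B] [Algebra K B] (f : V →ₗ[K] B)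
    (hf : ∀ z : E₂ c, pairMul f (z : V ⊗[K] V) = f (β.map z)) (v : V) :
    lift (β := β) f hf (incl c β v) = f v := by
  rw [← proj_ι, lift_proj, TensorAlgebra.lift_ι_apply]

/-- `U_Q` is the span of `1` under right multiplications by elements of `V`. -/
theorem mem_of_mul_right (p : Submodule K (UQ c β)) (h1 : 1 ∈ p)
    (hmul : ∀ a ∈ p, ∀ v, a * incl c β v ∈ p) (a : UQ c β) : a ∈ p := by
  suffices h : ∀ t : TensorAlgebra K V, ∀ a ∈ p, a * proj c β t ∈ p by
    obtain ⟨t, rfl⟩ := proj_surjective c β a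
    simpa using h t 1 h1
  intro t
  induction t using TensorAlgebra.induction with
  | algebraMap r =>
    intro a ha
    rw [AlgHom.commutes, ← Algebra.commutes, ← Algebra.smul_def]
    exact p.smul_mem r ha
  | ι v => exact fun a ha => hmul a ha v
  | mul x y hx hy =>
    intro a ha
    rw [map_mul, ← mul_assoc]
    exact hy _ (hx a ha)
  | add x y hx hy =>
    intro a ha
    rw [map_add, mul_add]
    exact p.add_mem (hx a ha) (hy a ha)

end UQ

section Relations

variable {A : Type*} [Ring A] [Algebra K A] {c : Braiding K V} {β : QBracket c}

theorem moveV_moveV (i : V →ₗ[K] A) (t : V ⊗[K] V) (a : A) (v : V) :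
    (pairMul (A := (Module.End K (A ⊗[K] V))ᵐᵒᵖ) (opMoveV c i) t).unop (a ⊗ₜ v) =
      absorbLeft (pairMul i) (a ⊗ₜ braidVVV' c (v ⊗ₜ t)) := by
  induction t with
  | zero => simp
  | add s t hs ht =>
    simp only [map_add, MulOpposite.unop_add, LinearMap.add_apply, hs, ht, TensorProduct.tmul_add]
  | tmul w w' =>
    have key : ∀ y : V ⊗[K] V, moveV c i w' (absorbLeft i (a ⊗ₜ y)) =
        absorbLeft (pairMul i) (a ⊗ₜ (TensorProduct.assoc K V V V).symm
          (leg₂ c.map (TensorProduct.assoc K V V V (y ⊗ₜ w')))) := by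
      intro y
      induction y with
      | zero => simp
      | add s t hs ht => simp only [map_add, hs, ht, TensorProduct.tmul_add, TensorProduct.add_tmul]
      | tmul y₁ y₂ =>
        simp only [absorbLeft_tmul, moveV_tmul, TensorProduct.assoc_tmul, leg₂,
          LinearMap.lTensor_tmul]
        generalize c.map (y₂ ⊗ₜ w') = y
        induction y with
        | zero => simp
        | add s t hs ht => simp only [map_add, hs, ht, TensorProduct.tmul_add]
        | tmul y₁ y₂ => simp [mul_assoc]
    exact key _

theorem absorbLeft_comp {M M' N : Type*} [AddCommGroup M] [Module K M] [AddCommGroup M']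
    [Module K M'] [AddCommGroup N] [Module K N] (i : M →ₗ[K] A) (f : M' →ₗ[K] M) (a : A)
    (y : M' ⊗[K] N) :
    absorbLeft i (a ⊗ₜ f.rTensor N y) = absorbLeft (i ∘ₗ f) (a ⊗ₜ y) := by
  induction y with
  | zero => simp
  | add s t hs ht => simp only [map_add, hs, ht, TensorProduct.tmul_add]
  | tmul y₁ y₂ => simp

theorem absorbRight_comp {M M' : Type*} [AddCommGroup M] [Module K M] [AddCommGroup M']
    [Module K M'] (i : M →ₗ[K] A) (f : M' →ₗ[K] M) (y : A ⊗[K] M') (b : A) :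
    absorbRight i (f.lTensor A y ⊗ₜ b) = absorbRight (i ∘ₗ f) (y ⊗ₜ b) := by
  induction y with
  | zero => simp
  | add s t hs ht => simp only [map_add, hs, ht, TensorProduct.add_tmul]
  | tmul y₁ y₂ => simp

theorem moveV_rel (i : V →ₗ[K] A)
    (hi : ∀ z : E₂ c, pairMul i (z : V ⊗[K] V) = i (β.map z)) (z : E₂ c) :
    pairMul (A := (Module.End K (A ⊗[K] V))ᵐᵒᵖ) (opMoveV c i) (z : V ⊗[K] V) =
      (opMoveV c i) (β.map z) := by
  apply MulOpposite.unop_injective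
  refine TensorProduct.ext' fun a v => ?_
  rw [moveV_moveV]
  have h1 : v ⊗ₜ[K] (z : V ⊗[K] V) = (E₂ c).subtype.lTensor V (v ⊗ₜ z) := rfl
  have h2 : pairMul i ∘ₗ (E₂ c).subtype = i ∘ₗ β.map := LinearMap.ext hi
  rw [h1, ← incl_braidVE₂, absorbLeft_comp, h2, ← absorbLeft_comp]
  have h3 := LinearMap.congr_fun β.right_compat (v ⊗ₜ z)
  simp only [LinearMap.comp_apply] at h3
  rw [← h3]
  rfl

end Relations

namespace UQ

variable (c : Braiding K V) (β : QBracket c)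

/-- The right action of `U = U_Q` on `U ⊗ V` given by `(a ⊗ v) x = (a ⊗ 1) c (v ⊗ x)`. -/
noncomputable def move : UQ c β →ₐ[K] (Module.End K (UQ c β ⊗[K] V))ᵐᵒᵖ :=
  lift (B := (Module.End K (UQ c β ⊗[K] V))ᵐᵒᵖ) (opMoveV c (incl c β))
    (moveV_rel _ (pairMul_incl c β))

/-- The braiding `c_{V,U} : V ⊗ U → U ⊗ V`. -/
noncomputable def braidV : V →ₗ[K] UQ c β →ₗ[K] UQ c β ⊗[K] V := braidVOf (move c β)

theorem move_incl (w : V) : (move c β (incl c β w)).unop = moveV c (incl c β) w := by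
  rw [move, lift_incl]; rfl

theorem braidV_one (v : V) : braidV c β v 1 = 1 ⊗ₜ v := by
  rw [braidV, braidVOf_apply, map_one]; rfl

theorem braidV_mul_incl (v : V) (a : UQ c β) (w : V) :
    braidV c β v (a * incl c β w) = moveV c (incl c β) w (braidV c β v a) := by
  rw [braidV, braidVOf_apply, map_mul, MulOpposite.unop_mul, move_incl]; rfl

/-- The braiding of `V ⊗ V` with `U`, as a map `(V ⊗ V) → U → U ⊗ (V ⊗ V)`. -/
noncomputable def braidVV (a : UQ c β) : V ⊗[K] V →ₗ[K] UQ c β ⊗[K] (V ⊗[K] V) :=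
  (TensorProduct.assoc K (UQ c β) V V).toLinearMap ∘ₗ
    (TensorProduct.lift (braidV c β)).rTensor V ∘ₗ
    (TensorProduct.assoc K V (UQ c β) V).symm.toLinearMap ∘ₗ
    ((braidV c β).flip a).lTensor V

/-- `(a ⊗ y) ↦ (a ⊗ 1) c (y ⊗ w)` on `U ⊗ (V ⊗ V)`. -/
noncomputable def moveVV (w : V) :
    UQ c β ⊗[K] (V ⊗[K] V) →ₗ[K] UQ c β ⊗[K] (V ⊗[K] V) :=
  absorbLeft (incl c β) ∘ₗ (braidVVV c ∘ₗ (TensorProduct.mk K (V ⊗[K] V) V).flip w).lTensor _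

theorem braidVV_one (t : V ⊗[K] V) : braidVV c β 1 t = 1 ⊗ₜ t := by
  induction t with
  | zero => simp
  | add s t hs ht => simp only [map_add, hs, ht, TensorProduct.tmul_add]
  | tmul v w => simp [braidVV, braidV_one]

theorem braidVV_mul_incl (a : UQ c β) (w : V) (t : V ⊗[K] V) :
    braidVV c β (a * incl c β w) t = moveVV c β w (braidVV c β a t) := by
  induction t with
  | zero => simp
  | add s t hs ht => simp only [map_add, hs, ht]
  | tmul v v' =>
    simp only [braidVV, LinearMap.comp_apply, LinearMap.lTensor_tmul, LinearMap.flip_apply,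
      braidV_mul_incl, LinearEquiv.coe_coe]
    generalize braidV c β v' a = y
    induction y with
    | zero => simp
    | add s t hs ht => simp only [map_add, hs, ht, TensorProduct.tmul_add]
    | tmul b u =>
      simp only [moveV_tmul, TensorProduct.assoc_symm_tmul, LinearMap.rTensor_tmul,
        TensorProduct.lift.tmul]
      have h1 : ∀ y : V ⊗[K] V,
          TensorProduct.assoc K (UQ c β) V V ((TensorProduct.lift (braidV c β)).rTensor V
            ((TensorProduct.assoc K V (UQ c β) V).symm
              (v ⊗ₜ absorbLeft (incl c β) (b ⊗ₜ y)))) =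
          absorbLeft (incl c β) ((TensorProduct.assoc K (UQ c β) V (V ⊗[K] V))
            (((LinearMap.id : UQ c β ⊗[K] V →ₗ[K] UQ c β ⊗[K] V)) (braidV c β v b) ⊗ₜ y) |>
            (leg₁ c.map).lTensor (UQ c β)) := by
        intro y
        induction y with
        | zero => simp
        | add s t hs ht => simp only [map_add, hs, ht, TensorProduct.tmul_add]
        | tmul y₁ y₂ =>
          simp only [absorbLeft_tmul, TensorProduct.assoc_symm_tmul, LinearMap.rTensor_tmul,
            TensorProduct.lift.tmul, braidV_mul_incl, LinearMap.id_apply]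
          generalize braidV c β v b = x
          induction x with
          | zero => simp
          | add s t hs ht => simp only [map_add, hs, ht, TensorProduct.add_tmul]
          | tmul x₁ x₂ =>
            simp only [moveV_tmul, TensorProduct.assoc_tmul, LinearMap.lTensor_tmul, leg₁,
              LinearMap.comp_apply, LinearEquiv.coe_coe, TensorProduct.assoc_symm_tmul,
              LinearMap.rTensor_tmul]
            generalize c.map (x₂ ⊗ₜ y₁) = q
            induction q with
            | zero => simp
            | add s t hs ht => simp only [map_add, hs, ht, TensorProduct.add_tmul,
                TensorProduct.tmul_add]
            | tmul q₁ q₂ => simp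
      rw [h1]
      simp only [LinearMap.id_apply]
      generalize braidV c β v b = x
      induction x with
      | zero => simp
      | add s t hs ht => simp only [map_add, hs, ht, TensorProduct.add_tmul]
      | tmul x₁ x₂ => simp [moveVV, braidVVV, leg₂]

/-- The braiding of `U` with the relations: `c_{V ⊗ V, U}` maps `E₂ ⊗ U` to `U ⊗ E₂`, compatibly
with the bracket. -/
theorem braid_rel (a : UQ c β) : ∀ z : E₂ c, ∃ y : UQ c β ⊗[K] E₂ c,
    braidVV c β a z = (E₂ c).subtype.lTensor _ y ∧
      braidV c β (β.map z) a = β.map.lTensor _ y := by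
  have hlin : ∀ w : V, ∀ y : UQ c β ⊗[K] E₂ c, ∃ y' : UQ c β ⊗[K] E₂ c,
      moveVV c β w ((E₂ c).subtype.lTensor _ y) = (E₂ c).subtype.lTensor _ y' ∧
        moveV c (incl c β) w (β.map.lTensor _ y) = β.map.lTensor _ y' := by
    intro w y
    refine ⟨absorbLeft (incl c β)
      ((braidE₂V c ∘ₗ (TensorProduct.mk K (E₂ c) V).flip w).lTensor _ y), ?_, ?_⟩
    · induction y with
      | zero => simp
      | add s t hs ht => simp only [map_add, hs, ht]
      | tmul b z =>
        have h := incl_braidE₂V c (z ⊗ₜ w)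
        simp only [LinearMap.rTensor_tmul] at h
        simp only [moveVV, LinearMap.comp_apply, LinearMap.lTensor_tmul, LinearMap.flip_apply,
          TensorProduct.mk_apply, ← h]
        generalize braidE₂V c (z ⊗ₜ w) = q
        induction q with
        | zero => simp
        | add s t hs ht => simp only [map_add, hs, ht, TensorProduct.tmul_add]
        | tmul q₁ q₂ => simp
    · induction y with
      | zero => simp
      | add s t hs ht => simp only [map_add, hs, ht]
      | tmul b z =>
        have h := LinearMap.congr_fun β.left_compat (z ⊗ₜ w)
        simp only [LinearMap.comp_apply, LinearMap.rTensor_tmul] at h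
        simp only [LinearMap.comp_apply, LinearMap.lTensor_tmul, LinearMap.flip_apply,
          TensorProduct.mk_apply, moveV_tmul, h]
        generalize braidE₂V c (z ⊗ₜ w) = q
        induction q with
        | zero => simp
        | add s t hs ht => simp only [map_add, hs, ht, TensorProduct.tmul_add]
        | tmul q₁ q₂ => simp
  let p : Submodule K (UQ c β) :=
    { carrier := {a | ∀ z : E₂ c, ∃ y : UQ c β ⊗[K] E₂ c,
        braidVV c β a z = (E₂ c).subtype.lTensor _ y ∧
          braidV c β (β.map z) a = β.map.lTensor _ y}
      zero_mem' := fun z => ⟨0, by simp [braidVV], by simp⟩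
      add_mem' := by
        intro a b ha hb z
        obtain ⟨y, hy, hy'⟩ := ha z
        obtain ⟨x, hx, hx'⟩ := hb z
        refine ⟨y + x, ?_, by simp only [map_add, hy', hx']⟩
        rw [map_add, ← hy, ← hx]
        simp [braidVV, LinearMap.lTensor_add]
      smul_mem' := by
        intro r a ha z
        obtain ⟨y, hy, hy'⟩ := ha z
        refine ⟨r • y, ?_, by simp only [map_smul, hy']⟩
        rw [map_smul, ← hy]
        simp [braidVV, LinearMap.lTensor_smul] }
  refine mem_of_mul_right p (fun z => ⟨1 ⊗ₜ z, ?_, ?_⟩) (fun a ha w z => ?_) a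
  · rw [braidVV_one]; rfl
  · rw [braidV_one]; rfl
  · obtain ⟨y, hy, hy'⟩ := ha z
    obtain ⟨y', h1, h2⟩ := hlin w y
    exact ⟨y', by rw [braidVV_mul_incl, hy, h1], by rw [braidV_mul_incl, hy', h2]⟩

theorem crossV_crossV (t : V ⊗[K] V) (a b : UQ c β) :
    pairMul (crossV (incl c β) (braidV c β)) t (a ⊗ₜ b) =
      absorbRight (pairMul (incl c β)) (braidVV c β a t ⊗ₜ b) := by
  induction t with
  | zero => simp
  | add s t hs ht => simp only [map_add, LinearMap.add_apply, hs, ht, TensorProduct.add_tmul]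
  | tmul v w =>
    simp only [pairMul_tmul, Module.End.mul_apply, crossV_tmul, braidVV, LinearMap.comp_apply,
      LinearMap.lTensor_tmul, LinearMap.flip_apply, LinearEquiv.coe_coe]
    generalize braidV c β w a = y
    induction y with
    | zero => simp
    | add s t hs ht => simp only [map_add, hs, ht, TensorProduct.add_tmul, TensorProduct.tmul_add]
    | tmul y₁ y₂ =>
      simp only [absorbRight_tmul, crossV_tmul, TensorProduct.assoc_symm_tmul,
        LinearMap.rTensor_tmul, TensorProduct.lift.tmul]
      generalize braidV c β v y₁ = x
      induction x with
      | zero => simp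
      | add s t hs ht => simp only [map_add, hs, ht, TensorProduct.add_tmul]
      | tmul x₁ x₂ => simp [mul_assoc]

theorem crossV_rel (z : E₂ c) :
    pairMul (crossV (incl c β) (braidV c β)) (z : V ⊗[K] V) =
      crossV (incl c β) (braidV c β) (β.map z) := by
  refine TensorProduct.ext' fun a b => ?_
  obtain ⟨y, hy, hy'⟩ := braid_rel c β a z
  have h2 : pairMul (incl c β) ∘ₗ (E₂ c).subtype = incl c β ∘ₗ β.map :=
    LinearMap.ext (pairMul_incl c β)
  rw [crossV_crossV, hy, crossV_tmul, hy', absorbRight_comp, absorbRight_comp, h2]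

/-- The action of `U` on `U ⊗ U` given by `x (a ⊗ b) = c (x ⊗ a) (1 ⊗ b)`. -/
noncomputable def cross : UQ c β →ₐ[K] Module.End K (UQ c β ⊗[K] UQ c β) :=
  lift (crossV (incl c β) (braidV c β)) (crossV_rel c β)

theorem move_left_linear (a x : UQ c β) (y : UQ c β ⊗[K] V) :
    (move c β a).unop ((LinearMap.mul K (UQ c β) x).rTensor V y) =
      (LinearMap.mul K (UQ c β) x).rTensor V ((move c β a).unop y) := by
  let p : Submodule K (UQ c β) :=
    { carrier := {a | ∀ y : UQ c β ⊗[K] V,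
        (move c β a).unop ((LinearMap.mul K (UQ c β) x).rTensor V y) =
          (LinearMap.mul K (UQ c β) x).rTensor V ((move c β a).unop y)}
      zero_mem' := fun y => by simp
      add_mem' := by
        intro a b ha hb y
        simp only [map_add, MulOpposite.unop_add, LinearMap.add_apply, ha y, hb y]
      smul_mem' := by
        intro r a ha y
        simp only [map_smul, MulOpposite.unop_smul, LinearMap.smul_apply, ha y] }
  refine mem_of_mul_right p (fun y => ?_) (fun a ha w y => ?_) a y
  · simp
  · simp only [map_mul, MulOpposite.unop_mul, Module.End.mul_apply, ha y, move_incl]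
    generalize (move c β a).unop y = q
    induction q with
    | zero => simp
    | add s t hs ht => simp only [map_add, hs, ht]
    | tmul q₁ q₂ =>
      simp only [moveV_tmul, LinearMap.rTensor_tmul]
      generalize c.map (q₂ ⊗ₜ w) = q
      induction q with
      | zero => simp
      | add s t hs ht => simp only [map_add, hs, ht, TensorProduct.tmul_add]
      | tmul q₁ q₂ => simp [mul_assoc]

/-- `∑ v ⊗ w ↦ ∑ (v a ⊗ b')`, where `c (w ⊗ a) (1 ⊗ b)` has been inserted. -/
noncomputable def mulCross (t : V ⊗[K] V) : Module.End K (UQ c β ⊗[K] UQ c β) :=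
  LinearMap.mul' K (Module.End K (UQ c β ⊗[K] UQ c β))
    (TensorProduct.map (LinearMap.rTensorHom (UQ c β) ∘ₗ LinearMap.mul K (UQ c β) ∘ₗ incl c β)
      (crossV (incl c β) (braidV c β)) t)

theorem crossV_mulLeft (v w : V) (a b : UQ c β) :
    crossV (incl c β) (braidV c β) v ((incl c β w * a) ⊗ₜ b) =
      mulCross c β (c.map (v ⊗ₜ w)) (a ⊗ₜ b) := by
  have h : braidV c β v (incl c β w * a) =
      (move c β a).unop (absorbLeft (incl c β) (1 ⊗ₜ c.map (v ⊗ₜ w))) := by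
    rw [braidV, braidVOf_apply, map_mul, MulOpposite.unop_mul, Module.End.mul_apply, move_incl]
    rfl
  rw [crossV_tmul, h]
  generalize c.map (v ⊗ₜ w) = q
  induction q with
  | zero => simp [mulCross]
  | add s t hs ht =>
    simp only [map_add, TensorProduct.tmul_add, TensorProduct.add_tmul, hs, ht, mulCross,
      LinearMap.add_apply]
  | tmul q₁ q₂ =>
    have h3 : absorbLeft (incl c β) ((1 : UQ c β) ⊗ₜ (q₁ ⊗ₜ[K] q₂)) =
      (LinearMap.mul K (UQ c β) (incl c β q₁)).rTensor V (1 ⊗ₜ q₂) := by simp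
    rw [h3, move_left_linear]
    simp only [mulCross, TensorProduct.map_tmul, LinearMap.mul'_apply, Module.End.mul_apply,
      crossV_tmul, LinearMap.comp_apply]
    rw [braidV, braidVOf_apply]
    generalize (move c β a).unop (1 ⊗ₜ q₂) = y
    induction y with
    | zero => simp
    | add s t hs ht => simp only [map_add, TensorProduct.add_tmul, hs, ht]
    | tmul y₁ y₂ => simp

theorem primV_primV (t : V ⊗[K] V) (a b : UQ c β) :
    pairMul (primV (incl c β) (braidV c β)) t (a ⊗ₜ b) =
      (pairMul (incl c β) t * a) ⊗ₜ b + mulCross c β (t + c.map t) (a ⊗ₜ b) +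
        pairMul (crossV (incl c β) (braidV c β)) t (a ⊗ₜ b) := by
  induction t with
  | zero => simp [mulCross]
  | add s t hs ht =>
    simp only [map_add, LinearMap.add_apply, hs, ht, add_mul, TensorProduct.add_tmul, mulCross]
    abel
  | tmul v w =>
    have h1 : ∀ x, primV (incl c β) (braidV c β) v x =
        (LinearMap.mul K (UQ c β) (incl c β v)).rTensor _ x +
          crossV (incl c β) (braidV c β) v x := fun x => rfl
    simp only [pairMul_tmul, Module.End.mul_apply]
    rw [primV_tmul, map_add, h1, h1, crossV_mulLeft]
    simp only [mulCross, map_add, LinearMap.add_apply, TensorProduct.map_tmul,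
      LinearMap.mul'_apply, Module.End.mul_apply, crossV_tmul, LinearMap.rTensor_tmul,
      LinearMap.mul_apply', LinearMap.comp_apply, LinearMap.coe_rTensorHom, mul_assoc]
    abel

theorem primV_rel (z : E₂ c) :
    pairMul (primV (incl c β) (braidV c β)) (z : V ⊗[K] V) =
      primV (incl c β) (braidV c β) (β.map z) := by
  refine TensorProduct.ext' fun a b => ?_
  rw [primV_primV, map_E₂ c z.2, add_neg_cancel, crossV_rel, pairMul_incl, primV_tmul, crossV_tmul]
  simp [mulCross]

/-- The action of `U` on `U ⊗ U` for which `v : V` acts as left multiplication by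
`v ⊗ 1 + 1 ⊗ v` with respect to the braided product. -/
noncomputable def prim : UQ c β →ₐ[K] Module.End K (UQ c β ⊗[K] UQ c β) :=
  lift (primV (incl c β) (braidV c β)) (primV_rel c β)

/-- The braiding of `U_Q`. -/
noncomputable def braid : UQ c β ⊗[K] UQ c β →ₗ[K] UQ c β ⊗[K] UQ c β := braidOf (cross c β)

/-- The comultiplication of `U_Q`. -/
noncomputable def comul : UQ c β →ₗ[K] UQ c β ⊗[K] UQ c β := comulOf (prim c β)

/-- The counit of `U_Q`. -/
noncomputable def counit : UQ c β →ₐ[K] K := lift 0 fun z => by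
  simp [pairMul]

end UQ

/-! `U_Q(V,c,β)` is the quotient of `T(V,c)` also as regards braiding, comultiplication, counit. -/

section ProjMorphism

variable (c : Braiding K V) (β : QBracket c)

theorem absorbLeft_map {A B M N : Type*} [Ring A] [Algebra K A] [Ring B] [Algebra K B]
    [AddCommGroup M] [Module K M] [AddCommGroup N] [Module K N] (f : A →ₐ[K] B) (i : M →ₗ[K] A)
    (y : A ⊗[K] (M ⊗[K] N)) :
    f.toLinearMap.rTensor N (absorbLeft i y) =
      absorbLeft (f.toLinearMap ∘ₗ i) (f.toLinearMap.rTensor _ y) := by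
  induction y with
  | zero => simp
  | add s t hs ht => simp only [map_add, hs, ht]
  | tmul a y =>
    induction y with
    | zero => simp
    | add s t hs ht => simp only [map_add, TensorProduct.tmul_add, hs, ht]
    | tmul m n => simp

theorem absorbRight_map {A B M : Type*} [Ring A] [Algebra K A] [Ring B] [Algebra K B]
    [AddCommGroup M] [Module K M] (f : A →ₐ[K] B) (i : M →ₗ[K] A) (y : A ⊗[K] M) (b : A) :
    TensorProduct.map f.toLinearMap f.toLinearMap (absorbRight i (y ⊗ₜ b)) =
      absorbRight (f.toLinearMap ∘ₗ i) (f.toLinearMap.rTensor _ y ⊗ₜ f b) := by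
  induction y with
  | zero => simp
  | add s t hs ht => simp only [map_add, TensorProduct.add_tmul, hs, ht]
  | tmul a m => simp

theorem proj_moveT (t : TensorAlgebra K V) : ∀ y : TensorAlgebra K V ⊗[K] V,
    (UQ.proj c β).toLinearMap.rTensor V ((moveT c t).unop y) =
      (UQ.move c β (UQ.proj c β t)).unop ((UQ.proj c β).toLinearMap.rTensor V y) := by
  induction t using TensorAlgebra.induction with
  | algebraMap r =>
    intro y
    simp only [Algebra.algebraMap_eq_smul_one, map_one, MulOpposite.unop_smul,
      MulOpposite.unop_one, LinearMap.smul_apply, Module.End.one_apply, map_smul]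
  | ι w =>
    intro y
    have h : (moveT c (TensorAlgebra.ι K w)).unop = moveV c (TensorAlgebra.ι K) w := by
      rw [moveT, TensorAlgebra.lift_ι_apply]; rfl
    rw [h, UQ.proj_ι, UQ.move_incl]
    induction y with
    | zero => simp
    | add s t hs ht => simp only [map_add, hs, ht]
    | tmul a v => rw [moveV_tmul, absorbLeft_map]; rfl
  | mul x x' hx hx' =>
    intro y
    simp only [map_mul, MulOpposite.unop_mul, Module.End.mul_apply, hx', hx]
  | add x x' hx hx' =>
    intro y
    simp only [map_add, MulOpposite.unop_add, LinearMap.add_apply, hx', hx]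

theorem proj_braidVT (v : V) (t : TensorAlgebra K V) :
    (UQ.proj c β).toLinearMap.rTensor V (braidVT c v t) = UQ.braidV c β v (UQ.proj c β t) := by
  rw [braidVT, braidVOf_apply, proj_moveT, UQ.braidV, braidVOf_apply]
  simp

theorem proj_crossT (t : TensorAlgebra K V) : ∀ y : TensorAlgebra K V ⊗[K] TensorAlgebra K V,
    TensorProduct.map (UQ.proj c β).toLinearMap (UQ.proj c β).toLinearMap (crossT c t y) =
      UQ.cross c β (UQ.proj c β t)
        (TensorProduct.map (UQ.proj c β).toLinearMap (UQ.proj c β).toLinearMap y) := by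
  induction t using TensorAlgebra.induction with
  | algebraMap r =>
    intro y
    simp only [Algebra.algebraMap_eq_smul_one, map_one, LinearMap.smul_apply,
      Module.End.one_apply, map_smul]
  | ι w =>
    intro y
    rw [crossT, TensorAlgebra.lift_ι_apply, UQ.proj_ι, UQ.cross, UQ.lift_incl]
    induction y with
    | zero => simp
    | add s t hs ht => simp only [map_add, hs, ht]
    | tmul a b =>
      rw [crossV_tmul, absorbRight_map, proj_braidVT]; rfl
  | mul x x' hx hx' =>
    intro y
    simp only [map_mul, Module.End.mul_apply, hx', hx]
  | add x x' hx hx' =>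
    intro y
    simp only [map_add, LinearMap.add_apply, hx', hx]

theorem proj_primT (t : TensorAlgebra K V) : ∀ y : TensorAlgebra K V ⊗[K] TensorAlgebra K V,
    TensorProduct.map (UQ.proj c β).toLinearMap (UQ.proj c β).toLinearMap (primT c t y) =
      UQ.prim c β (UQ.proj c β t)
        (TensorProduct.map (UQ.proj c β).toLinearMap (UQ.proj c β).toLinearMap y) := by
  induction t using TensorAlgebra.induction with
  | algebraMap r =>
    intro y
    simp only [Algebra.algebraMap_eq_smul_one, map_one, LinearMap.smul_apply,
      Module.End.one_apply, map_smul]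
  | ι w =>
    intro y
    rw [primT, TensorAlgebra.lift_ι_apply, UQ.proj_ι, UQ.prim, UQ.lift_incl]
    induction y with
    | zero => simp
    | add s t hs ht => simp only [map_add, hs, ht]
    | tmul a b =>
      rw [primV_tmul, map_add, absorbRight_map, proj_braidVT]
      simp [UQ.proj_ι]
      rfl
  | mul x x' hx hx' =>
    intro y
    simp only [map_mul, Module.End.mul_apply, hx', hx]
  | add x x' hx hx' =>
    intro y
    simp only [map_add, LinearMap.add_apply, hx', hx]

theorem UQ.comul_proj :
    UQ.comul c β ∘ₗ (UQ.proj c β).toLinearMap =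
      TensorProduct.map (UQ.proj c β).toLinearMap (UQ.proj c β).toLinearMap ∘ₗ comulT c := by
  ext t
  simp [comul, comulT, proj_primT]

theorem UQ.braid_proj :
    UQ.braid c β ∘ₗ TensorProduct.map (UQ.proj c β).toLinearMap (UQ.proj c β).toLinearMap =
      TensorProduct.map (UQ.proj c β).toLinearMap (UQ.proj c β).toLinearMap ∘ₗ braidT c := by
  refine TensorProduct.ext' fun x y => ?_
  simp [braid, braidT, proj_crossT]

theorem UQ.counit_proj (t : TensorAlgebra K V) :
    UQ.counit c β (UQ.proj c β t) = counitT c t := rfl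

end ProjMorphism

/-! ### The standard filtration -/

namespace UQ

variable (c : Braiding K V) (β : QBracket c)

/-- The `n`-th term `U'_n = π (⊕_{t ≤ n} V^{⊗ t})` of the standard filtration of `U_Q`. -/
noncomputable def fil (n : ℕ) : Submodule K (UQ c β) :=
  (⨆ (t : ℕ) (_ : t ≤ n), LinearMap.range (TensorAlgebra.ι K (M := V)) ^ t).map
    (proj c β).toLinearMap

/-- `U'_{n-1}`, with `U'_{-1} = 0`. -/
noncomputable def filPred : ℕ → Submodule K (UQ c β)
  | 0 => ⊥
  | n + 1 => fil c β n

theorem fil_eq (n : ℕ) :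
    fil c β n = (1 ⊔ LinearMap.range (incl c β)) ^ n := by
  have h : ∀ n : ℕ, (⨆ (t : ℕ) (_ : t ≤ n), LinearMap.range (TensorAlgebra.ι K (M := V)) ^ t) =
      (1 ⊔ LinearMap.range (TensorAlgebra.ι K (M := V))) ^ n := by
    intro n
    induction n with
    | zero => simp
    | succ n ih =>
      rw [pow_succ, ← ih, Submodule.mul_sup, mul_one, Submodule.iSup_mul]
      simp only [Submodule.iSup_mul, ← pow_succ]
      apply le_antisymm
      · refine iSup₂_le fun t ht => ?_
        rcases Nat.lt_or_ge t (n + 1) with h | h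
        · exact le_sup_of_le_left (le_iSup₂_of_le t (Nat.lt_succ_iff.1 h) le_rfl)
        · obtain rfl : t = n + 1 := le_antisymm ht h
          exact le_sup_of_le_right (le_iSup₂_of_le n le_rfl le_rfl)
      · refine sup_le ?_ ?_
        · exact iSup₂_le fun t ht => le_iSup₂_of_le t (by omega) le_rfl
        · exact iSup₂_le fun t ht => le_iSup₂_of_le (t + 1) (by omega) le_rfl
  rw [fil, h, Submodule.map_pow, Submodule.map_sup, Submodule.map_one, incl, LinearMap.range_comp]

theorem one_le_base : (1 : Submodule K (UQ c β)) ≤ 1 ⊔ LinearMap.range (incl c β) := le_sup_left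

theorem fil_mono {m n : ℕ} (h : m ≤ n) : fil c β m ≤ fil c β n := by
  rw [fil_eq, fil_eq]; exact pow_le_pow_right' (one_le_base c β) h

theorem fil_zero : fil c β 0 = 1 := by rw [fil_eq, pow_zero]

theorem one_mem_fil (n : ℕ) : (1 : UQ c β) ∈ fil c β n :=
  fil_mono c β (Nat.zero_le n) (by rw [fil_zero]; exact Submodule.one_le.1 le_rfl)

theorem incl_mem_fil (v : V) : incl c β v ∈ fil c β 1 := by
  rw [fil_eq, pow_one]; exact Submodule.mem_sup_right ⟨v, rfl⟩

theorem fil_mul {m n : ℕ} {x y : UQ c β} (hx : x ∈ fil c β m) (hy : y ∈ fil c β n) :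
    x * y ∈ fil c β (m + n) := by
  rw [fil_eq] at hx hy ⊢; rw [pow_add]; exact Submodule.mul_mem_mul hx hy

theorem filPred_mono {m n : ℕ} (h : m ≤ n) : filPred c β m ≤ filPred c β n := by
  cases m with
  | zero => exact bot_le
  | succ m =>
    cases n with
    | zero => omega
    | succ n => exact fil_mono c β (by omega)

theorem filPred_le (n : ℕ) : filPred c β n ≤ fil c β n := by
  cases n with
  | zero => exact bot_le
  | succ n => exact fil_mono c β (Nat.le_succ n)

theorem fil_le_filPred {m n : ℕ} (h : m < n) : fil c β m ≤ filPred c β n := by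
  cases n with
  | zero => omega
  | succ n => exact fil_mono c β (by omega)

theorem filPred_mul {m n : ℕ} {x y : UQ c β} (hx : x ∈ filPred c β m) (hy : y ∈ fil c β n) :
    x * y ∈ filPred c β (m + n) := by
  cases m with
  | zero => obtain rfl : x = 0 := hx; simp
  | succ m => exact fil_le_filPred c β (by omega) (fil_mul c β hx hy)

theorem mul_filPred {m n : ℕ} {x y : UQ c β} (hx : x ∈ fil c β m) (hy : y ∈ filPred c β n) :
    x * y ∈ filPred c β (m + n) := by
  cases n with
  | zero => obtain rfl : y = 0 := hy; simp
  | succ m => exact fil_le_filPred c β (by omega) (fil_mul c β hx hy)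

/-- Induction along the standard filtration. -/
theorem fil_induction (S : ℕ → Submodule K (UQ c β)) (h1 : 1 ∈ S 0)
    (hs : ∀ n, S n ≤ S (n + 1)) (hmul : ∀ n, ∀ a ∈ S n, ∀ v, a * incl c β v ∈ S (n + 1)) (n : ℕ) :
    fil c β n ≤ S n := by
  induction n with
  | zero => rw [fil_zero]; exact Submodule.one_le.2 h1
  | succ n ih =>
    rw [fil_eq, pow_succ, ← fil_eq, Submodule.mul_sup, mul_one]
    refine sup_le (ih.trans (hs n)) (Submodule.mul_le.2 ?_)
    rintro a ha _ ⟨v, rfl⟩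
    exact hmul n a (ih ha) v

theorem fil_induction_left (S : ℕ → Submodule K (UQ c β)) (h1 : 1 ∈ S 0)
    (hs : ∀ n, S n ≤ S (n + 1)) (hmul : ∀ n, ∀ a ∈ S n, ∀ v, incl c β v * a ∈ S (n + 1)) (n : ℕ) :
    fil c β n ≤ S n := by
  induction n with
  | zero => rw [fil_zero]; exact Submodule.one_le.2 h1
  | succ n ih =>
    rw [fil_eq, pow_succ', ← fil_eq, Submodule.sup_mul, one_mul]
    refine sup_le (ih.trans (hs n)) (Submodule.mul_le.2 ?_)
    rintro _ ⟨v, rfl⟩ a ha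
    exact hmul n a (ih ha) v

/-- The image of `P ⊗ Q` in `U ⊗ U`. -/
noncomputable def tens (P Q : Submodule K (UQ c β)) : Submodule K (UQ c β ⊗[K] UQ c β) :=
  Submodule.map₂ (TensorProduct.mk K (UQ c β) (UQ c β)) P Q

variable {c β}

theorem tmul_mem_tens {P Q : Submodule K (UQ c β)} {a b : UQ c β} (ha : a ∈ P) (hb : b ∈ Q) :
    a ⊗ₜ b ∈ tens c β P Q := Submodule.apply_mem_map₂ _ ha hb

theorem tens_le {P Q : Submodule K (UQ c β)} {R : Submodule K (UQ c β ⊗[K] UQ c β)} :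
    tens c β P Q ≤ R ↔ ∀ a ∈ P, ∀ b ∈ Q, a ⊗ₜ b ∈ R := Submodule.map₂_le

theorem tens_mono {P P' Q Q' : Submodule K (UQ c β)} (h : P ≤ P') (h' : Q ≤ Q') :
    tens c β P Q ≤ tens c β P' Q' := Submodule.map₂_le_map₂ h h'

variable (c β)

theorem tmul_mem_range {n : ℕ} {a : UQ c β} (ha : a ∈ fil c β n) (v : V) :
    a ⊗ₜ v ∈ LinearMap.range ((fil c β n).subtype.rTensor V) :=
  ⟨(⟨a, ha⟩ : fil c β n) ⊗ₜ v, LinearMap.rTensor_tmul _ _ _ _⟩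

theorem range_rTensor_le {n : ℕ} {P : Submodule K (UQ c β ⊗[K] V)}
    (h : ∀ a ∈ fil c β n, ∀ v : V, a ⊗ₜ v ∈ P) :
    LinearMap.range ((fil c β n).subtype.rTensor V) ≤ P := by
  rintro _ ⟨y, rfl⟩
  induction y with
  | zero => rw [map_zero]; exact P.zero_mem
  | add s t hs ht => rw [map_add]; exact P.add_mem hs ht
  | tmul a v => rw [LinearMap.rTensor_tmul]; exact h _ a.2 v

theorem moveV_mem (n : ℕ) (w : V) {y : UQ c β ⊗[K] V}
    (hy : y ∈ LinearMap.range ((fil c β n).subtype.rTensor V)) :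
    moveV c (incl c β) w y ∈ LinearMap.range ((fil c β (n + 1)).subtype.rTensor V) := by
  suffices h : LinearMap.range ((fil c β n).subtype.rTensor V) ≤
      (LinearMap.range ((fil c β (n + 1)).subtype.rTensor V)).comap (moveV c (incl c β) w) from h hy
  refine range_rTensor_le c β fun b hb u => ?_
  rw [Submodule.mem_comap, moveV_tmul]
  generalize c.map (u ⊗ₜ w) = q
  induction q with
  | zero => rw [TensorProduct.tmul_zero, map_zero]; exact Submodule.zero_mem _
  | add s t hs ht => rw [TensorProduct.tmul_add, map_add]; exact Submodule.add_mem _ hs ht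
  | tmul q₁ q₂ =>
    rw [absorbLeft_tmul]
    exact tmul_mem_range c β (fil_mul c β hb (incl_mem_fil c β q₁)) q₂

theorem braidV_mem (n : ℕ) {a : UQ c β} (ha : a ∈ fil c β n) (v : V) :
    braidV c β v a ∈ LinearMap.range ((fil c β n).subtype.rTensor V) := by
  refine fil_induction c β
    (fun n => (LinearMap.range ((fil c β n).subtype.rTensor V)).comap (braidV c β v)) ?_ ?_ ?_ n ha
  · rw [Submodule.mem_comap, braidV_one]
    exact tmul_mem_range c β (one_mem_fil c β 0) v
  · exact fun n => Submodule.comap_mono (range_rTensor_le c β fun a ha v =>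
      tmul_mem_range c β (fil_mono c β (Nat.le_succ n) ha) v)
  · intro n a ha w
    rw [Submodule.mem_comap, braidV_mul_incl]
    exact moveV_mem c β n w ha

theorem crossV_mem (m n : ℕ) (v : V) {x : UQ c β ⊗[K] UQ c β}
    (hx : x ∈ tens c β (fil c β m) (fil c β n)) :
    crossV (incl c β) (braidV c β) v x ∈ tens c β (fil c β m) (fil c β (n + 1)) := by
  suffices h : tens c β (fil c β m) (fil c β n) ≤
      (tens c β (fil c β m) (fil c β (n + 1))).comap (crossV (incl c β) (braidV c β) v) from h hx
  refine tens_le.2 fun a ha b hb => ?_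
  rw [Submodule.mem_comap, crossV_tmul]
  suffices h : LinearMap.range ((fil c β m).subtype.rTensor V) ≤
      (tens c β (fil c β m) (fil c β (n + 1))).comap
        (absorbRight (incl c β) ∘ₗ (TensorProduct.mk K _ _).flip b) from h (braidV_mem c β m ha v)
  refine range_rTensor_le c β fun d hd u => ?_
  rw [Submodule.mem_comap, LinearMap.comp_apply, LinearMap.flip_apply, TensorProduct.mk_apply,
    absorbRight_tmul, add_comm]
  exact tmul_mem_tens hd (fil_mul c β (incl_mem_fil c β u) hb)

theorem braid_mem {m n : ℕ} {x y : UQ c β} (hx : x ∈ fil c β m) (hy : y ∈ fil c β n) :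
    braid c β (x ⊗ₜ y) ∈ tens c β (fil c β n) (fil c β m) := by
  have key := fil_induction_left c β
    (fun m => (tens c β (fil c β n) (fil c β m)).comap
      (LinearMap.applyₗ (y ⊗ₜ[K] (1 : UQ c β)) ∘ₗ (cross c β).toLinearMap)) ?_ ?_ ?_ m hx
  · exact key
  · rw [Submodule.mem_comap, LinearMap.comp_apply, AlgHom.toLinearMap_apply, map_one]
    exact tmul_mem_tens hy (one_mem_fil c β 0)
  · exact fun k => Submodule.comap_mono (tens_mono le_rfl (fil_mono c β (Nat.le_succ k)))
  · intro k a ha v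
    rw [Submodule.mem_comap, LinearMap.comp_apply, AlgHom.toLinearMap_apply, map_mul, cross,
      lift_incl]
    exact crossV_mem c β n k v ha

/-- The subspace `∑_{i+j=n} U'_i ⊗ U'_j` of `U ⊗ U`. -/
noncomputable def filTens (n : ℕ) : Submodule K (UQ c β ⊗[K] UQ c β) :=
  ⨆ p : {p : ℕ × ℕ // p.1 + p.2 = n}, tens c β (fil c β p.1.1) (fil c β p.1.2)

theorem tens_le_filTens (i j : ℕ) :
    tens c β (fil c β i) (fil c β j) ≤ filTens c β (i + j) :=
  le_iSup (fun p : {p : ℕ × ℕ // p.1 + p.2 = i + j} => tens c β (fil c β p.1.1) (fil c β p.1.2))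
    ⟨(i, j), rfl⟩

theorem primV_mem (n : ℕ) (v : V) {x : UQ c β ⊗[K] UQ c β} (hx : x ∈ filTens c β n) :
    primV (incl c β) (braidV c β) v x ∈ filTens c β (n + 1) := by
  suffices h : filTens c β n ≤
      (filTens c β (n + 1)).comap (primV (incl c β) (braidV c β) v) from h hx
  refine iSup_le ?_
  rintro ⟨⟨i, j⟩, rfl⟩
  refine tens_le.2 fun a ha b hb => ?_
  rw [Submodule.mem_comap, primV_tmul, ← crossV_tmul]
  refine Submodule.add_mem _ ?_ ?_
  · have h : i + j + 1 = (1 + i) + j := by ring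
    rw [h]
    exact tens_le_filTens c β _ _
      (tmul_mem_tens (fil_mul c β (incl_mem_fil c β v) ha) hb)
  · exact tens_le_filTens c β i (j + 1) (crossV_mem c β i j v (tmul_mem_tens ha hb))

theorem comul_mem {n : ℕ} {x : UQ c β} (hx : x ∈ fil c β n) : comul c β x ∈ filTens c β n := by
  refine fil_induction_left c β (fun n => (filTens c β n).comap (comul c β)) ?_ ?_ ?_ n hx
  · rw [Submodule.mem_comap, comul, comulOf_apply, map_one]
    exact tens_le_filTens c β 0 0 (tmul_mem_tens (one_mem_fil c β 0) (one_mem_fil c β 0))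
  · intro k
    refine Submodule.comap_mono (iSup_le ?_)
    rintro ⟨⟨i, j⟩, rfl⟩
    exact (tens_mono le_rfl (fil_mono c β (Nat.le_succ j))).trans (tens_le_filTens c β i (j + 1))
  · intro k a ha v
    rw [Submodule.mem_comap, comul, comulOf_apply, map_mul, Module.End.mul_apply, prim, lift_incl]
    exact primV_mem c β k v ha

/-! ### The graded braided bialgebra associated to the standard filtration -/

/-- The homogeneous component `U'_n / U'_{n-1}`. -/
def GrPiece (n : ℕ) : Type (max u v) := fil c β n ⧸ (filPred c β n).submoduleOf (fil c β n)

noncomputable instance (n : ℕ) : AddCommGroup (GrPiece c β n) :=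
  inferInstanceAs (AddCommGroup (fil c β n ⧸ (filPred c β n).submoduleOf (fil c β n)))

noncomputable instance (n : ℕ) : Module K (GrPiece c β n) :=
  inferInstanceAs (Module K (fil c β n ⧸ (filPred c β n).submoduleOf (fil c β n)))

/-- `gr'(U_Q) = ⊕_n U'_n / U'_{n-1}`. -/
abbrev Gr : Type (max u v) := ⨁ n, GrPiece c β n

/-- The class in `U'_n / U'_{n-1}` of an element of `U'_n`. -/
noncomputable def cls (n : ℕ) : fil c β n →ₗ[K] GrPiece c β n :=
  Submodule.mkQ ((filPred c β n).submoduleOf (fil c β n))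

variable {c β} in
theorem cls_eq_zero {n : ℕ} {x : fil c β n} : cls c β n x = 0 ↔ (x : UQ c β) ∈ filPred c β n :=
  Submodule.Quotient.mk_eq_zero _

variable {c β} in
theorem cls_eq_cls {n : ℕ} {x y : fil c β n} (h : (x : UQ c β) = y) :
    cls c β n x = cls c β n y := by rw [Subtype.ext h]

theorem cls_surjective (n : ℕ) : Function.Surjective (cls c β n) := Submodule.mkQ_surjective _

/-- Descent of a bilinear map to quotients. -/
noncomputable def _root_.QLie.quotLift₂ {M N P : Type*} [AddCommGroup M] [Module K M]
    [AddCommGroup N] [Module K N] [AddCommGroup P] [Module K P] {p : Submodule K M}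
    {q : Submodule K N} (f : M →ₗ[K] N →ₗ[K] P) (hp : ∀ x ∈ p, ∀ y, f x y = 0)
    (hq : ∀ x, ∀ y ∈ q, f x y = 0) : M ⧸ p →ₗ[K] N ⧸ q →ₗ[K] P :=
  Submodule.liftQ p
    (LinearMap.flip (Submodule.liftQ q f.flip fun y hy => LinearMap.ext fun x => hq x y hy))
    fun x hx => LinearMap.ext fun y => by
      obtain ⟨y, rfl⟩ := Submodule.mkQ_surjective q y
      exact hp x hx y

/-- The multiplication `U'_m / U'_{m-1} × U'_n / U'_{n-1} → U'_{m+n} / U'_{m+n-1}`. -/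
noncomputable def grMul (m n : ℕ) :
    GrPiece c β m →ₗ[K] GrPiece c β n →ₗ[K] GrPiece c β (m + n) :=
  QLie.quotLift₂
    (LinearMap.mk₂ K (fun (x : fil c β m) (y : fil c β n) =>
        cls c β (m + n) ⟨(x : UQ c β) * y, fil_mul c β x.2 y.2⟩)
      (fun x x' y => by rw [← map_add]; exact cls_eq_cls (by simp [add_mul]))
      (fun r x y => by rw [← map_smul]; exact cls_eq_cls (by simp))
      (fun x y y' => by rw [← map_add]; exact cls_eq_cls (by simp [mul_add]))
      (fun r x y => by rw [← map_smul]; exact cls_eq_cls (by simp)))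
    (fun x hx y => cls_eq_zero.2 (filPred_mul c β hx y.2))
    (fun x y hy => cls_eq_zero.2 (mul_filPred c β x.2 hy))

theorem grMul_cls (m n : ℕ) (x : fil c β m) (y : fil c β n) :
    grMul c β m n (cls c β m x) (cls c β n y) =
      cls c β (m + n) ⟨(x : UQ c β) * y, fil_mul c β x.2 y.2⟩ := rfl

variable {c β} in
theorem gr_ext {m n : ℕ} (h : m = n) (x : fil c β m) (y : fil c β n) (hxy : (x : UQ c β) = y) :
    GradedMonoid.mk (A := GrPiece c β) m (cls c β m x) = GradedMonoid.mk n (cls c β n y) := by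
  subst h
  rw [cls_eq_cls hxy]

noncomputable instance : GradedMonoid.GMul (GrPiece c β) where
  mul {m n} x y := grMul c β m n x y

noncomputable instance : GradedMonoid.GOne (GrPiece c β) where
  one := cls c β 0 ⟨1, one_mem_fil c β 0⟩

noncomputable instance : GradedMonoid.GMonoid (GrPiece c β) where
  one_mul := by
    rintro ⟨n, x⟩
    obtain ⟨x, rfl⟩ := cls_surjective c β n x
    exact gr_ext (zero_add n) _ _ (one_mul _)
  mul_one := by
    rintro ⟨n, x⟩
    obtain ⟨x, rfl⟩ := cls_surjective c β n x
    exact gr_ext (add_zero n) _ _ (mul_one _)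
  mul_assoc := by
    rintro ⟨l, x⟩ ⟨m, y⟩ ⟨n, z⟩
    obtain ⟨x, rfl⟩ := cls_surjective c β l x
    obtain ⟨y, rfl⟩ := cls_surjective c β m y
    obtain ⟨z, rfl⟩ := cls_surjective c β n z
    exact gr_ext (add_assoc l m n) _ _ (mul_assoc _ _ _)

noncomputable instance : DirectSum.GRing (GrPiece c β) where
  mul_zero x := map_zero _
  zero_mul y := by exact LinearMap.congr_fun (map_zero (grMul c β _ _)) y
  mul_add x y z := map_add _ _ _
  add_mul x y z := LinearMap.congr_fun (map_add (grMul c β _ _) x y) z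
  natCast n := n • cls c β 0 ⟨1, one_mem_fil c β 0⟩
  natCast_zero := zero_smul _ _
  natCast_succ n := by rw [succ_nsmul]; rfl
  intCast n := n • cls c β 0 ⟨1, one_mem_fil c β 0⟩
  intCast_ofNat n := natCast_zsmul _ n
  intCast_negSucc_ofNat n := by rw [negSucc_zsmul]

noncomputable instance : DirectSum.GAlgebra K (GrPiece c β) where
  toFun :=
    ((LinearMap.toSpanSingleton K (GrPiece c β 0)
      (cls c β 0 ⟨1, one_mem_fil c β 0⟩)).toAddMonoidHom : K →+ GrPiece c β 0)
  map_one := one_smul K (cls c β 0 ⟨1, one_mem_fil c β 0⟩)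
  map_mul r s := by
    refine gr_ext (add_zero 0).symm ((r * s) • (⟨1, one_mem_fil c β 0⟩ : fil c β 0))
      ⟨_, fil_mul c β ((r • ⟨1, one_mem_fil c β 0⟩ : fil c β 0)).2
        ((s • ⟨1, one_mem_fil c β 0⟩ : fil c β 0)).2⟩ ?_
    simp [mul_smul, smul_comm r s]
  commutes r := by
    rintro ⟨n, x⟩
    obtain ⟨x, rfl⟩ := cls_surjective c β n x
    refine gr_ext (by simp) ⟨_, fil_mul c β ((r • ⟨1, one_mem_fil c β 0⟩ : fil c β 0)).2 x.2⟩
      ⟨_, fil_mul c β x.2 ((r • ⟨1, one_mem_fil c β 0⟩ : fil c β 0)).2⟩ ?_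
    simp
  smul_def r := by
    rintro ⟨n, x⟩
    obtain ⟨x, rfl⟩ := cls_surjective c β n x
    refine gr_ext (by simp) (r • x)
      ⟨_, fil_mul c β ((r • ⟨1, one_mem_fil c β 0⟩ : fil c β 0)).2 x.2⟩ ?_
    simp

end UQ

namespace UQ

variable (c : Braiding K V) (β : QBracket c)

/-- A linear extension to `U` of the quotient map `U'_n → U'_n / U'_{n-1}`. It is only applied
where the result does not depend on the choice of the extension. -/
noncomputable def symb (n : ℕ) : UQ c β →ₗ[K] GrPiece c β n :=
  Classical.choose (LinearMap.exists_extend (cls c β n))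

theorem symb_coe (n : ℕ) (x : fil c β n) : symb c β n x = cls c β n x :=
  LinearMap.congr_fun (Classical.choose_spec (LinearMap.exists_extend (cls c β n))) x

theorem symb_eq_zero {n : ℕ} {x : UQ c β} (hx : x ∈ filPred c β n) : symb c β n x = 0 := by
  rw [show symb c β n x = cls c β n ⟨x, filPred_le c β n hx⟩ from
    symb_coe c β n ⟨x, filPred_le c β n hx⟩]
  exact cls_eq_zero.2 hx

theorem map_symb_eq_zero_left {m n : ℕ} {P Q : Submodule K (UQ c β)} (hP : P ≤ filPred c β m)
    {w : UQ c β ⊗[K] UQ c β} (hw : w ∈ tens c β P Q) :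
    TensorProduct.map (symb c β m) (symb c β n) w = 0 := by
  suffices h : tens c β P Q ≤ LinearMap.ker (TensorProduct.map (symb c β m) (symb c β n)) from h hw
  refine tens_le.2 fun a ha b _ => ?_
  rw [LinearMap.mem_ker, TensorProduct.map_tmul, symb_eq_zero c β (hP ha), TensorProduct.zero_tmul]

theorem map_symb_eq_zero_right {m n : ℕ} {P Q : Submodule K (UQ c β)} (hQ : Q ≤ filPred c β n)
    {w : UQ c β ⊗[K] UQ c β} (hw : w ∈ tens c β P Q) :
    TensorProduct.map (symb c β m) (symb c β n) w = 0 := by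
  suffices h : tens c β P Q ≤ LinearMap.ker (TensorProduct.map (symb c β m) (symb c β n)) from h hw
  refine tens_le.2 fun a _ b hb => ?_
  rw [LinearMap.mem_ker, TensorProduct.map_tmul, symb_eq_zero c β (hQ hb), TensorProduct.tmul_zero]

theorem map_symb_filTens {i j k : ℕ} (hk : k < i + j) {w : UQ c β ⊗[K] UQ c β}
    (hw : w ∈ filTens c β k) : TensorProduct.map (symb c β i) (symb c β j) w = 0 := by
  suffices h : filTens c β k ≤ LinearMap.ker (TensorProduct.map (symb c β i) (symb c β j)) from h hw
  refine iSup_le ?_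
  rintro ⟨⟨p, q⟩, hpq⟩ w hw
  dsimp only at hpq hw
  rcases Nat.lt_or_ge p i with h | h
  · exact map_symb_eq_zero_left c β (fil_le_filPred c β h) hw
  · exact map_symb_eq_zero_right c β (fil_le_filPred c β (by omega)) hw

/-- The component `U'_m / U'_{m-1} ⊗ U'_n / U'_{n-1} → U'_n / U'_{n-1} ⊗ U'_m / U'_{m-1}` of the
braiding of `gr'(U_Q)`, induced by the braiding of `U_Q`. -/
noncomputable def grBraidPiece (m n : ℕ) :
    GrPiece c β m →ₗ[K] GrPiece c β n →ₗ[K] GrPiece c β n ⊗[K] GrPiece c β m :=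
  QLie.quotLift₂
    ((TensorProduct.mk K (UQ c β) (UQ c β)).compr₂
        (TensorProduct.map (symb c β n) (symb c β m) ∘ₗ braid c β) |>.compl₁₂
      (fil c β m).subtype (fil c β n).subtype)
    (fun x hx y => by
      have hx' : (x : UQ c β) ∈ filPred c β m := hx
      cases m with
      | zero => obtain rfl : x = 0 := Subtype.ext hx'; rw [map_zero]; rfl
      | succ m => exact map_symb_eq_zero_right c β le_rfl (braid_mem c β hx' y.2))
    (fun x y hy => by
      have hy' : (y : UQ c β) ∈ filPred c β n := hy
      cases n with
      | zero => obtain rfl : y = 0 := Subtype.ext hy'; rw [map_zero]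
      | succ n => exact map_symb_eq_zero_left c β le_rfl (braid_mem c β x.2 hy'))

/-- If `c (x ⊗ y)` is represented by `w ∈ U'_n ⊗ U'_m`, then `w` represents the value of the
braiding of `gr'(U_Q)`. -/
theorem grBraidPiece_cls {m n : ℕ} (x : fil c β m) (y : fil c β n)
    (w : fil c β n ⊗[K] fil c β m)
    (hw : TensorProduct.map (fil c β n).subtype (fil c β m).subtype w =
      braid c β ((x : UQ c β) ⊗ₜ (y : UQ c β))) :
    grBraidPiece c β m n (cls c β m x) (cls c β n y) =
      TensorProduct.map (cls c β n) (cls c β m) w := by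
  have h : grBraidPiece c β m n (cls c β m x) (cls c β n y) =
    TensorProduct.map (symb c β n) (symb c β m) (braid c β ((x : UQ c β) ⊗ₜ (y : UQ c β))) := rfl
  rw [h, ← hw, ← LinearMap.comp_apply, ← TensorProduct.map_comp]
  congr 2
  · exact LinearMap.ext (symb_coe c β n)
  · exact LinearMap.ext (symb_coe c β m)

/-- The braiding of `gr'(U_Q)`. -/
noncomputable def grBraid : Gr c β ⊗[K] Gr c β →ₗ[K] Gr c β ⊗[K] Gr c β :=
  TensorProduct.lift
    (DirectSum.toModule K ℕ _ fun m =>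
      LinearMap.flip (DirectSum.toModule K ℕ _ fun n =>
        LinearMap.flip ((grBraidPiece c β m n).compr₂
          (TensorProduct.map (DirectSum.lof K ℕ (GrPiece c β) n)
            (DirectSum.lof K ℕ (GrPiece c β) m)))))

/-- The component `U'_n / U'_{n-1} → ⊕_{i+j=n} U'_i / U'_{i-1} ⊗ U'_j / U'_{j-1}` of the
comultiplication of `gr'(U_Q)`, induced by the comultiplication of `U_Q`. -/
noncomputable def grComulPiece (n : ℕ) : GrPiece c β n →ₗ[K] Gr c β ⊗[K] Gr c β :=
  Submodule.liftQ ((filPred c β n).submoduleOf (fil c β n))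
    (∑ p ∈ Finset.HasAntidiagonal.antidiagonal n,
      TensorProduct.map (DirectSum.lof K ℕ (GrPiece c β) p.1 ∘ₗ symb c β p.1)
        (DirectSum.lof K ℕ (GrPiece c β) p.2 ∘ₗ symb c β p.2) ∘ₗ
          comul c β ∘ₗ (fil c β n).subtype)
    (fun x hx => by
      have hx' : (x : UQ c β) ∈ filPred c β n := hx
      rw [LinearMap.mem_ker, LinearMap.sum_apply]
      refine Finset.sum_eq_zero fun p hp => ?_
      rw [Finset.HasAntidiagonal.mem_antidiagonal] at hp
      rw [TensorProduct.map_comp, LinearMap.comp_apply, LinearMap.comp_apply, LinearMap.comp_apply]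
      cases n with
      | zero => obtain rfl : x = 0 := Subtype.ext hx'; simp only [map_zero]
      | succ n =>
        rw [Submodule.subtype_apply, map_symb_filTens c β (k := n) (by omega) (comul_mem c β hx'),
          map_zero])

/-- The comultiplication of `gr'(U_Q)`. -/
noncomputable def grComul : Gr c β →ₗ[K] Gr c β ⊗[K] Gr c β :=
  DirectSum.toModule K ℕ _ (grComulPiece c β)

/-- If `Δ (x)` is represented by a family `w i j ∈ U'_i ⊗ U'_j`, `i + j = n`, then this family
represents the value of the comultiplication of `gr'(U_Q)`. -/
theorem grComul_cls {n : ℕ} (x : fil c β n)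
    (w : ∀ p : ℕ × ℕ, fil c β p.1 ⊗[K] fil c β p.2)
    (hw : ∑ p ∈ Finset.HasAntidiagonal.antidiagonal n,
      TensorProduct.map (fil c β p.1).subtype (fil c β p.2).subtype (w p) =
        comul c β (x : UQ c β)) :
    grComul c β (DirectSum.lof K ℕ (GrPiece c β) n (cls c β n x)) =
      ∑ p ∈ Finset.HasAntidiagonal.antidiagonal n,
        TensorProduct.map (DirectSum.lof K ℕ (GrPiece c β) p.1 ∘ₗ cls c β p.1)
          (DirectSum.lof K ℕ (GrPiece c β) p.2 ∘ₗ cls c β p.2) (w p) := by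
  have hmem : ∀ p : ℕ × ℕ,
      TensorProduct.map (fil c β p.1).subtype (fil c β p.2).subtype (w p) ∈
        tens c β (fil c β p.1) (fil c β p.2) := by
    intro p
    generalize w p = y
    induction y with
    | zero => rw [map_zero]; exact Submodule.zero_mem _
    | add s t hs ht => rw [map_add]; exact Submodule.add_mem _ hs ht
    | tmul a b => exact tmul_mem_tens a.2 b.2
  have h : grComul c β (DirectSum.lof K ℕ (GrPiece c β) n (cls c β n x)) =
      ∑ p ∈ Finset.HasAntidiagonal.antidiagonal n,
        TensorProduct.map (DirectSum.lof K ℕ (GrPiece c β) p.1)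
          (DirectSum.lof K ℕ (GrPiece c β) p.2)
            (TensorProduct.map (symb c β p.1) (symb c β p.2) (comul c β (x : UQ c β))) := by
    rw [grComul, DirectSum.toModule_lof]
    have h1 : grComulPiece c β n (cls c β n x) = (∑ p ∈ Finset.HasAntidiagonal.antidiagonal n,
      TensorProduct.map (DirectSum.lof K ℕ (GrPiece c β) p.1 ∘ₗ symb c β p.1)
        (DirectSum.lof K ℕ (GrPiece c β) p.2 ∘ₗ symb c β p.2) ∘ₗ
          comul c β ∘ₗ (fil c β n).subtype) x := Submodule.liftQ_apply _ _ _
    rw [h1, LinearMap.sum_apply]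
    refine Finset.sum_congr rfl fun p _ => ?_
    rw [TensorProduct.map_comp]
    rfl
  rw [h]
  refine Finset.sum_congr rfl fun p hp => ?_
  rw [← hw, map_sum, Finset.sum_eq_single_of_mem p hp]
  · rw [TensorProduct.map_comp, LinearMap.comp_apply]
    congr 1
    rw [← LinearMap.comp_apply, ← TensorProduct.map_comp]
    congr 2
    · exact LinearMap.ext (symb_coe c β p.1)
    · exact LinearMap.ext (symb_coe c β p.2)
  · intro q hq hqp
    rw [Finset.HasAntidiagonal.mem_antidiagonal] at hp hq
    rcases Nat.lt_trichotomy q.1 p.1 with hlt | heq | hgt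
    · exact map_symb_eq_zero_left c β (fil_le_filPred c β hlt) (hmem q)
    · exact absurd (Prod.ext heq (by omega)) hqp
    · exact map_symb_eq_zero_right c β (fil_le_filPred c β (by omega)) (hmem q)

/-- The counit of `gr'(U_Q)`: the counit of `U_Q` on `U'_0`, and `0` in positive degrees. -/
noncomputable def grCounit : Gr c β →ₗ[K] K :=
  DirectSum.toModule K ℕ K fun n =>
    match n with
    | 0 => Submodule.liftQ ((filPred c β 0).submoduleOf (fil c β 0))
        ((counit c β).toLinearMap ∘ₗ (fil c β 0).subtype)
        (fun x hx => by
          obtain rfl : x = 0 := Subtype.ext hx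
          exact map_zero _)
    | _ + 1 => 0

/-- The grading of `gr'(U_Q)`. -/
noncomputable def grGrading (n : ℕ) : Submodule K (Gr c β) :=
  LinearMap.range (DirectSum.lof K ℕ (GrPiece c β) n)

/-- The map `θ₁ : V → U'_1 / U'_0`, `v ↦ π (v) + U'_0`, followed by the inclusion into
`gr'(U_Q)`. -/
noncomputable def theta₁ : V →ₗ[K] Gr c β :=
  DirectSum.lof K ℕ (GrPiece c β) 1 ∘ₗ cls c β 1 ∘ₗ
    (incl c β).codRestrict (fil c β 1) (incl_mem_fil c β)

theorem lof_mul_lof {m n : ℕ} (x : fil c β m) (y : fil c β n) :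
    DirectSum.lof K ℕ (GrPiece c β) m (cls c β m x) *
      DirectSum.lof K ℕ (GrPiece c β) n (cls c β n y) =
      DirectSum.lof K ℕ (GrPiece c β) (m + n)
        (cls c β (m + n) ⟨(x : UQ c β) * y, fil_mul c β x.2 y.2⟩) := by
  rw [DirectSum.lof_eq_of, DirectSum.lof_eq_of, DirectSum.lof_eq_of, DirectSum.of_mul_of]
  rfl

theorem pairMul_mem_fil (t : V ⊗[K] V) : pairMul (incl c β) t ∈ fil c β 2 := by
  induction t with
  | zero => rw [map_zero]; exact Submodule.zero_mem _
  | add s t hs ht => rw [map_add]; exact Submodule.add_mem _ hs ht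
  | tmul v w =>
    rw [pairMul_tmul]
    exact fil_mul c β (m := 1) (n := 1) (incl_mem_fil c β v) (incl_mem_fil c β w)

theorem pairMul_theta₁ (t : V ⊗[K] V) :
    pairMul (theta₁ c β) t =
      DirectSum.lof K ℕ (GrPiece c β) 2 (cls c β 2 ⟨pairMul (incl c β) t, pairMul_mem_fil c β t⟩) := by
  induction t with
  | zero =>
    have h : (⟨pairMul (incl c β) (0 : V ⊗[K] V), pairMul_mem_fil c β 0⟩ : fil c β 2) = 0 :=
      Subtype.ext (map_zero _)
    rw [h, map_zero, map_zero, map_zero]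
  | add s t hs ht =>
    have h : (⟨pairMul (incl c β) (s + t), pairMul_mem_fil c β (s + t)⟩ : fil c β 2) =
        ⟨pairMul (incl c β) s, pairMul_mem_fil c β s⟩ +
          ⟨pairMul (incl c β) t, pairMul_mem_fil c β t⟩ :=
      Subtype.ext (map_add _ _ _)
    rw [h, map_add, map_add, map_add, hs, ht]
  | tmul v w =>
    rw [pairMul_tmul]
    exact lof_mul_lof c β (m := 1) (n := 1) ⟨_, incl_mem_fil c β v⟩ ⟨_, incl_mem_fil c β w⟩

/-- The canonical map `θ : S_Q(V,c) → gr'(U_Q(V,c,β))`, the algebra map which extends `θ₁`. -/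
noncomputable def theta : UQ c 0 →ₐ[K] Gr c β :=
  lift (theta₁ c β) fun z => by
    have h : (pairMul (incl c β) (z : V ⊗[K] V)) ∈ filPred c β 2 := by
      rw [pairMul_incl]; exact incl_mem_fil c β _
    rw [pairMul_theta₁, cls_eq_zero.2 h, map_zero, QBracket.zero_map, LinearMap.zero_apply,
      map_zero]

/-- The component `π (V^{⊗ n})` of `U_Q`; for the zero bracket this is the grading of the quadratic
symmetric algebra `S_Q(V,c) = U_Q(V,c,0)`. -/
noncomputable def component (n : ℕ) : Submodule K (UQ c β) :=
  (LinearMap.range (TensorAlgebra.ι K (M := V)) ^ n).map (proj c β).toLinearMap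

/-- The subspace of primitive elements of `U_Q`. -/
noncomputable def primitives : Submodule K (UQ c β) where
  carrier := {x | comul c β x = x ⊗ₜ 1 + 1 ⊗ₜ x}
  zero_mem' := by simp
  add_mem' := by
    intro x y hx hy
    simp only [Set.mem_ofPred_eq] at hx hy ⊢
    rw [map_add, hx, hy, TensorProduct.add_tmul, TensorProduct.tmul_add]
    abel
  smul_mem' := by
    intro r x hx
    simp only [Set.mem_ofPred_eq] at hx ⊢
    rw [map_smul, hx, smul_add, TensorProduct.smul_tmul', TensorProduct.tmul_smul]

end UQ

/-- An algebra map between braided bialgebras (given by comultiplication, counit, braiding and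
grading) is an isomorphism of graded braided bialgebras. -/
structure IsGradedBraidedBialgIso {A B : Type*} [Ring A] [Algebra K A] [Ring B] [Algebra K B]
    (comulA : A →ₗ[K] A ⊗[K] A) (counitA : A →ₗ[K] K) (braidA : A ⊗[K] A →ₗ[K] A ⊗[K] A)
    (gradA : ℕ → Submodule K A)
    (comulB : B →ₗ[K] B ⊗[K] B) (counitB : B →ₗ[K] K) (braidB : B ⊗[K] B →ₗ[K] B ⊗[K] B)
    (gradB : ℕ → Submodule K B) (f : A →ₐ[K] B) : Prop where
  bijective : Function.Bijective f
  map_comul : comulB ∘ₗ f.toLinearMap = TensorProduct.map f.toLinearMap f.toLinearMap ∘ₗ comulA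
  map_counit : counitB ∘ₗ f.toLinearMap = counitA
  map_braid : braidB ∘ₗ TensorProduct.map f.toLinearMap f.toLinearMap =
    TensorProduct.map f.toLinearMap f.toLinearMap ∘ₗ braidA
  map_grading : ∀ n, (gradA n).map f.toLinearMap = gradB n

/-! ### Quantum shuffles -/

section AbstractShuffle

variable {R : Type*} [Ring R]

/-- `s k * s (k+1) * ⋯ * s (k+p-1)`. -/
def cyc (s : ℕ → R) : ℕ → ℕ → R
  | _, 0 => 1
  | k, p + 1 => s k * cyc s (k + 1) p

/-- The sum over all `(p,q)`-shuffles, acting on the positions `k, …, k+p+q-1`, of the corresponding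
positive braids in the generators `s i`: the first letter of the result is either the first of the
`p` letters, or the first of the `q` letters, which has been moved over the `p` letters. -/
def sh (s : ℕ → R) : ℕ → ℕ → ℕ → R
  | _, 0, _ => 1
  | _, _ + 1, 0 => 1
  | k, p + 1, q + 1 => sh s (k + 1) p (q + 1) + sh s (k + 1) (p + 1) q * cyc s k (p + 1)
termination_by _ p q => p + q

theorem sh_zero_left (s : ℕ → R) (k q : ℕ) : sh s k 0 q = 1 := by rw [sh]

theorem sh_zero_right (s : ℕ → R) (k p : ℕ) : sh s k p 0 = 1 := by cases p <;> rw [sh]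

theorem cyc_add (s : ℕ → R) (k p q : ℕ) : cyc s k (p + q) = cyc s k p * cyc s (k + p) q := by
  induction p generalizing k with
  | zero => simp [cyc]
  | succ p ih =>
    rw [Nat.succ_add, cyc, cyc, ih, mul_assoc, show k + 1 + p = k + (p + 1) by omega]

theorem cyc_mem (s : ℕ → R) (S : Subring R) (k p : ℕ)
    (h : ∀ i, k ≤ i → i < k + p → s i ∈ S) : cyc s k p ∈ S := by
  induction p generalizing k with
  | zero => exact S.one_mem
  | succ p ih =>
    exact S.mul_mem (h k le_rfl (by omega)) (ih (k + 1) fun i h1 h2 => h i (by omega) (by omega))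

theorem sh_mem (s : ℕ → R) (S : Subring R) (k p q : ℕ)
    (h : ∀ i, k ≤ i → i + 2 ≤ k + p + q → s i ∈ S) : sh s k p q ∈ S := by
  induction hn : p + q using Nat.strong_induction_on generalizing k p q with
  | _ n ih =>
    match p, q with
    | 0, q => rw [sh]; exact S.one_mem
    | p + 1, 0 => rw [sh]; exact S.one_mem
    | p + 1, q + 1 =>
      rw [sh]
      refine S.add_mem ?_ (S.mul_mem ?_ ?_)
      · exact ih _ (by omega) _ _ _ (fun i h1 h2 => h i (by omega) (by omega)) rfl
      · exact ih _ (by omega) _ _ _ (fun i h1 h2 => h i (by omega) (by omega)) rfl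
      · exact cyc_mem s S _ _ fun i h1 h2 => h i (by omega) (by omega)

/-- The relations of the braid group. -/
structure BraidRel (s : ℕ → R) : Prop where
  braid : ∀ i, s i * s (i + 1) * s i = s (i + 1) * s i * s (i + 1)
  comm : ∀ i j, i + 2 ≤ j → s i * s j = s j * s i

theorem BraidRel.cyc_comm {s : ℕ → R} (h : BraidRel s) (k p i : ℕ) (hi : k + p + 1 ≤ i) :
    cyc s k p * s i = s i * cyc s k p := by
  have hm : cyc s k p ∈ Subring.centralizer {s i} := cyc_mem s _ k p fun j h1 h2 => by
    rw [Subring.mem_centralizer_iff]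
    rintro _ rfl
    exact (h.comm j i (by omega)).symm
  exact ((Subring.mem_centralizer_iff.1 hm) _ rfl).symm

theorem BraidRel.comm_cyc {s : ℕ → R} (h : BraidRel s) (k p i : ℕ) (hi : i + 2 ≤ k) :
    cyc s k p * s i = s i * cyc s k p := by
  have hm : cyc s k p ∈ Subring.centralizer {s i} := cyc_mem s _ k p fun j h1 h2 => by
    rw [Subring.mem_centralizer_iff]
    rintro _ rfl
    exact h.comm i j (by omega)
  exact ((Subring.mem_centralizer_iff.1 hm) _ rfl).symm

theorem BraidRel.cyc_shift {s : ℕ → R} (h : BraidRel s) (k p i : ℕ) (hi : k ≤ i)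
    (hi' : i + 2 ≤ k + p) : cyc s k p * s i = s (i + 1) * cyc s k p := by
  induction p generalizing k with
  | zero => omega
  | succ p ih =>
    rcases Nat.eq_or_lt_of_le hi with rfl | hlt
    · obtain ⟨p, rfl⟩ : ∃ r, p = r + 1 := ⟨p - 1, by omega⟩
      rw [cyc, cyc, mul_assoc, mul_assoc, h.comm_cyc _ _ _ (by omega), ← mul_assoc, ← mul_assoc,
        h.braid, mul_assoc, mul_assoc]
    · rw [cyc, mul_assoc, ih (k + 1) (by omega) (by omega), ← mul_assoc, h.comm k (i + 1) (by omega),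
        mul_assoc]

theorem BraidRel.cyc_sh {s : ℕ → R} (h : BraidRel s) (k P a p q : ℕ) (hk : k ≤ a)
    (hP : a + p + q ≤ k + P) : cyc s k P * sh s a p q = sh s (a + 1) p q * cyc s k P := by
  induction hn : p + q using Nat.strong_induction_on generalizing a p q with
  | _ n ih =>
    match p, q with
    | 0, q => rw [sh, sh, mul_one, one_mul]
    | p + 1, 0 => rw [sh, sh, mul_one, one_mul]
    | p + 1, q + 1 =>
      have hc : ∀ r b, k ≤ b → b + r + 1 ≤ k + P →
          cyc s k P * cyc s b r = cyc s (b + 1) r * cyc s k P := by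
        intro r
        induction r with
        | zero => intro b _ _; rw [cyc, cyc, mul_one, one_mul]
        | succ r ihr =>
          intro b h1 h2
          rw [cyc, cyc, ← mul_assoc, h.cyc_shift _ _ _ h1 (by omega), mul_assoc,
            ihr (b + 1) (by omega) (by omega), mul_assoc]
      rw [sh, sh, mul_add, add_mul, ih _ (by omega) _ _ _ (by omega) (by omega) rfl, ← mul_assoc,
        ih _ (by omega) _ _ _ (by omega) (by omega) rfl, mul_assoc, hc _ _ (by omega) (by omega),
        mul_assoc]

theorem BraidRel.cyc_comm_sh {s : ℕ → R} (h : BraidRel s) (k P a p q : ℕ)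
    (ha : k + P + 1 ≤ a) : cyc s k P * sh s a p q = sh s a p q * cyc s k P := by
  have hm : sh s a p q ∈ Subring.centralizer {cyc s k P} := sh_mem s _ a p q fun j h1 h2 => by
    rw [Subring.mem_centralizer_iff]
    rintro _ rfl
    exact h.cyc_comm _ _ _ (by omega)
  exact (Subring.mem_centralizer_iff.1 hm) _ rfl

/-- Associativity of the shuffle product. -/
theorem BraidRel.sh_assoc {s : ℕ → R} (h : BraidRel s) (k p q r : ℕ) :
    sh s k (p + q) r * sh s k p q = sh s k p (q + r) * sh s (k + p) q r := by
  induction hn : p + q + r using Nat.strong_induction_on generalizing k p q r with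
  | _ n ih =>
    match p, q, r with
    | 0, q, r => simp [sh_zero_left]
    | p + 1, 0, r => simp [sh_zero_left, sh_zero_right]
    | p + 1, q + 1, 0 => simp [sh_zero_right]
    | p + 1, q + 1, r + 1 =>
      have e1 : sh s (k + 1) (p + (q + 1)) (r + 1) * sh s (k + 1) p (q + 1) =
          sh s (k + 1) p (q + 1 + (r + 1)) * sh s (k + 1 + p) (q + 1) (r + 1) :=
        ih _ (by omega) _ _ _ _ rfl
      have e2 : sh s (k + 1) (p + 1 + q) (r + 1) * sh s (k + 1) (p + 1) q =
          sh s (k + 1) (p + 1) (q + (r + 1)) * sh s (k + 1 + (p + 1)) q (r + 1) :=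
        ih _ (by omega) _ _ _ _ rfl
      have e3 : sh s (k + 1) (p + 1 + (q + 1)) r * sh s (k + 1) (p + 1) (q + 1) =
          sh s (k + 1) (p + 1) (q + 1 + r) * sh s (k + 1 + (p + 1)) (q + 1) r :=
        ih _ (by omega) _ _ _ _ rfl
      have l1 : sh s k (p + 1 + (q + 1)) (r + 1) = sh s (k + 1) (p + (q + 1)) (r + 1) +
          sh s (k + 1) (p + 1 + (q + 1)) r * cyc s k (p + 1 + (q + 1)) := by
        rw [show p + 1 + (q + 1) = (p + (q + 1)) + 1 by omega, sh]
      have l2 : sh s k (p + 1) (q + 1) =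
          sh s (k + 1) p (q + 1) + sh s (k + 1) (p + 1) q * cyc s k (p + 1) := by rw [sh]
      have l3 : sh s k (p + 1) (q + 1 + (r + 1)) = sh s (k + 1) p (q + 1 + (r + 1)) +
          sh s (k + 1) (p + 1) (q + (r + 1)) * cyc s k (p + 1) := by
        rw [show q + 1 + (r + 1) = (q + (r + 1)) + 1 by omega, sh]
      have l4 : sh s (k + (p + 1)) (q + 1) (r + 1) = sh s (k + (p + 1) + 1) q (r + 1) +
          sh s (k + (p + 1) + 1) (q + 1) r * cyc s (k + (p + 1)) (q + 1) := by rw [sh]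
      have c1 : cyc s k (p + 1 + (q + 1)) * sh s k (p + 1) (q + 1) =
          sh s (k + 1) (p + 1) (q + 1) * cyc s k (p + 1 + (q + 1)) :=
        h.cyc_sh _ _ _ _ _ le_rfl (by omega)
      have i1 : k + 1 + p = k + (p + 1) := by omega
      have i2 : k + 1 + (p + 1) = k + (p + 1) + 1 := by omega
      have i3 : p + 1 + q = p + (q + 1) := by omega
      have i4 : q + 1 + r = q + (r + 1) := by omega
      rw [i1] at e1
      rw [i2, i3] at e2
      rw [i2, i4] at e3
      calc sh s k (p + 1 + (q + 1)) (r + 1) * sh s k (p + 1) (q + 1)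
          = sh s (k + 1) (p + (q + 1)) (r + 1) * sh s (k + 1) p (q + 1) +
            sh s (k + 1) (p + (q + 1)) (r + 1) * sh s (k + 1) (p + 1) q * cyc s k (p + 1) +
            sh s (k + 1) (p + 1 + (q + 1)) r * sh s (k + 1) (p + 1) (q + 1) *
              cyc s k (p + 1 + (q + 1)) := by
            rw [l1, add_mul, mul_assoc _ (cyc s k _), c1]
            nth_rewrite 1 [l2]
            rw [mul_add]
            simp only [mul_assoc]
        _ = sh s (k + 1) p (q + 1 + (r + 1)) * sh s (k + (p + 1)) (q + 1) (r + 1) +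
            sh s (k + 1) (p + 1) (q + (r + 1)) * sh s (k + (p + 1) + 1) q (r + 1) *
              cyc s k (p + 1) +
            sh s (k + 1) (p + 1) (q + (r + 1)) * sh s (k + (p + 1) + 1) (q + 1) r *
              cyc s k (p + 1 + (q + 1)) := by rw [e1, e2, e3]
        _ = sh s (k + 1) p (q + 1 + (r + 1)) * sh s (k + (p + 1)) (q + 1) (r + 1) +
            sh s (k + 1) (p + 1) (q + (r + 1)) * cyc s k (p + 1) *
              sh s (k + (p + 1)) (q + 1) (r + 1) := by
            rw [add_assoc]
            congr 1
            have g1 := h.cyc_comm_sh k (p + 1) (k + (p + 1) + 1) q (r + 1) (by omega)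
            have g2 := h.cyc_comm_sh k (p + 1) (k + (p + 1) + 1) (q + 1) r (by omega)
            rw [l4, mul_add, cyc_add s k (p + 1) (q + 1), mul_assoc, ← g1]
            congr 1
            · rw [mul_assoc]
            · rw [mul_assoc, mul_assoc, ← mul_assoc (sh s (k + (p + 1) + 1) (q + 1) r), ← g2,
                mul_assoc]
        _ = _ := by rw [l3, add_mul]

end AbstractShuffle

section Shuffle

/-- Auxiliary left action of `T` on `T × (V ⊗ T)`: `v (x, y) = (v x, v ⊗ x)`. -/
noncomputable def stripAux :
    TensorAlgebra K V →ₐ[K] Module.End K (TensorAlgebra K V × (V ⊗[K] TensorAlgebra K V)) :=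
  TensorAlgebra.lift K
    (LinearMap.mk₂ K (fun v (p : TensorAlgebra K V × (V ⊗[K] TensorAlgebra K V)) =>
        ((TensorAlgebra.ι K v * p.1, v ⊗ₜ p.1) : TensorAlgebra K V × (V ⊗[K] TensorAlgebra K V)))
      (fun v w p => by simp [add_mul, TensorProduct.add_tmul])
      (fun r v p => by simp [TensorProduct.smul_tmul'])
      (fun v p q => by simp [mul_add, TensorProduct.tmul_add])
      (fun r v p => by simp))

/-- Removal of the first letter: the map `T → V ⊗ T` with `1 ↦ 0` and `v x ↦ v ⊗ x`. -/
noncomputable def strip : TensorAlgebra K V →ₗ[K] V ⊗[K] TensorAlgebra K V :=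
  LinearMap.snd K _ _ ∘ₗ LinearMap.applyₗ (1, 0) ∘ₗ stripAux.toLinearMap

/-- The map `V ⊗ T → T`, `v ⊗ x ↦ v x`. -/
noncomputable def cons : V ⊗[K] TensorAlgebra K V →ₗ[K] TensorAlgebra K V :=
  LinearMap.mul' K (TensorAlgebra K V) ∘ₗ (TensorAlgebra.ι K).rTensor _

@[simp] theorem cons_tmul (v : V) (x : TensorAlgebra K V) :
    cons (v ⊗ₜ[K] x) = TensorAlgebra.ι K v * x := rfl

theorem stripAux_fst (t : TensorAlgebra K V) :
    ∀ p : TensorAlgebra K V × (V ⊗[K] TensorAlgebra K V), (stripAux t p).1 = t * p.1 := by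
  induction t using TensorAlgebra.induction with
  | algebraMap r =>
    intro p
    rw [AlgHom.commutes, Module.algebraMap_end_apply, Prod.smul_fst, Algebra.smul_def]
  | ι v => intro p; rw [stripAux, TensorAlgebra.lift_ι_apply]; rfl
  | mul x y hx hy => intro p; rw [map_mul, Module.End.mul_apply, hx, hy, mul_assoc]
  | add x y hx hy => intro p; rw [map_add, LinearMap.add_apply, Prod.fst_add, hx, hy, add_mul]

@[simp] theorem strip_one : strip (1 : TensorAlgebra K V) = 0 := by
  change (stripAux (1 : TensorAlgebra K V) (1, 0)).2 = 0
  rw [map_one]; rfl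

theorem strip_ι_mul (v : V) (x : TensorAlgebra K V) :
    strip (TensorAlgebra.ι K v * x) = v ⊗ₜ x := by
  change (stripAux (TensorAlgebra.ι K v * x) (1, 0)).2 = _
  rw [map_mul, Module.End.mul_apply]
  nth_rewrite 1 [stripAux]
  rw [TensorAlgebra.lift_ι_apply]
  change v ⊗ₜ[K] (stripAux x (1, 0)).1 = _
  rw [stripAux_fst, mul_one]

theorem strip_cons (y : V ⊗[K] TensorAlgebra K V) : strip (cons y) = y := by
  induction y with
  | zero => simp
  | add s t hs ht => simp only [map_add, hs, ht]
  | tmul v x => rw [cons_tmul, strip_ι_mul]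

@[simp] theorem strip_ι (v : V) : strip (TensorAlgebra.ι K v) = v ⊗ₜ 1 := by
  rw [← strip_ι_mul, mul_one]

/-- The operator `V ⊗ F`: it maps `1` to `0` and `v x` to `v F(x)`. -/
noncomputable def shift (F : Module.End K (TensorAlgebra K V)) : Module.End K (TensorAlgebra K V) :=
  cons ∘ₗ F.lTensor V ∘ₗ strip

/-- The braiding `c`, applied to the first two letters of a tensor (and `0` in degrees `0`, `1`). -/
noncomputable def sigma₀ (c : Braiding K V) : Module.End K (TensorAlgebra K V) :=
  cons ∘ₗ cons.lTensor V ∘ₗ (TensorProduct.assoc K V V (TensorAlgebra K V)).toLinearMap ∘ₗ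
    c.map.rTensor (TensorAlgebra K V) ∘ₗ
    (TensorProduct.assoc K V V (TensorAlgebra K V)).symm.toLinearMap ∘ₗ strip.lTensor V ∘ₗ strip

/-- The operator `c_{i+1}` on `T`: the braiding, applied at the positions `i` and `i+1`, counted
from `0` (and `0` in degrees less than `i+2`). -/
noncomputable def sigma (c : Braiding K V) : ℕ → Module.End K (TensorAlgebra K V)
  | 0 => sigma₀ c
  | i + 1 => shift (sigma c i)

theorem shift_one (F : Module.End K (TensorAlgebra K V)) : shift F 1 = 0 := by
  simp [shift]

theorem shift_ι_mul (F : Module.End K (TensorAlgebra K V)) (v : V) (x : TensorAlgebra K V) :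
    shift F (TensorAlgebra.ι K v * x) = TensorAlgebra.ι K v * F x := by
  simp only [shift, LinearMap.comp_apply, strip_ι_mul, LinearMap.lTensor_tmul, cons_tmul]

theorem shift_mul (F G : Module.End K (TensorAlgebra K V)) : shift (F * G) = shift F * shift G := by
  ext t
  simp only [shift, Module.End.mul_apply, LinearMap.comp_apply, strip_cons]
  rw [← LinearMap.comp_apply (F.lTensor V), ← LinearMap.lTensor_comp]
  rfl

theorem sigma₀_one (c : Braiding K V) : sigma₀ c 1 = 0 := by simp [sigma₀]

theorem sigma₀_ι (c : Braiding K V) (v : V) : sigma₀ c (TensorAlgebra.ι K v) = 0 := by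
  simp [sigma₀]

theorem sigma₀_pairMul (c : Braiding K V) (y : V ⊗[K] V) (x : TensorAlgebra K V) :
    sigma₀ c (pairMul (TensorAlgebra.ι K) y * x) = pairMul (TensorAlgebra.ι K) (c.map y) * x := by
  induction y with
  | zero => simp
  | add s t hs ht => simp only [map_add, add_mul, hs, ht]
  | tmul v w =>
    simp only [pairMul_tmul, mul_assoc, sigma₀, LinearMap.comp_apply, strip_ι_mul,
      LinearMap.lTensor_tmul, LinearEquiv.coe_coe, TensorProduct.assoc_symm_tmul,
      LinearMap.rTensor_tmul]
    generalize c.map (v ⊗ₜ w) = q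
    induction q with
    | zero => simp
    | add s t hs ht => simp only [map_add, TensorProduct.add_tmul, add_mul, hs, ht]
    | tmul q₁ q₂ => simp [mul_assoc]

/-- Every operator identity on `T` may be checked on `1` and on the elements `v x`. -/
theorem end_ext {F G : Module.End K (TensorAlgebra K V)} (h1 : F 1 = G 1)
    (h : ∀ v x, F (TensorAlgebra.ι K v * x) = G (TensorAlgebra.ι K v * x)) : F = G := by
  have key : ∀ t y : TensorAlgebra K V, F y = G y → F (t * y) = G (t * y) := by
    intro t
    induction t using TensorAlgebra.induction with
    | algebraMap r =>
      intro y hy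
      rw [← Algebra.smul_def, map_smul, map_smul, hy]
    | ι v => exact fun y _ => h v y
    | mul a b ha hb => intro y hy; rw [mul_assoc]; exact ha _ (hb _ hy)
    | add a b ha hb => intro y hy; rw [add_mul, map_add, map_add, ha y hy, hb y hy]
  ext t
  simpa using key t 1 h1

theorem end_ext₂ {F G : Module.End K (TensorAlgebra K V)} (h1 : F 1 = G 1)
    (hι : ∀ v, F (TensorAlgebra.ι K v) = G (TensorAlgebra.ι K v))
    (h : ∀ y x, F (pairMul (TensorAlgebra.ι K) y * x) = G (pairMul (TensorAlgebra.ι K) y * x)) :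
    F = G := by
  refine end_ext h1 fun v x => ?_
  have h2 : F ∘ₗ LinearMap.mulLeft K (TensorAlgebra.ι K v) =
      G ∘ₗ LinearMap.mulLeft K (TensorAlgebra.ι K v) := by
    refine end_ext (by simpa using hι v) fun w x => ?_
    have := h (v ⊗ₜ w) x
    rwa [pairMul_tmul, mul_assoc] at this
  exact LinearMap.congr_fun h2 x

theorem sigma_comm₀ (c : Braiding K V) (F : Module.End K (TensorAlgebra K V)) :
    sigma₀ c * shift (shift F) = shift (shift F) * sigma₀ c := by
  have hp : ∀ y x, shift (shift F) (pairMul (TensorAlgebra.ι K) y * x) =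
      pairMul (TensorAlgebra.ι K) y * F x := by
    intro y x
    induction y with
    | zero => simp
    | add s t hs ht => simp only [map_add, add_mul, hs, ht]
    | tmul v w => rw [pairMul_tmul, mul_assoc, shift_ι_mul, shift_ι_mul, mul_assoc]
  refine end_ext₂ ?_ (fun v => ?_) (fun y x => ?_)
  · rw [Module.End.mul_apply, Module.End.mul_apply, shift_one, sigma₀_one, map_zero, map_zero]
  · rw [Module.End.mul_apply, Module.End.mul_apply, ← mul_one (TensorAlgebra.ι K v), shift_ι_mul,
      shift_one, mul_zero, mul_one, sigma₀_ι, map_zero, map_zero]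
  · rw [Module.End.mul_apply, Module.End.mul_apply, hp, sigma₀_pairMul, sigma₀_pairMul, hp]

/-- The map `V ⊗ V ⊗ V → T`. -/
noncomputable def tripleMul : V ⊗[K] (V ⊗[K] V) →ₗ[K] TensorAlgebra K V :=
  LinearMap.mul' K (TensorAlgebra K V) ∘ₗ
    TensorProduct.map (TensorAlgebra.ι K) (pairMul (TensorAlgebra.ι K))

theorem sigma_braid₀ (c : Braiding K V) :
    sigma₀ c * shift (sigma₀ c) * sigma₀ c = shift (sigma₀ c) * sigma₀ c * shift (sigma₀ c) := by
  have h0 : ∀ y : V ⊗[K] (V ⊗[K] V), ∀ x, sigma₀ c (tripleMul y * x) =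
      tripleMul (leg₁ c.map y) * x := by
    intro y x
    induction y with
    | zero => simp
    | add s t hs ht => simp only [map_add, add_mul, hs, ht]
    | tmul u y =>
      induction y with
      | zero => simp
      | add s t hs ht => simp only [TensorProduct.tmul_add, map_add, add_mul, hs, ht]
      | tmul v w =>
        have h : tripleMul (u ⊗ₜ[K] (v ⊗ₜ[K] w)) =
            pairMul (TensorAlgebra.ι K) (u ⊗ₜ v) * TensorAlgebra.ι K w := by
          simp [tripleMul, mul_assoc]
        rw [h, mul_assoc, sigma₀_pairMul]
        simp only [leg₁, LinearMap.comp_apply, LinearEquiv.coe_coe, TensorProduct.assoc_symm_tmul,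
          LinearMap.rTensor_tmul]
        generalize c.map (u ⊗ₜ v) = q
        induction q with
        | zero => simp
        | add s t hs ht => simp only [map_add, TensorProduct.add_tmul, add_mul, hs, ht]
        | tmul q₁ q₂ => simp [tripleMul, mul_assoc]
  have h1 : ∀ y : V ⊗[K] (V ⊗[K] V), ∀ x, shift (sigma₀ c) (tripleMul y * x) =
      tripleMul (leg₂ c.map y) * x := by
    intro y x
    induction y with
    | zero => simp
    | add s t hs ht => simp only [map_add, add_mul, hs, ht]
    | tmul u y =>
      simp only [tripleMul, LinearMap.comp_apply, TensorProduct.map_tmul, LinearMap.mul'_apply,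
        mul_assoc, shift_ι_mul, sigma₀_pairMul, leg₂, LinearMap.lTensor_tmul]
  have hz : ∀ y, shift (sigma₀ c) (pairMul (TensorAlgebra.ι K) y) = 0 := by
    intro y
    induction y with
    | zero => simp
    | add s t hs ht => simp only [map_add, hs, ht, add_zero]
    | tmul v w => rw [pairMul_tmul, shift_ι_mul, sigma₀_ι, mul_zero]
  have hz' : ∀ v, shift (sigma₀ c) (TensorAlgebra.ι K v) = 0 := by
    intro v
    rw [← mul_one (TensorAlgebra.ι K v), shift_ι_mul, sigma₀_one, mul_zero]
  refine end_ext₂ ?_ (fun v => ?_) (fun y x => ?_)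
  · simp only [Module.End.mul_apply, shift_one, sigma₀_one, map_zero]
  · simp only [Module.End.mul_apply, sigma₀_ι, hz', map_zero]
  · have h2 : (sigma₀ c * shift (sigma₀ c) * sigma₀ c) ∘ₗ
        LinearMap.mulLeft K (pairMul (TensorAlgebra.ι K) y) =
        (shift (sigma₀ c) * sigma₀ c * shift (sigma₀ c)) ∘ₗ
          LinearMap.mulLeft K (pairMul (TensorAlgebra.ι K) y) := by
      have hp : sigma₀ c (pairMul (TensorAlgebra.ι K) y) =
          pairMul (TensorAlgebra.ι K) (c.map y) := by
        simpa using sigma₀_pairMul c y 1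
      refine end_ext ?_ fun w x => ?_
      · simp only [LinearMap.comp_apply, LinearMap.mulLeft_apply, mul_one, Module.End.mul_apply, hz,
          hp, map_zero]
      · have h3 : pairMul (TensorAlgebra.ι K) y * TensorAlgebra.ι K w =
            tripleMul (TensorProduct.assoc K V V V (y ⊗ₜ w)) := by
          induction y with
          | zero => simp
          | add s t hs ht =>
            simp only [map_add, add_mul, TensorProduct.add_tmul] at hs ht ⊢
            rw [hs (by simpa using sigma₀_pairMul c s 1), ht (by simpa using sigma₀_pairMul c t 1)]
          | tmul u v => simp [tripleMul, mul_assoc]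
        simp only [LinearMap.comp_apply, LinearMap.mulLeft_apply, Module.End.mul_apply]
        rw [← mul_assoc, h3]
        simp only [h0, h1]
        have h4 := LinearMap.congr_fun c.yangBaxter (TensorProduct.assoc K V V V (y ⊗ₜ w))
        simp only [LinearMap.comp_apply] at h4
        rw [h4]
    exact LinearMap.congr_fun h2 x

theorem sigma_braidRel (c : Braiding K V) : BraidRel (sigma c) where
  braid i := by
    induction i with
    | zero => exact sigma_braid₀ c
    | succ i ih =>
      change shift (sigma c i) * shift (sigma c (i + 1)) * shift (sigma c i) =
        shift (sigma c (i + 1)) * shift (sigma c i) * shift (sigma c (i + 1))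
      rw [← shift_mul, ← shift_mul, ih, shift_mul, shift_mul]
  comm i := by
    induction i with
    | zero =>
      intro j hj
      obtain ⟨j, rfl⟩ : ∃ r, j = r + 2 := ⟨j - 2, by omega⟩
      exact sigma_comm₀ c _
    | succ i ih =>
      intro j hj
      obtain ⟨j, rfl⟩ : ∃ r, j = r + 1 := ⟨j - 1, by omega⟩
      change shift (sigma c i) * shift (sigma c j) = shift (sigma c j) * shift (sigma c i)
      rw [← shift_mul, ih j (by omega), shift_mul]

variable (K V) in
/-- The homogeneous component `V^{⊗ n}` of the tensor algebra. -/
noncomputable def tpow (n : ℕ) : Submodule K (TensorAlgebra K V) :=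
  LinearMap.range (TensorAlgebra.ι K (M := V)) ^ n

theorem tpow_mul {m n : ℕ} {x y : TensorAlgebra K V} (hx : x ∈ tpow K V m) (hy : y ∈ tpow K V n) :
    x * y ∈ tpow K V (m + n) := by
  rw [tpow, pow_add]; exact Submodule.mul_mem_mul hx hy

theorem one_mem_tpow : (1 : TensorAlgebra K V) ∈ tpow K V 0 := by
  rw [tpow, pow_zero]; exact Submodule.one_le.1 le_rfl

theorem ι_mem_tpow (v : V) : TensorAlgebra.ι K v ∈ tpow K V 1 := by
  rw [tpow, pow_one]; exact ⟨v, rfl⟩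

theorem tpow_zero_eq {x : TensorAlgebra K V} (hx : x ∈ tpow K V 0) :
    ∃ r : K, x = algebraMap K _ r := by
  rw [tpow, pow_zero] at hx
  obtain ⟨r, hr⟩ := Submodule.mem_one.1 hx
  exact ⟨r, hr.symm⟩

theorem tpow_succ_induction {n : ℕ} {P : Submodule K (TensorAlgebra K V)}
    (h : ∀ v, ∀ x ∈ tpow K V n, TensorAlgebra.ι K v * x ∈ P) : tpow K V (n + 1) ≤ P := by
  rw [tpow, pow_succ']
  refine Submodule.mul_le.2 ?_
  rintro _ ⟨v, rfl⟩ x hx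
  exact h v x hx

theorem pairMul_mem_tpow (z : V ⊗[K] V) : pairMul (TensorAlgebra.ι K) z ∈ tpow K V 2 := by
  induction z with
  | zero => rw [map_zero]; exact Submodule.zero_mem _
  | add s t hs ht => rw [map_add]; exact Submodule.add_mem _ hs ht
  | tmul v w => rw [pairMul_tmul]; exact tpow_mul (m := 1) (n := 1) (ι_mem_tpow v) (ι_mem_tpow w)

/-- The operators on `T` which preserve the degree `n` and act on the first `n` letters only. -/
noncomputable def leftOps (n : ℕ) : Subring (Module.End K (TensorAlgebra K V)) where
  carrier := {F | ∀ x ∈ tpow K V n, F x ∈ tpow K V n ∧ ∀ y, F (x * y) = F x * y}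
  mul_mem' := by
    intro F G hF hG x hx
    obtain ⟨h1, h2⟩ := hG x hx
    obtain ⟨h3, h4⟩ := hF _ h1
    exact ⟨h3, fun y => by rw [Module.End.mul_apply, h2, h4, Module.End.mul_apply]⟩
  one_mem' := fun x hx => ⟨hx, fun y => rfl⟩
  add_mem' := by
    intro F G hF hG x hx
    refine ⟨Submodule.add_mem _ (hF x hx).1 (hG x hx).1, fun y => ?_⟩
    rw [LinearMap.add_apply, (hF x hx).2, (hG x hx).2, LinearMap.add_apply, add_mul]
  zero_mem' := fun x hx => ⟨Submodule.zero_mem _, fun y => by simp⟩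
  neg_mem' := by
    intro F hF x hx
    refine ⟨Submodule.neg_mem _ (hF x hx).1, fun y => ?_⟩
    rw [LinearMap.neg_apply, (hF x hx).2, LinearMap.neg_apply, neg_mul]

theorem mem_leftOps_iff {n : ℕ} {F : Module.End K (TensorAlgebra K V)} :
    F ∈ leftOps n ↔ ∀ x ∈ tpow K V n, F x ∈ tpow K V n ∧ ∀ y, F (x * y) = F x * y := Iff.rfl

/-- The elements `x` of degree `n` on which `F` has the properties of `leftOps`. -/
noncomputable def leftSet (F : Module.End K (TensorAlgebra K V)) (n : ℕ) :
    Submodule K (TensorAlgebra K V) where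
  carrier := {x | F x ∈ tpow K V n ∧ ∀ y, F (x * y) = F x * y}
  zero_mem' := by simp
  add_mem' := by
    rintro a b ⟨h1, h2⟩ ⟨h3, h4⟩
    refine ⟨by rw [map_add]; exact Submodule.add_mem _ h1 h3, fun y => ?_⟩
    rw [add_mul, map_add, map_add, h2, h4, add_mul]
  smul_mem' := by
    rintro r a ⟨h1, h2⟩
    refine ⟨by rw [map_smul]; exact Submodule.smul_mem _ r h1, fun y => ?_⟩
    rw [smul_mul_assoc, map_smul, map_smul, h2, smul_mul_assoc]

theorem sigma_mem_leftOps (c : Braiding K V) (i n : ℕ) (h : i + 2 ≤ n) :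
    sigma c i ∈ leftOps n := by
  induction i generalizing n with
  | zero =>
    obtain ⟨n, rfl⟩ : ∃ r, n = r + 2 := ⟨n - 2, by omega⟩
    suffices h : tpow K V (n + 2) ≤ leftSet (sigma c 0) (n + 2) from fun x hx => h hx
    refine tpow_succ_induction fun v x hx => ?_
    suffices h : tpow K V (n + 1) ≤
        (leftSet (sigma c 0) (n + 2)).comap (LinearMap.mulLeft K (TensorAlgebra.ι K v)) from h hx
    refine tpow_succ_induction fun w x hx => ?_
    rw [Submodule.mem_comap, LinearMap.mulLeft_apply, ← mul_assoc, ← pairMul_tmul]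
    have e := sigma₀_pairMul c (v ⊗ₜ[K] w)
    refine ⟨?_, fun y => ?_⟩
    · rw [sigma, e, add_comm]
      exact tpow_mul (pairMul_mem_tpow _) hx
    · rw [sigma, mul_assoc, e, e, mul_assoc]
  | succ i ih =>
    obtain ⟨n, rfl⟩ : ∃ r, n = r + 1 := ⟨n - 1, by omega⟩
    suffices h : tpow K V (n + 1) ≤ leftSet (sigma c (i + 1)) (n + 1) from fun x hx => h hx
    refine tpow_succ_induction fun v x hx => ?_
    obtain ⟨h1, h2⟩ := ih n (by omega) x hx
    refine ⟨?_, fun y => ?_⟩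
    · rw [sigma, shift_ι_mul, add_comm]
      exact tpow_mul (ι_mem_tpow v) h1
    · rw [sigma, mul_assoc, shift_ι_mul, h2, shift_ι_mul, mul_assoc]

theorem sh_mem_leftOps (c : Braiding K V) (k p q n : ℕ) (h : k + p + q ≤ n) :
    sh (sigma c) k p q ∈ leftOps n :=
  sh_mem _ _ _ _ _ fun i _ h2 => sigma_mem_leftOps c i n (by omega)

theorem sigma_mul_left (c : Braiding K V) (i p : ℕ) {x : TensorAlgebra K V} (hx : x ∈ tpow K V p) :
    ∀ y, sigma c (i + p) (x * y) = x * sigma c i y := by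
  induction p generalizing x with
  | zero =>
    intro y
    obtain ⟨r, rfl⟩ := tpow_zero_eq hx
    rw [← Algebra.smul_def, map_smul, Algebra.smul_def, add_zero]
  | succ p ih =>
    intro y
    suffices h : tpow K V (p + 1) ≤ LinearMap.ker
        (sigma c (i + (p + 1)) ∘ₗ LinearMap.mulRight K y - LinearMap.mulRight K (sigma c i y)) by
      have := h hx
      rw [LinearMap.mem_ker, LinearMap.sub_apply, sub_eq_zero] at this
      exact this
    refine tpow_succ_induction fun v x hx => ?_
    rw [LinearMap.mem_ker, LinearMap.sub_apply, sub_eq_zero, LinearMap.comp_apply,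
      LinearMap.mulRight_apply, LinearMap.mulRight_apply, ← add_assoc, sigma, mul_assoc,
      shift_ι_mul, ih hx, mul_assoc]

theorem sh_mul_left (c : Braiding K V) (k p q r : ℕ) {x : TensorAlgebra K V}
    (hx : x ∈ tpow K V p) :
    ∀ y, sh (sigma c) (k + p) q r (x * y) = x * sh (sigma c) k q r y := by
  have hc : ∀ r k y, cyc (sigma c) (k + p) r (x * y) = x * cyc (sigma c) k r y := by
    intro r
    induction r with
    | zero => intro k y; rfl
    | succ r ih =>
      intro k y
      rw [cyc, cyc, Module.End.mul_apply, Module.End.mul_apply, add_right_comm, ih,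
        sigma_mul_left c k p hx]
  induction hn : q + r using Nat.strong_induction_on generalizing k q r with
  | _ n ih =>
    intro y
    match q, r with
    | 0, r => rw [sh, sh]; rfl
    | q + 1, 0 => rw [sh, sh]; rfl
    | q + 1, r + 1 =>
      rw [sh, sh, LinearMap.add_apply, LinearMap.add_apply, Module.End.mul_apply,
        Module.End.mul_apply, hc, add_right_comm, ih _ (by omega) _ _ _ rfl,
        ih _ (by omega) _ _ _ rfl, mul_add]

/-- The homogeneous component `V^{⊗ n}` of the quantum shuffle algebra. -/
def ShPiece (_ : Braiding K V) (n : ℕ) : Type (max u v) := tpow K V n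

noncomputable instance (c : Braiding K V) (n : ℕ) : AddCommGroup (ShPiece c n) :=
  inferInstanceAs (AddCommGroup (tpow K V n))

noncomputable instance (c : Braiding K V) (n : ℕ) : Module K (ShPiece c n) :=
  inferInstanceAs (Module K (tpow K V n))

/-- The quantum shuffle algebra `T^c(V,c) = ⊕_n V^{⊗ n}`, with the quantum shuffle product. -/
abbrev ShuffleAlgebra (c : Braiding K V) : Type (max u v) := ⨁ n, ShPiece c n

/-- The element of the component `V^{⊗ n}` of the quantum shuffle algebra given by a tensor. -/
noncomputable def ShPiece.mk (c : Braiding K V) (n : ℕ) : tpow K V n →ₗ[K] ShPiece c n :=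
  LinearMap.id

/-- The underlying tensor of an element of `ShPiece`. -/
noncomputable def ShPiece.val (c : Braiding K V) {n : ℕ} : ShPiece c n →ₗ[K] TensorAlgebra K V :=
  (tpow K V n).subtype

/-- The quantum shuffle product `V^{⊗ p} × V^{⊗ q} → V^{⊗ (p+q)}`: the sum of all
`(p,q)`-shuffles, acting through `c`, of the concatenation. -/
noncomputable def shMul (c : Braiding K V) (p q : ℕ) (x : tpow K V p) (y : tpow K V q) :
    tpow K V (p + q) :=
  ⟨sh (sigma c) 0 p q ((x : TensorAlgebra K V) * y),
    ((sh_mem_leftOps c 0 p q (p + q) (by omega)) _ (tpow_mul x.2 y.2)).1⟩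

theorem sh_ext (c : Braiding K V) {m n : ℕ} (h : m = n) (x : tpow K V m) (y : tpow K V n)
    (hxy : (x : TensorAlgebra K V) = y) :
    GradedMonoid.mk (A := ShPiece c) m x = GradedMonoid.mk n y := by
  subst h
  rw [Subtype.ext hxy]

noncomputable instance (c : Braiding K V) : GradedMonoid.GMul (ShPiece c) where
  mul {p q} x y := shMul c p q x y

noncomputable instance (c : Braiding K V) : GradedMonoid.GOne (ShPiece c) where
  one := (⟨1, one_mem_tpow⟩ : tpow K V 0)

noncomputable instance (c : Braiding K V) : GradedMonoid.GMonoid (ShPiece c) where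
  one_mul := by
    rintro ⟨n, x⟩
    refine sh_ext c (zero_add n) _ _ ?_
    change sh (sigma c) 0 0 n ((1 : TensorAlgebra K V) * ShPiece.val c x) = ShPiece.val c x
    rw [sh_zero_left, one_mul]; rfl
  mul_one := by
    rintro ⟨n, x⟩
    refine sh_ext c (add_zero n) _ _ ?_
    change sh (sigma c) 0 n 0 (ShPiece.val c x * 1) = ShPiece.val c x
    rw [sh_zero_right, mul_one]; rfl
  mul_assoc := by
    rintro ⟨p, x⟩ ⟨q, y⟩ ⟨r, z⟩
    refine sh_ext c (add_assoc p q r) (shMul c (p + q) r (shMul c p q x y) z)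
      (shMul c p (q + r) x (shMul c q r y z)) ?_
    obtain ⟨x, hx⟩ := x
    obtain ⟨y, hy⟩ := y
    obtain ⟨z, hz⟩ := z
    change sh (sigma c) 0 (p + q) r (sh (sigma c) 0 p q (x * y) * z) =
      sh (sigma c) 0 p (q + r) (x * sh (sigma c) 0 q r (y * z))
    rw [← ((sh_mem_leftOps c 0 p q (p + q) (by omega)) _ (tpow_mul hx hy)).2,
      ← sh_mul_left c 0 p q r hx, mul_assoc, ← Module.End.mul_apply, ← Module.End.mul_apply,
      (sigma_braidRel c).sh_assoc]

noncomputable instance (c : Braiding K V) : DirectSum.GRing (ShPiece c) where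
  mul_zero {p q} x := by
    refine Subtype.ext ?_
    change sh (sigma c) 0 p q (ShPiece.val c x * 0) = 0
    rw [mul_zero, map_zero]
  zero_mul {p q} y := by
    refine Subtype.ext ?_
    change sh (sigma c) 0 p q (0 * ShPiece.val c y) = 0
    rw [zero_mul, map_zero]
  mul_add {p q} x y z := by
    refine Subtype.ext ?_
    change sh (sigma c) 0 p q (ShPiece.val c x * (ShPiece.val c y + ShPiece.val c z)) = _
    rw [mul_add, map_add]; rfl
  add_mul {p q} x y z := by
    refine Subtype.ext ?_
    change sh (sigma c) 0 p q ((ShPiece.val c x + ShPiece.val c y) * ShPiece.val c z) = _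
    rw [add_mul, map_add]; rfl
  natCast n := n • ShPiece.mk c 0 ⟨1, one_mem_tpow⟩
  natCast_zero := zero_smul _ _
  natCast_succ n := by rw [succ_nsmul]; rfl
  intCast n := n • ShPiece.mk c 0 ⟨1, one_mem_tpow⟩
  intCast_ofNat n := natCast_zsmul _ n
  intCast_negSucc_ofNat n := by rw [negSucc_zsmul]

noncomputable instance (c : Braiding K V) : DirectSum.GAlgebra K (ShPiece c) where
  toFun :=
    ((LinearMap.toSpanSingleton K (ShPiece c 0)
      (ShPiece.mk c 0 ⟨1, one_mem_tpow⟩)).toAddMonoidHom : K →+ ShPiece c 0)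
  map_one := one_smul K (ShPiece.mk c 0 ⟨1, one_mem_tpow⟩)
  map_mul r s := by
    refine sh_ext c (add_zero 0).symm ((r * s) • (⟨1, one_mem_tpow⟩ : tpow K V 0))
      (shMul c 0 0 (r • (⟨1, one_mem_tpow⟩ : tpow K V 0))
        (s • (⟨1, one_mem_tpow⟩ : tpow K V 0))) ?_
    simp [shMul, sh_zero_left, mul_smul, smul_comm r s]
  commutes r := by
    rintro ⟨n, x⟩
    refine sh_ext c (by simp) (shMul c 0 n (r • (⟨1, one_mem_tpow⟩ : tpow K V 0)) x)
      (shMul c n 0 x (r • (⟨1, one_mem_tpow⟩ : tpow K V 0))) ?_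
    simp [shMul, sh_zero_left, sh_zero_right]
  smul_def r := by
    rintro ⟨n, x⟩
    refine sh_ext c (by simp) (r • (show tpow K V n from x))
      (shMul c 0 n (r • (⟨1, one_mem_tpow⟩ : tpow K V 0)) x) ?_
    simp only [shMul, sh_zero_left, Module.End.one_apply, Submodule.coe_smul, smul_mul_assoc, one_mul]
    rfl

/-- The embedding of `V` in the quantum shuffle algebra. -/
noncomputable def ιSh (c : Braiding K V) : V →ₗ[K] ShuffleAlgebra c :=
  DirectSum.lof K ℕ (ShPiece c) 1 ∘ₗ ShPiece.mk c 1 ∘ₗ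
    (TensorAlgebra.ι K).codRestrict (tpow K V 1) ι_mem_tpow

/-- The algebra homomorphism `Γ : T(V,c) → T^c(V,c)` which restricts to the identity of `V`. -/
noncomputable def Gam (c : Braiding K V) : TensorAlgebra K V →ₐ[K] ShuffleAlgebra c :=
  TensorAlgebra.lift K (ιSh c)

/-- The Nichols algebra `B(V,c) = Im Γ`, a subalgebra of the quantum shuffle algebra. -/
noncomputable def Nichols (c : Braiding K V) : Subalgebra K (ShuffleAlgebra c) := (Gam c).range

/-- The surjection `T(V,c) → B(V,c)` induced by `Γ`. -/
noncomputable def toNichols (c : Braiding K V) : TensorAlgebra K V →ₐ[K] Nichols c :=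
  (Gam c).rangeRestrict

/-- The grading of the Nichols algebra, induced by the one of the quantum shuffle algebra. -/
noncomputable def nicholsGrading (c : Braiding K V) (n : ℕ) : Submodule K (Nichols c) :=
  (LinearMap.range (DirectSum.lof K ℕ (ShPiece c) n)).comap (Nichols c).val.toLinearMap

theorem pairMul_ιSh (c : Braiding K V) (z : V ⊗[K] V) :
    pairMul (ιSh c) z = DirectSum.lof K ℕ (ShPiece c) 2 (ShPiece.mk c 2
      ⟨pairMul (TensorAlgebra.ι K) (z + c.map z), pairMul_mem_tpow _⟩) := by
  let F : V ⊗[K] V →ₗ[K] ShuffleAlgebra c :=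
    DirectSum.lof K ℕ (ShPiece c) 2 ∘ₗ ShPiece.mk c 2 ∘ₗ
      (pairMul (TensorAlgebra.ι K) ∘ₗ (LinearMap.id + c.map)).codRestrict (tpow K V 2)
        (fun z => pairMul_mem_tpow _)
  suffices h : pairMul (ιSh c) = F from LinearMap.congr_fun h z
  refine TensorProduct.ext' fun v w => ?_
  rw [pairMul_tmul]
  have h1 : ιSh c v * ιSh c w = DirectSum.lof K ℕ (ShPiece c) (1 + 1)
      (shMul c 1 1 ⟨_, ι_mem_tpow v⟩ ⟨_, ι_mem_tpow w⟩) := by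
    simp only [ιSh, LinearMap.comp_apply, DirectSum.lof_eq_of]
    rw [DirectSum.of_mul_of]
    rfl
  have h2 : (shMul c 1 1 ⟨_, ι_mem_tpow v⟩ ⟨_, ι_mem_tpow w⟩) =
      (⟨pairMul (TensorAlgebra.ι K) (v ⊗ₜ w + c.map (v ⊗ₜ w)), pairMul_mem_tpow _⟩ :
        tpow K V 2) := by
    refine Subtype.ext ?_
    have e := sigma₀_pairMul c (v ⊗ₜ[K] w) 1
    rw [mul_one, mul_one, pairMul_tmul] at e
    simp only [shMul, sh, cyc, sigma, map_add, pairMul_tmul, LinearMap.add_apply,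
      Module.End.one_apply, e, mul_one, one_mul]
  rw [h1, h2]
  rfl

/-- The canonical projection `S_Q(V,c) → B(V,c)` induced by `Γ`. -/
noncomputable def sqToNichols (c : Braiding K V) : UQ c 0 →ₐ[K] Nichols c :=
  UQ.lift ((toNichols c).toLinearMap ∘ₗ TensorAlgebra.ι K) fun z => by
    rw [← UQ.pairMul_comp, QBracket.zero_map, LinearMap.zero_apply, map_zero]
    refine Subtype.ext ?_
    change Gam c (pairMul (TensorAlgebra.ι K) (z : V ⊗[K] V)) = 0
    have h1 : (Gam c).toLinearMap ∘ₗ TensorAlgebra.ι K = ιSh c := TensorAlgebra.ι_comp_lift _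
    have h2 : (z : V ⊗[K] V) + c.map z = 0 := by rw [map_E₂ c z.2, add_neg_cancel]
    have h3 : (⟨pairMul (TensorAlgebra.ι K) ((z : V ⊗[K] V) + c.map z), pairMul_mem_tpow _⟩ :
        tpow K V 2) = 0 := Subtype.ext (by
      change pairMul (TensorAlgebra.ι K) ((z : V ⊗[K] V) + c.map z) = 0
      rw [h2, map_zero])
    rw [UQ.pairMul_comp, h1, pairMul_ιSh, h3, map_zero, map_zero]

end Shuffle

/-! ### Quadratic algebras -/

/-- A `K`-algebra `A` with subspaces `𝒜 n` is a quadratic algebra: it is graded by the `𝒜 n`, one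
has `A⁰ = K`, it is generated by `A¹`, and the ideal of relations, that is the kernel of
`T(A¹) → A`, is generated as a two-sided ideal by its intersection with `A¹ ⊗ A¹`. -/
structure IsQuadraticAlgebra {A : Type*} [Ring A] [Algebra K A] (𝒜 : ℕ → Submodule K A) :
    Prop where
  gradedMonoid : SetLike.GradedMonoid 𝒜
  isInternal : DirectSum.IsInternal 𝒜
  degree_zero : 𝒜 0 = 1
  algebraMap_injective : Function.Injective (algebraMap K A)
  generated : Algebra.adjoin K (𝒜 1 : Set A) = ⊤
  relations : TwoSidedIdeal.ker (TensorAlgebra.lift K (𝒜 1).subtype) =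
    TwoSidedIdeal.span {t : TensorAlgebra K (𝒜 1) |
      t ∈ LinearMap.range (TensorAlgebra.ι K (M := 𝒜 1)) ^ 2 ∧
        TensorAlgebra.lift K (𝒜 1).subtype t = 0}

end QLie

/-! ### Recursion on words in the tensor algebra. -/

namespace QLie

universe u v

variable {K : Type u} {V : Type v} [Field K] [AddCommGroup V] [Module K V]

/-! The proof is governed by one component of the comultiplication of `T`: the map `comulOne`, that
is `Δ^{1,n} : V^{⊗(n+1)} → V ⊗ V^{⊗n}`. By `comulOne_ι_mul` it satisfies `Δ^{1,*}(v x) = v ⊗ x + (V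
⊗ m)(c ⊗ T)(v ⊗ Δ^{1,*}(x))`. The quantum shuffle product satisfies the same recursion once the
first letter is split off (`strip_shMulV`), because in a shuffle of `v` with `w x` either `v` stays
in front or `w` has crossed `v` by means of `c`. Hence `Γ` is rebuilt degree by degree from
`Δ^{1,n}`: removing the first letter of `Γ(t)` gives `(V ⊗ Γ)(Δ^{1,*}(t))` (`strip_symmetrizer`).

Since `Γ` factors through `S_Q`, a tensor of degree `n + 1` whose `Δ^{1,n}` vanishes in `V ⊗ S_Q` is
killed by `Γ`. If `S_Q → B` is injective, the tensor is therefore zero in `S_Q`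
(`proj_eq_zero_of_comulOne`). Thus `Δ^{1,n}` is injective on the positive degrees of `S_Q`, and this
is the only use made of the Nichols algebra in the equivalence of the four assertions.

The first claim is a computation in degree two: there `Γ` is `Id + c`, so the quadratic relations of
`B` are exactly `E₂`. As `V` is the degree one part of `B`, being quadratic means that `ker Γ` is
generated by `E₂`, that is `S_Q = B` (`isQuadraticAlgebra_iff`).

For every bracket, `θ` is a surjective morphism of graded braided bialgebras. It sends the class of
a homogeneous tensor to the symbol of its image in `U_Q` (`theta_proj`), and the structure maps on
both sides are computed from homogeneous representatives in `T`. If `i` is injective, then so is `V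
→ U'_1 / U'_0`, because the counit separates `i(V)` from the scalars. A linear projection of
`gr'(U_Q)` onto `V` then exists, and `θ` matches it with the degree one projection of `T`. An
element of degree `n + 1` in the kernel of `θ` has `Δ^{1,n}` in the kernel of `V ⊗ θ`, so induction
on the degree and the injectivity of `Δ^{1,n}` make `θ` injective (`theta_injective`).

The same mechanism controls primitive elements. If `x` is primitive and lies in `U'_n` with `n ≥ 2`,
the component of `Δ` of bidegree `(1, n - 1)` vanishes on its symbol. The symbol is `θ` of a
homogeneous element of `S_Q`, which must vanish, and `x` drops into `U'_{n-1}`. This descent ends in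
`K + i(V)`, where only `i(V)` is primitive (`primitives_le`). In the converse directions, an
isomorphism `θ` makes `i` injective because `V` always embeds in `S_Q`, and the fourth assertion
contains the injectivity of `i`. -/

/-- A subspace of the tensor algebra which contains `1` and is stable under left multiplication by
the elements of `V` is everything. -/
theorem tensor_induction_left (P : Submodule K (TensorAlgebra K V)) (h1 : 1 ∈ P)
    (h : ∀ v, ∀ x ∈ P, TensorAlgebra.ι K v * x ∈ P) (t : TensorAlgebra K V) : t ∈ P := by
  suffices key : ∀ t : TensorAlgebra K V, ∀ y ∈ P, t * y ∈ P by simpa using key t 1 h1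
  intro t
  induction t using TensorAlgebra.induction with
  | algebraMap r => intro y hy; rw [← Algebra.smul_def]; exact P.smul_mem r hy
  | ι v => exact h v
  | mul a b ha hb => intro y hy; rw [mul_assoc]; exact ha _ (hb _ hy)
  | add a b ha hb => intro y hy; rw [add_mul]; exact P.add_mem (ha y hy) (hb y hy)

/-- Linear maps out of the tensor algebra are determined by a recursion along left
multiplications by elements of `V`. -/
theorem tensor_hom_ext {M : Type*} [AddCommGroup M] [Module K M]
    {f g : TensorAlgebra K V →ₗ[K] M} (h1 : f 1 = g 1)
    (h : ∀ v x, f x = g x → f (TensorAlgebra.ι K v * x) = g (TensorAlgebra.ι K v * x)) : f = g := by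
  refine LinearMap.ext fun t => ?_
  have := tensor_induction_left (LinearMap.ker (f - g))
    (by rw [LinearMap.mem_ker, LinearMap.sub_apply, h1, sub_self])
    (fun v x hx => by
      rw [LinearMap.mem_ker, LinearMap.sub_apply, sub_eq_zero] at hx ⊢
      exact h v x hx) t
  rwa [LinearMap.mem_ker, LinearMap.sub_apply, sub_eq_zero] at this

/-! ### The degree one part of a tensor. -/

section DegreeOne

variable (c : Braiding K V)

@[simp] theorem counitT_ι_mul (v : V) (x : TensorAlgebra K V) :
    counitT c (TensorAlgebra.ι K v * x) = 0 := by
  rw [map_mul, counitT, TensorAlgebra.lift_ι_apply]; simp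

/-- The projection of the tensor algebra onto its component `V` of degree one. -/
noncomputable def degOne : TensorAlgebra K V →ₗ[K] V :=
  (TensorProduct.rid K V).toLinearMap ∘ₗ
    (counitT c).toLinearMap.lTensor V ∘ₗ strip

@[simp] theorem degOne_one : degOne c 1 = 0 := by simp [degOne]

theorem degOne_ι_mul (v : V) (x : TensorAlgebra K V) :
    degOne c (TensorAlgebra.ι K v * x) = counitT c x • v := by
  simp [degOne, strip_ι_mul]

@[simp] theorem degOne_ι (v : V) : degOne c (TensorAlgebra.ι K v) = v := by
  simp [degOne]

/-- The definition of `degOne` reads the first letter, whereas the braiding of `V` with `T` is built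
by right multiplications. This is the right-hand version needed there. On a word with letters on
both sides of `x` the two expressions vanish, so the recursion uses no induction hypothesis. -/
theorem degOne_mul_ι (x : TensorAlgebra K V) (w : V) :
    degOne c (x * TensorAlgebra.ι K w) = counitT c x • w := by
  have h : degOne c ∘ₗ LinearMap.mulRight K (TensorAlgebra.ι K w) =
      (LinearMap.toSpanSingleton K V w) ∘ₗ (counitT c).toLinearMap := by
    refine tensor_hom_ext (by simp) fun v x _ => ?_
    have h0 : counitT c (x * TensorAlgebra.ι K w) = 0 := by
      rw [map_mul]; simp [counitT]
    simp [mul_assoc, degOne_ι_mul, h0]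
  exact LinearMap.congr_fun h x

theorem degOne_eq_zero {n : ℕ} (hn : n ≠ 1) {x : TensorAlgebra K V} (hx : x ∈ tpow K V n) :
    degOne c x = 0 := by
  match n with
  | 0 =>
    obtain ⟨r, rfl⟩ := tpow_zero_eq hx
    rw [Algebra.algebraMap_eq_smul_one, map_smul, degOne_one, smul_zero]
  | 1 => exact absurd rfl hn
  | n + 2 =>
    suffices h : tpow K V (n + 1 + 1) ≤ LinearMap.ker (degOne c) from h hx
    refine tpow_succ_induction fun v x hx => ?_
    rw [LinearMap.mem_ker, degOne_ι_mul]
    suffices h : tpow K V (n + 1) ≤ LinearMap.ker (counitT c).toLinearMap by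
      have h0 : counitT c x = 0 := h hx
      rw [h0, zero_smul]
    exact tpow_succ_induction fun v x _ => counitT_ι_mul c v x

theorem counitT_eq_zero {n : ℕ} (hn : n ≠ 0) {x : TensorAlgebra K V} (hx : x ∈ tpow K V n) :
    counitT c x = 0 := by
  obtain ⟨n, rfl⟩ := Nat.exists_eq_succ_of_ne_zero hn
  suffices h : tpow K V (n + 1) ≤ LinearMap.ker (counitT c).toLinearMap from h hx
  exact tpow_succ_induction fun v x _ => counitT_ι_mul c v x

/-- Splitting off the first letter and projecting the rest to degree one recovers `v ⊗ w` from the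
word `v w`. -/
theorem pairMul_ι_injective : Function.Injective (pairMul (TensorAlgebra.ι K (M := V))) := by
  -- The operator `degOne` carries a braiding as a parameter but does not depend on it, so the zero
  -- map serves.
  have c : Braiding K V := ⟨0, by simp [leg₁]⟩
  have h : (degOne c).lTensor V ∘ₗ strip ∘ₗ pairMul (TensorAlgebra.ι K) = LinearMap.id := by
    refine TensorProduct.ext' fun v w => ?_
    simp [strip_ι_mul]
  exact Function.LeftInverse.injective (g := (degOne c).lTensor V ∘ₗ strip)
    fun z => LinearMap.congr_fun h z

end DegreeOne

/-! ### The component `Δ^{1,*}` of the comultiplication and its recursion. -/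

section ComulOne

variable (c : Braiding K V)

theorem braidVT_one (v : V) : braidVT c v 1 = 1 ⊗ₜ v := by
  rw [braidVT, braidVOf_apply, map_one]; rfl

theorem braidVT_mul_ι (v : V) (a : TensorAlgebra K V) (w : V) :
    braidVT c v (a * TensorAlgebra.ι K w) = moveV c (TensorAlgebra.ι K) w (braidVT c v a) := by
  have h : (moveT c (TensorAlgebra.ι K w)).unop = moveV c (TensorAlgebra.ι K) w := by
    rw [moveT, TensorAlgebra.lift_ι_apply]; rfl
  rw [braidVT, braidVOf_apply, map_mul, MulOpposite.unop_mul, h]; rfl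

/-- A subspace of the tensor algebra which contains `1` and is stable under right multiplication by
the elements of `V` is everything. -/
theorem tensor_induction_right (P : Submodule K (TensorAlgebra K V)) (h1 : 1 ∈ P)
    (h : ∀ x ∈ P, ∀ v, x * TensorAlgebra.ι K v ∈ P) (t : TensorAlgebra K V) : t ∈ P := by
  suffices key : ∀ t : TensorAlgebra K V, ∀ y ∈ P, y * t ∈ P by simpa using key t 1 h1
  intro t
  induction t using TensorAlgebra.induction with
  | algebraMap r =>
    intro y hy; rw [← Algebra.commutes, ← Algebra.smul_def]; exact P.smul_mem r hy
  | ι v => exact fun y hy => h y hy v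
  | mul a b ha hb => intro y hy; rw [← mul_assoc]; exact hb _ (ha _ hy)
  | add a b ha hb => intro y hy; rw [mul_add]; exact P.add_mem (ha y hy) (hb y hy)

/-- Linear maps out of the tensor algebra are determined by a recursion along right
multiplications by elements of `V`. -/
theorem tensor_hom_ext_right {M : Type*} [AddCommGroup M] [Module K M]
    {f g : TensorAlgebra K V →ₗ[K] M} (h1 : f 1 = g 1)
    (h : ∀ x v, f x = g x → f (x * TensorAlgebra.ι K v) = g (x * TensorAlgebra.ι K v)) :
    f = g := by
  refine LinearMap.ext fun t => ?_
  have := tensor_induction_right (LinearMap.ker (f - g))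
    (by rw [LinearMap.mem_ker, LinearMap.sub_apply, h1, sub_self])
    (fun x hx v => by
      rw [LinearMap.mem_ker, LinearMap.sub_apply, sub_eq_zero] at hx ⊢
      exact h x v hx) t
  rwa [LinearMap.mem_ker, LinearMap.sub_apply, sub_eq_zero] at this

/-- Moving past `w` multiplies the algebra factor on the right by a letter, and the counit kills
such products. -/
theorem counitT_rTensor_moveV (w : V) (y : TensorAlgebra K V ⊗[K] V) :
    (counitT c).toLinearMap.rTensor V (moveV c (TensorAlgebra.ι K) w y) = 0 := by
  induction y with
  | zero => simp
  | add s t hs ht => simp only [map_add, hs, ht, add_zero]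
  | tmul a v =>
    rw [moveV_tmul]
    generalize c.map (v ⊗ₜ w) = q
    induction q with
    | zero => simp
    | add s t hs ht => simp only [TensorProduct.tmul_add, map_add, hs, ht, add_zero]
    | tmul q₁ q₂ => simp [counitT]

/-- The algebra factor acquires one letter from `c` on its right, so its degree one part is that
letter times the counit of what stood before. -/
theorem degOne_rTensor_moveV (w : V) (y : TensorAlgebra K V ⊗[K] V) :
    (degOne c).rTensor V (moveV c (TensorAlgebra.ι K) w y) =
      c.map (TensorProduct.lid K V ((counitT c).toLinearMap.rTensor V y) ⊗ₜ w) := by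
  induction y with
  | zero => simp
  | add s t hs ht => simp only [map_add, hs, ht, TensorProduct.add_tmul]
  | tmul a v =>
    rw [moveV_tmul, LinearMap.rTensor_tmul, TensorProduct.lid_tmul, ← TensorProduct.smul_tmul',
      map_smul]
    generalize c.map (v ⊗ₜ w) = q
    induction q with
    | zero => simp
    | add s t hs ht => simp only [TensorProduct.tmul_add, map_add, hs, ht, smul_add]
    | tmul q₁ q₂ => simp [degOne_mul_ι, TensorProduct.smul_tmul']

/-- Compatibility of the braiding with the counit. Both sides vanish on right multiples of letters,
so the claim reduces to its value at `1`. -/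
theorem counitT_rTensor_braidVT (v : V) (a : TensorAlgebra K V) :
    (counitT c).toLinearMap.rTensor V (braidVT c v a) = counitT c a ⊗ₜ v := by
  have h : (counitT c).toLinearMap.rTensor V ∘ₗ braidVT c v =
      (TensorProduct.mk K K V).flip v ∘ₗ (counitT c).toLinearMap := by
    refine tensor_hom_ext_right (by simp [braidVT_one]) fun x w _ => ?_
    rw [LinearMap.comp_apply, braidVT_mul_ι, counitT_rTensor_moveV]
    simp [counitT]
  exact LinearMap.congr_fun h a

/-- The component `V ⊗ V → V ⊗ V` of the braiding of `V` with the tensor algebra is `c`. -/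
theorem degOne_rTensor_braidVT (v : V) (a : TensorAlgebra K V) :
    (degOne c).rTensor V (braidVT c v a) = c.map (v ⊗ₜ degOne c a) := by
  have h : (degOne c).rTensor V ∘ₗ braidVT c v = c.map ∘ₗ TensorProduct.mk K V V v ∘ₗ degOne c := by
    refine tensor_hom_ext_right (by simp [braidVT_one]) fun x w _ => ?_
    -- Only the counit of the earlier letters survives, and the braiding leaves `v` unchanged in
    -- front of it. What remains is a single application of `c` to `v` and the last letter.
    rw [LinearMap.comp_apply, braidVT_mul_ι, degOne_rTensor_moveV, counitT_rTensor_braidVT]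
    simp [degOne_mul_ι, ← TensorProduct.smul_tmul']
  exact LinearMap.congr_fun h a

/-- The component `T → V ⊗ T` of the comultiplication. -/
noncomputable def comulOne : TensorAlgebra K V →ₗ[K] V ⊗[K] TensorAlgebra K V :=
  (degOne c).rTensor (TensorAlgebra K V) ∘ₗ comulT c

/-- For `L : V → End M`, the operator `v ⊗ (w ⊗ x) ↦ (V ⊗ L) (c (v ⊗ w) ⊗ x)`. -/
noncomputable def braidPush {M : Type*} [AddCommGroup M] [Module K M]
    (L : V →ₗ[K] Module.End K M) : V ⊗[K] (V ⊗[K] M) →ₗ[K] V ⊗[K] M :=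
  (TensorProduct.lift L).lTensor V ∘ₗ (TensorProduct.assoc K V V M).toLinearMap ∘ₗ
    c.map.rTensor M ∘ₗ (TensorProduct.assoc K V V M).symm.toLinearMap

/-- Left multiplication by elements of `V`. -/
noncomputable def mulV : V →ₗ[K] Module.End K (TensorAlgebra K V) :=
  LinearMap.mul K (TensorAlgebra K V) ∘ₗ TensorAlgebra.ι K

/-- Naturality of `braidPush`: the braiding touches only the two copies of `V`, so any map that
intertwines the two actions of `V` passes through. It is applied to `Γ`, which intertwines
concatenation and shuffling with a letter. -/
theorem braidPush_lTensor {M N : Type*} [AddCommGroup M] [Module K M] [AddCommGroup N] [Module K N]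
    (L : V →ₗ[K] Module.End K M) (L' : V →ₗ[K] Module.End K N) (f : M →ₗ[K] N)
    (hf : ∀ v x, f (L v x) = L' v (f x)) (v : V) (y : V ⊗[K] M) :
    f.lTensor V (braidPush c L (v ⊗ₜ y)) = braidPush c L' (v ⊗ₜ f.lTensor V y) := by
  induction y with
  | zero => simp
  | add s t hs ht => simp only [TensorProduct.tmul_add, map_add, hs, ht]
  | tmul w x =>
    simp only [braidPush, LinearMap.comp_apply, LinearEquiv.coe_coe, TensorProduct.assoc_symm_tmul,
      LinearMap.lTensor_tmul, LinearMap.rTensor_tmul]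
    generalize c.map (v ⊗ₜ w) = q
    induction q with
    | zero => simp
    | add s t hs ht => simp only [TensorProduct.add_tmul, map_add, hs, ht]
    | tmul q₁ q₂ => simp [hf]

theorem comulT_one : comulT c 1 = 1 ⊗ₜ 1 := by
  rw [comulT, comulOf_apply, map_one]; rfl

theorem comulT_ι_mul (v : V) (x : TensorAlgebra K V) :
    comulT c (TensorAlgebra.ι K v * x) = primV (TensorAlgebra.ι K) (braidVT c) v (comulT c x) := by
  rw [comulT, comulOf_apply, map_mul, Module.End.mul_apply, primT, TensorAlgebra.lift_ι_apply]; rfl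

/-- The left counit law. In multiplication by `v ⊗ 1 + 1 ⊗ v` the counit kills the first summand. In
the second it passes through the braiding and leaves left multiplication by `v` on the other tensor
factor. -/
theorem counitT_comulT (x : TensorAlgebra K V) :
    (counitT c).toLinearMap.rTensor _ (comulT c x) = 1 ⊗ₜ x := by
  have h : (counitT c).toLinearMap.rTensor (TensorAlgebra K V) ∘ₗ comulT c =
      TensorProduct.mk K K (TensorAlgebra K V) 1 := by
    refine tensor_hom_ext (by simp [comulT_one]) fun v x hx => ?_
    rw [LinearMap.comp_apply, comulT_ι_mul]
    have key : ∀ y : TensorAlgebra K V ⊗[K] TensorAlgebra K V,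
        (counitT c).toLinearMap.rTensor _ (primV (TensorAlgebra.ι K) (braidVT c) v y) =
        (mulV v).lTensor K ((counitT c).toLinearMap.rTensor _ y) := by
      intro y
      induction y with
      | zero => simp
      | add s t hs ht => simp only [map_add, hs, ht]
      | tmul a b =>
        have h2 : ∀ z : TensorAlgebra K V ⊗[K] V,
            (counitT c).toLinearMap.rTensor _ (absorbRight (TensorAlgebra.ι K) (z ⊗ₜ b)) =
            (LinearMap.mulRight K b ∘ₗ TensorAlgebra.ι K).lTensor K
              ((counitT c).toLinearMap.rTensor V z) := by
          intro z
          induction z with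
          | zero => simp
          | add s t hs ht => simp only [TensorProduct.add_tmul, map_add, hs, ht]
          | tmul a b => simp
        rw [primV_tmul, map_add, h2, counitT_rTensor_braidVT]
        simp [mulV]
    rw [key]
    have hx' : (counitT c).toLinearMap.rTensor _ (comulT c x) = 1 ⊗ₜ x := hx
    rw [hx']
    simp [mulV]
  exact LinearMap.congr_fun h x

@[simp] theorem comulOne_one : comulOne c 1 = 0 := by
  simp [comulOne, comulT_one]

/-- Multiplication by `v ⊗ 1` contributes to degree one only where the left factor is a scalar, and
by the counit law this gives `v ⊗ x`. Multiplication by `1 ⊗ v` braids `v` past the left factor, and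
in degree one that braiding is `c`. -/
theorem comulOne_ι_mul (v : V) (x : TensorAlgebra K V) :
    comulOne c (TensorAlgebra.ι K v * x) = v ⊗ₜ x + braidPush c mulV (v ⊗ₜ comulOne c x) := by
  have key : ∀ y : TensorAlgebra K V ⊗[K] TensorAlgebra K V,
      (degOne c).rTensor _ (primV (TensorAlgebra.ι K) (braidVT c) v y) =
        v ⊗ₜ TensorProduct.lid K _ ((counitT c).toLinearMap.rTensor _ y) +
          braidPush c mulV (v ⊗ₜ (degOne c).rTensor _ y) := by
    intro y
    induction y with
    | zero => simp
    | add s t hs ht => simp only [map_add, TensorProduct.tmul_add, hs, ht]; abel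
    | tmul a b =>
      have h2 : ∀ z : TensorAlgebra K V ⊗[K] V,
          (degOne c).rTensor _ (absorbRight (TensorAlgebra.ι K) (z ⊗ₜ b)) =
          (LinearMap.mulRight K b ∘ₗ TensorAlgebra.ι K).lTensor V ((degOne c).rTensor V z) := by
        intro z
        induction z with
        | zero => simp
        | add s t hs ht => simp only [TensorProduct.add_tmul, map_add, hs, ht]
        | tmul a b => simp
      rw [primV_tmul, map_add, h2, degOne_rTensor_braidVT]
      congr 1
      · simp [degOne_ι_mul, TensorProduct.smul_tmul]
      · simp only [braidPush, LinearMap.comp_apply, LinearEquiv.coe_coe,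
          TensorProduct.assoc_symm_tmul, LinearMap.rTensor_tmul]
        generalize c.map (v ⊗ₜ degOne c a) = q
        induction q with
        | zero => simp
        | add s t hs ht => simp only [TensorProduct.add_tmul, map_add, hs, ht]
        | tmul q₁ q₂ => simp [mulV]
  rw [comulOne, LinearMap.comp_apply, comulT_ι_mul, key, counitT_comulT, TensorProduct.lid_tmul,
    one_smul]
  rfl

end ComulOne

theorem range_lTensor_le {M : Type*} [AddCommGroup M] [Module K M] {Q : Submodule K M}
    {P : Submodule K (V ⊗[K] M)} (h : ∀ v, ∀ x ∈ Q, v ⊗ₜ x ∈ P) :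
    LinearMap.range (Q.subtype.lTensor V) ≤ P := by
  rintro _ ⟨y, rfl⟩
  induction y with
  | zero => rw [map_zero]; exact P.zero_mem
  | add s t hs ht => rw [map_add]; exact P.add_mem hs ht
  | tmul v x => exact h v _ x.2

theorem tmul_mem_range_lTensor {M : Type*} [AddCommGroup M] [Module K M] {Q : Submodule K M}
    (v : V) {x : M} (hx : x ∈ Q) : v ⊗ₜ[K] x ∈ LinearMap.range (Q.subtype.lTensor V) :=
  ⟨v ⊗ₜ ⟨x, hx⟩, rfl⟩

/-- Homogeneity of `Δ^{1,*}`: the second factor has degree exactly one less, which makes an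
induction on the degree possible for `θ`. -/
theorem comulOne_mem (c : Braiding K V) (n : ℕ) {t : TensorAlgebra K V} (ht : t ∈ tpow K V (n + 1)) :
    comulOne c t ∈ LinearMap.range ((tpow K V n).subtype.lTensor V) := by
  induction n generalizing t with
  | zero =>
    suffices h : tpow K V (0 + 1) ≤
        (LinearMap.range ((tpow K V 0).subtype.lTensor V)).comap (comulOne c) from h ht
    refine tpow_succ_induction fun v x hx => ?_
    have h0 : comulOne c x = 0 := by
      obtain ⟨r, rfl⟩ := tpow_zero_eq hx
      rw [Algebra.algebraMap_eq_smul_one, map_smul, comulOne_one, smul_zero]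
    rw [Submodule.mem_comap, comulOne_ι_mul, h0, TensorProduct.tmul_zero, map_zero, add_zero]
    exact tmul_mem_range_lTensor v hx
  | succ n ih =>
    suffices h : tpow K V (n + 1 + 1) ≤
        (LinearMap.range ((tpow K V (n + 1)).subtype.lTensor V)).comap (comulOne c) from h ht
    refine tpow_succ_induction fun v x hx => ?_
    rw [Submodule.mem_comap, comulOne_ι_mul]
    refine Submodule.add_mem _ (tmul_mem_range_lTensor v hx) ?_
    suffices h : LinearMap.range ((tpow K V n).subtype.lTensor V) ≤
        (LinearMap.range ((tpow K V (n + 1)).subtype.lTensor V)).comap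
          (braidPush c mulV ∘ₗ TensorProduct.mk K V _ v) from h (ih hx)
    refine range_lTensor_le fun w x hx => ?_
    simp only [Submodule.mem_comap, LinearMap.comp_apply, TensorProduct.mk_apply, braidPush,
      LinearEquiv.coe_coe, TensorProduct.assoc_symm_tmul, LinearMap.rTensor_tmul]
    generalize c.map (v ⊗ₜ w) = q
    induction q with
    | zero => simp
    | add s t hs ht => simp only [TensorProduct.add_tmul, map_add]; exact Submodule.add_mem _ hs ht
    | tmul q₁ q₂ =>
      simp only [TensorProduct.assoc_tmul, LinearMap.lTensor_tmul, TensorProduct.lift.tmul]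
      refine tmul_mem_range_lTensor q₁ ?_
      rw [add_comm]
      exact tpow_mul (ι_mem_tpow q₂) hx

/-! ### The homomorphism to the quantum shuffle algebra -/

section ShuffleMap

variable (c : Braiding K V)

theorem tpow_isInternal : DirectSum.IsInternal (tpow K V) :=
  DirectSum.Decomposition.isInternal (fun n => LinearMap.range (TensorAlgebra.ι K (M := V)) ^ n)

/-- Linear maps out of the tensor algebra agree if they agree on homogeneous tensors. -/
theorem tensor_hom_ext_tpow {M : Type*} [AddCommGroup M] [Module K M]
    {f g : TensorAlgebra K V →ₗ[K] M} (h : ∀ n, ∀ t ∈ tpow K V n, f t = g t) : f = g := by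
  refine LinearMap.ext fun t => ?_
  suffices hle : ⨆ n, tpow K V n ≤ LinearMap.eqLocus f g by
    rw [(tpow_isInternal (K := K) (V := V)).submodule_iSup_eq_top] at hle
    exact hle (Submodule.mem_top (x := t))
  exact iSup_le h

/-- The quantum shuffle algebra has the tensor algebra as its underlying space. -/
noncomputable def shEquiv : ShuffleAlgebra c ≃ₗ[K] TensorAlgebra K V :=
  LinearEquiv.ofBijective (DirectSum.coeLinearMap (tpow K V)) (tpow_isInternal (K := K) (V := V))

theorem shEquiv_lof (n : ℕ) (x : tpow K V n) :
    shEquiv c (DirectSum.lof K ℕ (ShPiece c) n (ShPiece.mk c n x)) = x :=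
  DirectSum.coeLinearMap_lof (tpow K V) n x

theorem shEquiv_one : shEquiv c 1 = 1 := shEquiv_lof c 0 ⟨1, one_mem_tpow⟩

theorem shEquiv_ι (v : V) : shEquiv c (ιSh c v) = TensorAlgebra.ι K v :=
  shEquiv_lof c 1 ⟨_, ι_mem_tpow v⟩

/-- The quantum shuffle product with an element of `V` from the left. -/
noncomputable def shMulV : V →ₗ[K] Module.End K (TensorAlgebra K V) :=
  LinearMap.llcomp K _ _ _ (shEquiv c).toLinearMap ∘ₗ
    LinearMap.lcomp K _ (shEquiv c).symm.toLinearMap ∘ₗ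
      LinearMap.mul K (ShuffleAlgebra c) ∘ₗ ιSh c

theorem shMulV_shEquiv (v : V) (y : ShuffleAlgebra c) :
    shMulV c v (shEquiv c y) = shEquiv c (ιSh c v * y) := by
  simp [shMulV]

/-- The sum over shuffles depends on the degrees of its arguments, so the formula can only be given
degree by degree. -/
theorem shMulV_apply (v : V) {n : ℕ} {x : TensorAlgebra K V} (hx : x ∈ tpow K V n) :
    shMulV c v x = sh (sigma c) 0 1 n (TensorAlgebra.ι K v * x) := by
  have h1 : x = shEquiv c (DirectSum.lof K ℕ (ShPiece c) n (ShPiece.mk c n ⟨x, hx⟩)) :=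
    (shEquiv_lof c n ⟨x, hx⟩).symm
  have h2 : ιSh c v * DirectSum.lof K ℕ (ShPiece c) n (ShPiece.mk c n ⟨x, hx⟩) =
      DirectSum.lof K ℕ (ShPiece c) (1 + n)
        (ShPiece.mk c (1 + n) (shMul c 1 n ⟨_, ι_mem_tpow v⟩ ⟨x, hx⟩)) := by
    simp only [ιSh, LinearMap.comp_apply, DirectSum.lof_eq_of]
    rw [DirectSum.of_mul_of]
    rfl
  nth_rewrite 1 [h1]
  rw [shMulV_shEquiv, h2, shEquiv_lof]
  rfl

theorem shMulV_one (v : V) : shMulV c v 1 = TensorAlgebra.ι K v := by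
  rw [shMulV_apply c v one_mem_tpow, sh_zero_right, mul_one]; rfl

/-- The shuffles of the letter `v` with a word are sorted by the first letter of the result. Either
it is `v`, or it comes from the first letter of the word, moved over `v` by `c`; what follows is
then again a shuffle of a letter with the shorter word. This is the shape of the recursion for
`comulOne`, with concatenation replaced by the shuffle product. -/
theorem strip_shMulV (v : V) (x : TensorAlgebra K V) :
    strip (shMulV c v x) = v ⊗ₜ x + braidPush c (shMulV c) (v ⊗ₜ strip x) := by
  suffices h : strip ∘ₗ shMulV c v = TensorProduct.mk K V _ v +
      braidPush c (shMulV c) ∘ₗ TensorProduct.mk K V _ v ∘ₗ strip from LinearMap.congr_fun h x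
  refine tensor_hom_ext_tpow fun n => ?_
  change tpow K V n ≤ LinearMap.eqLocus _ _
  cases n with
  | zero =>
    intro x hx
    obtain ⟨r, rfl⟩ := tpow_zero_eq hx
    rw [LinearMap.mem_eqLocus, Algebra.algebraMap_eq_smul_one]
    simp [shMulV_one]
  | succ n =>
    refine tpow_succ_induction fun w x hx => ?_
    rw [LinearMap.mem_eqLocus]
    have hwx : TensorAlgebra.ι K w * x ∈ tpow K V (n + 1) := by
      rw [add_comm]; exact tpow_mul (ι_mem_tpow w) hx
    simp only [LinearMap.add_apply, LinearMap.comp_apply, TensorProduct.mk_apply]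
    -- The recursive clause of `sh` is this dichotomy: its first summand reduces to the identity,
    -- and its second begins with one braiding of the two leading letters.
    rw [shMulV_apply c v hwx, sh, sh_zero_left, LinearMap.add_apply, map_add, Module.End.one_apply,
      strip_ι_mul, strip_ι_mul, Module.End.mul_apply, cyc, cyc, mul_one, ← mul_assoc, ← pairMul_tmul,
      sigma, sigma₀_pairMul]
    congr 1
    simp only [braidPush, LinearMap.comp_apply, LinearEquiv.coe_coe,
      TensorProduct.assoc_symm_tmul, LinearMap.rTensor_tmul]
    generalize c.map (v ⊗ₜ w) = q
    induction q with
    | zero => simp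
    | add s t hs ht => simp only [TensorProduct.add_tmul, map_add, add_mul, hs, ht]
    | tmul q₁ q₂ =>
      -- The remaining shuffles start at position one, so they act behind `q₁` and shuffle `q₂` into
      -- `x`.
      rw [pairMul_tmul, mul_assoc, sh_mul_left c 0 1 1 n (ι_mem_tpow q₁), strip_ι_mul,
        ← shMulV_apply c q₂ hx]
      rfl

theorem Gam_ι (v : V) : Gam c (TensorAlgebra.ι K v) = ιSh c v := TensorAlgebra.lift_ι_apply _ _

/-- The map `Γ`, as an endomorphism of the space `T`. -/
noncomputable def symmetrizer : Module.End K (TensorAlgebra K V) :=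
  (shEquiv c).toLinearMap ∘ₗ (Gam c).toLinearMap

theorem symmetrizer_apply (t : TensorAlgebra K V) : symmetrizer c t = shEquiv c (Gam c t) := rfl

theorem symmetrizer_one : symmetrizer c 1 = 1 := by
  rw [symmetrizer_apply, map_one, shEquiv_one]

theorem symmetrizer_ι (v : V) : symmetrizer c (TensorAlgebra.ι K v) = TensorAlgebra.ι K v := by
  rw [symmetrizer_apply, Gam_ι, shEquiv_ι]

theorem symmetrizer_ι_mul (v : V) (t : TensorAlgebra K V) :
    symmetrizer c (TensorAlgebra.ι K v * t) = shMulV c v (symmetrizer c t) := by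
  rw [symmetrizer_apply, map_mul, Gam_ι, symmetrizer_apply, shMulV_shEquiv]

theorem symmetrizer_pairMul (z : V ⊗[K] V) :
    symmetrizer c (pairMul (TensorAlgebra.ι K) z) = pairMul (TensorAlgebra.ι K) (z + c.map z) := by
  have h : (Gam c).toLinearMap ∘ₗ TensorAlgebra.ι K = ιSh c := TensorAlgebra.ι_comp_lift _
  rw [symmetrizer_apply, UQ.pairMul_comp, h, pairMul_ιSh, shEquiv_lof]

/-- `Γ` is compatible with the comultiplications, in the components `(1, n)`. -/
theorem strip_symmetrizer (t : TensorAlgebra K V) :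
    strip (symmetrizer c t) = (symmetrizer c).lTensor V (comulOne c t) := by
  suffices h : strip ∘ₗ symmetrizer c = (symmetrizer c).lTensor V ∘ₗ comulOne c from
    LinearMap.congr_fun h t
  refine tensor_hom_ext (by simp [symmetrizer_one]) fun v x hx => ?_
  simp only [LinearMap.comp_apply] at hx ⊢
  -- The two sides obey the same recursion, and `Γ` is carried past the braiding by naturality.
  rw [symmetrizer_ι_mul, strip_shMulV, hx, comulOne_ι_mul, map_add, LinearMap.lTensor_tmul,
    braidPush_lTensor c mulV (shMulV c) (symmetrizer c) (symmetrizer_ι_mul c)]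

theorem symmetrizer_mem {n : ℕ} {t : TensorAlgebra K V} (ht : t ∈ tpow K V n) :
    symmetrizer c t ∈ tpow K V n := by
  induction n generalizing t with
  | zero =>
    obtain ⟨r, rfl⟩ := tpow_zero_eq ht
    rw [Algebra.algebraMap_eq_smul_one, map_smul, symmetrizer_one]
    exact Submodule.smul_mem _ _ one_mem_tpow
  | succ n ih =>
    suffices h : tpow K V (n + 1) ≤ (tpow K V (n + 1)).comap (symmetrizer c) from h ht
    refine tpow_succ_induction fun v x hx => ?_
    rw [Submodule.mem_comap, symmetrizer_ι_mul, shMulV_apply c v (ih hx)]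
    refine ((sh_mem_leftOps c 0 1 n (n + 1) (by omega)) _ ?_).1
    rw [add_comm]
    exact tpow_mul (ι_mem_tpow v) (ih hx)

/-- Positive degree is essential, since removal of the first letter kills the scalars. -/
theorem cons_strip {n : ℕ} {t : TensorAlgebra K V} (ht : t ∈ tpow K V (n + 1)) :
    cons (strip t) = t := by
  suffices h : tpow K V (n + 1) ≤ LinearMap.ker (cons ∘ₗ strip - LinearMap.id) by
    have := h ht
    rwa [LinearMap.mem_ker, LinearMap.sub_apply, sub_eq_zero] at this
  refine tpow_succ_induction fun v x _ => ?_
  simp [strip_ι_mul]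

end ShuffleMap

/-! ### The quadratic symmetric algebra and the Nichols algebra -/

section Nichols

variable (c : Braiding K V)

theorem sqToNichols_proj (t : TensorAlgebra K V) :
    sqToNichols c (UQ.proj c 0 t) = toNichols c t := by
  rw [sqToNichols, UQ.lift_proj]
  exact DFunLike.congr_fun (TensorAlgebra.lift_comp_ι (toNichols c)) t

theorem symmetrizer_eq_zero_iff (t : TensorAlgebra K V) :
    symmetrizer c t = 0 ↔ toNichols c t = 0 := by
  rw [symmetrizer_apply, LinearEquiv.map_eq_zero_iff, ← Subtype.coe_inj]; rfl

theorem sqToNichols_surjective : Function.Surjective (sqToNichols c) := by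
  intro y
  obtain ⟨t, rfl⟩ := (Gam c).rangeRestrict_surjective y
  exact ⟨UQ.proj c 0 t, sqToNichols_proj c t⟩

/-- The map `S_Q → T` induced by `Γ`. -/
noncomputable def sqSymmetrizer : UQ c 0 →ₗ[K] TensorAlgebra K V :=
  (shEquiv c).toLinearMap ∘ₗ (Nichols c).val.toLinearMap ∘ₗ (sqToNichols c).toLinearMap

theorem sqSymmetrizer_proj (t : TensorAlgebra K V) :
    sqSymmetrizer c (UQ.proj c 0 t) = symmetrizer c t := by
  simp only [sqSymmetrizer, LinearMap.comp_apply, AlgHom.toLinearMap_apply, sqToNichols_proj]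
  rfl

/-- If `S_Q → B` is injective, then an element of degree `n + 1` of `S_Q` is zero as soon as its
component of bidegree `(1, n)` of its comultiplication is zero. -/
theorem proj_eq_zero_of_comulOne (hc : Function.Injective (sqToNichols c)) {n : ℕ}
    {t : TensorAlgebra K V} (ht : t ∈ tpow K V (n + 1))
    (h : (UQ.proj c 0).toLinearMap.lTensor V (comulOne c t) = 0) : UQ.proj c 0 t = 0 := by
  -- Because `Γ` factors through `S_Q`, the tensor `(V ⊗ Γ)(Δ^{1,n}(t))` depends only on the image
  -- of `Δ^{1,n}(t)` in `V ⊗ S_Q`.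
  have h1 : symmetrizer c = sqSymmetrizer c ∘ₗ (UQ.proj c 0).toLinearMap :=
    LinearMap.ext fun t => (sqSymmetrizer_proj c t).symm
  have h2 : symmetrizer c t = 0 := by
    rw [← cons_strip (symmetrizer_mem c ht), strip_symmetrizer, h1, LinearMap.lTensor_comp,
      LinearMap.comp_apply, h, map_zero, map_zero]
  -- Up to here only the factorization of `Γ` was used; injectivity of `S_Q → B` turns `Γ(t) = 0`
  -- into the vanishing of `t` in `S_Q`.
  apply hc
  rw [sqToNichols_proj, map_zero, ← symmetrizer_eq_zero_iff, h2]

end Nichols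

/-! ### The grading of the Nichols algebra and its quadratic relations. -/

section NicholsQuadratic

variable (c : Braiding K V)

theorem lof_mem_range_iff (n : ℕ) (y : ShuffleAlgebra c) :
    y ∈ LinearMap.range (DirectSum.lof K ℕ (ShPiece c) n) ↔ shEquiv c y ∈ tpow K V n := by
  constructor
  · rintro ⟨x, rfl⟩
    exact (shEquiv_lof c n x).symm ▸ x.2
  · intro h
    refine ⟨ShPiece.mk c n ⟨_, h⟩, (shEquiv c).injective ?_⟩
    rw [shEquiv_lof]

theorem mem_nicholsGrading_iff (n : ℕ) (y : Nichols c) :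
    y ∈ nicholsGrading c n ↔ shEquiv c y ∈ tpow K V n := lof_mem_range_iff c n y

theorem map_toNichols_le (n : ℕ) :
    (tpow K V n).map (toNichols c).toLinearMap ≤ nicholsGrading c n := by
  rintro _ ⟨t, ht, rfl⟩
  exact (mem_nicholsGrading_iff c n _).2 (symmetrizer_mem c ht)

theorem toNichols_surjective : Function.Surjective (toNichols c) :=
  (Gam c).rangeRestrict_surjective

theorem iSup_map_toNichols : ⨆ n, (tpow K V n).map (toNichols c).toLinearMap = ⊤ := by
  rw [← Submodule.map_iSup, (tpow_isInternal (K := K) (V := V)).submodule_iSup_eq_top,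
    Submodule.map_top, LinearMap.range_eq_top]
  exact toNichols_surjective c

/-- Independence is inherited from the powers of `V` in `T`, along the injective linear map from the
Nichols algebra to the space underlying the shuffle algebra. -/
theorem iSupIndep_nicholsGrading : iSupIndep (nicholsGrading c) := by
  have h := (tpow_isInternal (K := K) (V := V)).submodule_iSupIndep
  have hinj : Function.Injective ((shEquiv c).toLinearMap ∘ₗ (Nichols c).val.toLinearMap) :=
    (shEquiv c).injective.comp Subtype.val_injective
  intro n
  rw [Submodule.disjoint_def]
  intro y hy hy'
  refine hinj ?_
  rw [map_zero]
  refine Submodule.disjoint_def.1 (h n) _ ((mem_nicholsGrading_iff c n y).1 hy) ?_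
  suffices hle : ⨆ (j) (_ : j ≠ n), nicholsGrading c j ≤ (⨆ (j) (_ : j ≠ n), tpow K V j).comap
    ((shEquiv c).toLinearMap ∘ₗ (Nichols c).val.toLinearMap) from hle hy'
  exact iSup₂_le fun j hj y hy => Submodule.mem_iSup_of_mem j (Submodule.mem_iSup_of_mem hj
    ((mem_nicholsGrading_iff c j y).1 hy))

theorem nicholsGrading_isInternal : DirectSum.IsInternal (nicholsGrading c) := by
  refine DirectSum.isInternal_submodule_of_iSupIndep_of_iSup_eq_top (iSupIndep_nicholsGrading c) ?_
  rw [eq_top_iff, ← iSup_map_toNichols]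
  exact iSup_mono (map_toNichols_le c)

/-- The grading was defined by restriction from the shuffle algebra; because `Γ` is homogeneous and
its image is all of `B`, it coincides with the grading by images of homogeneous tensors. In this
form it is visibly multiplicative and generated in degree one. -/
theorem nicholsGrading_eq (n : ℕ) :
    nicholsGrading c n = (tpow K V n).map (toNichols c).toLinearMap := by
  refine le_antisymm (fun y hy => ?_) (map_toNichols_le c n)
  have h1 : y ∈ ⨆ n, (tpow K V n).map (toNichols c).toLinearMap := by
    rw [iSup_map_toNichols]; exact Submodule.mem_top
  have h2 : ⨆ m, (tpow K V m).map (toNichols c).toLinearMap ≤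
      (tpow K V n).map (toNichols c).toLinearMap ⊔ ⨆ (j) (_ : j ≠ n), nicholsGrading c j := by
    refine iSup_le fun m => ?_
    by_cases hm : m = n
    · subst hm; exact le_sup_left
    · exact le_sup_of_le_right ((map_toNichols_le c m).trans (le_iSup₂_of_le m hm le_rfl))
  -- Here `a` is an image of a tensor of degree `n`, while `b` collects the other degrees. As the
  -- difference of `a + b` and `a`, the element `b` also has degree `n`, so independence makes it
  -- zero.
  obtain ⟨a, ha, b, hb, rfl⟩ := Submodule.mem_sup.1 (h2 h1)
  have hb' : b ∈ nicholsGrading c n := by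
    have := Submodule.sub_mem _ hy (map_toNichols_le c n ha)
    rwa [add_sub_cancel_left] at this
  rw [Submodule.disjoint_def.1 (iSupIndep_nicholsGrading c n) b hb' hb, add_zero]
  exact ha

theorem nicholsGrading_gradedMonoid : SetLike.GradedMonoid (nicholsGrading c) where
  one_mem := by
    rw [mem_nicholsGrading_iff]
    exact (shEquiv_one c).symm ▸ one_mem_tpow
  mul_mem := by
    intro m n x y hx hy
    rw [nicholsGrading_eq] at hx hy ⊢
    obtain ⟨s, hs, rfl⟩ := hx
    obtain ⟨t, ht, rfl⟩ := hy
    exact ⟨s * t, tpow_mul hs ht, map_mul (toNichols c) s t⟩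

theorem toNichols_one_ne_zero : (1 : Nichols c) ≠ 0 := by
  intro h
  have h1 : toNichols c 1 = 0 := by rw [map_one, h]
  rw [← symmetrizer_eq_zero_iff, symmetrizer_one] at h1
  exact one_ne_zero h1

theorem toNichols_ι_mem (v : V) : toNichols c (TensorAlgebra.ι K v) ∈ nicholsGrading c 1 :=
  map_toNichols_le c 1 ⟨_, ι_mem_tpow v, rfl⟩

/-- The identification of `V` with the component of degree one of the Nichols algebra. -/
noncomputable def nicholsOne : V ≃ₗ[K] nicholsGrading c 1 :=
  LinearEquiv.ofBijective
    (((toNichols c).toLinearMap ∘ₗ TensorAlgebra.ι K).codRestrict (nicholsGrading c 1)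
      (toNichols_ι_mem c)) (by
    constructor
    · refine (injective_iff_map_eq_zero _).2 fun v hv => ?_
      have h : toNichols c (TensorAlgebra.ι K v) = 0 := congrArg Subtype.val hv
      rw [← symmetrizer_eq_zero_iff, symmetrizer_ι] at h
      exact (TensorAlgebra.ι_eq_zero_iff (R := K) v).1 h
    · rintro ⟨y, hy⟩
      rw [nicholsGrading_eq, tpow, pow_one] at hy
      obtain ⟨_, ⟨v, rfl⟩, rfl⟩ := hy
      exact ⟨v, rfl⟩)

theorem nicholsOne_apply (v : V) :
    (nicholsOne c v : Nichols c) = toNichols c (TensorAlgebra.ι K v) := rfl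

/-! ### Transport of quadratic relations along an isomorphism of generators. -/

section Relations

variable {A : Type*} [Ring A] [Algebra K A] {W : Submodule K A} (e : V ≃ₗ[K] W)

/-- The isomorphism of tensor algebras given by an isomorphism `V ≃ W`. -/
noncomputable def tensorEquiv : TensorAlgebra K V ≃ₐ[K] TensorAlgebra K W :=
  AlgEquiv.ofAlgHom (TensorAlgebra.lift K (TensorAlgebra.ι K ∘ₗ e.toLinearMap))
    (TensorAlgebra.lift K (TensorAlgebra.ι K ∘ₗ e.symm.toLinearMap))
    (by ext w; simp) (by ext v; simp)

@[simp] theorem tensorEquiv_ι (v : V) :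
    tensorEquiv e (TensorAlgebra.ι K v) = TensorAlgebra.ι K (e v) := by
  simp [tensorEquiv]

@[simp] theorem tensorEquiv_symm_ι (w : W) :
    (tensorEquiv e).symm (TensorAlgebra.ι K w) = TensorAlgebra.ι K (e.symm w) := by
  simp [tensorEquiv]

theorem tensorEquiv_mem {n : ℕ} {t : TensorAlgebra K V} (ht : t ∈ tpow K V n) :
    tensorEquiv e t ∈ LinearMap.range (TensorAlgebra.ι K (M := W)) ^ n := by
  have h : (tpow K V n).map (tensorEquiv e).toAlgHom.toLinearMap ≤
      LinearMap.range (TensorAlgebra.ι K (M := W)) ^ n := by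
    rw [tpow, Submodule.map_pow]
    refine pow_le_pow_left' ?_ n
    rintro _ ⟨_, ⟨v, rfl⟩, rfl⟩
    exact ⟨e v, (tensorEquiv_ι e v).symm⟩
  exact h ⟨t, ht, rfl⟩

theorem tensorEquiv_symm_mem {n : ℕ} {t : TensorAlgebra K W}
    (ht : t ∈ LinearMap.range (TensorAlgebra.ι K (M := W)) ^ n) :
    (tensorEquiv e).symm t ∈ tpow K V n := by
  have h : (LinearMap.range (TensorAlgebra.ι K (M := W)) ^ n).map
      (tensorEquiv e).symm.toAlgHom.toLinearMap ≤ tpow K V n := by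
    rw [tpow, Submodule.map_pow]
    refine pow_le_pow_left' ?_ n
    rintro _ ⟨_, ⟨w, rfl⟩, rfl⟩
    exact ⟨e.symm w, (tensorEquiv_symm_ι e w).symm⟩
  exact h ⟨t, ht, rfl⟩

/-- The condition that an algebra has quadratic relations, in terms of an isomorphic space of
generators. -/
theorem relations_iff (f : TensorAlgebra K V →ₐ[K] A)
    (hf : ∀ v, f (TensorAlgebra.ι K v) = e v) :
    TwoSidedIdeal.ker (TensorAlgebra.lift K W.subtype) =
      TwoSidedIdeal.span {t : TensorAlgebra K W |
        t ∈ LinearMap.range (TensorAlgebra.ι K (M := W)) ^ 2 ∧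
          TensorAlgebra.lift K W.subtype t = 0} ↔
    ∀ t, f t = 0 → t ∈ TwoSidedIdeal.span {t | t ∈ tpow K V 2 ∧ f t = 0} := by
  have hlift : ∀ t, TensorAlgebra.lift K W.subtype (tensorEquiv e t) = f t := by
    have h : (TensorAlgebra.lift K W.subtype).comp (tensorEquiv e).toAlgHom = f := by
      ext v; simp [hf]
    exact DFunLike.congr_fun h
  constructor
  · intro h t ht
    have h1 : tensorEquiv e t ∈ TwoSidedIdeal.ker (TensorAlgebra.lift K W.subtype) := by
      rw [TwoSidedIdeal.mem_ker, hlift, ht]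
    rw [h] at h1
    -- The isomorphism of tensor algebras preserves degree two and the evaluation in `A`, so it
    -- matches the generators of the two ideals. Comparing an ideal with a preimage then reduces to
    -- these generators.
    suffices hle : TwoSidedIdeal.span {t : TensorAlgebra K W |
        t ∈ LinearMap.range (TensorAlgebra.ι K (M := W)) ^ 2 ∧
          TensorAlgebra.lift K W.subtype t = 0} ≤
        (TwoSidedIdeal.span {t | t ∈ tpow K V 2 ∧ f t = 0}).comap (tensorEquiv e).symm by
      have := (TwoSidedIdeal.mem_comap _).1 (hle h1)
      rwa [AlgEquiv.symm_apply_apply] at this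
    refine TwoSidedIdeal.span_le.2 ?_
    rintro s ⟨hs, hs'⟩
    refine (TwoSidedIdeal.mem_comap _).2 (TwoSidedIdeal.subset_span
      ⟨tensorEquiv_symm_mem e hs, ?_⟩)
    rw [← hlift, AlgEquiv.apply_symm_apply, hs']
  · intro h
    refine le_antisymm (fun s hs => ?_) (TwoSidedIdeal.span_le.2 fun s hs => ?_)
    · rw [TwoSidedIdeal.mem_ker, ← (tensorEquiv e).apply_symm_apply s, hlift] at hs
      suffices hle : TwoSidedIdeal.span {t | t ∈ tpow K V 2 ∧ f t = 0} ≤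
          (TwoSidedIdeal.span {t : TensorAlgebra K W |
            t ∈ LinearMap.range (TensorAlgebra.ι K (M := W)) ^ 2 ∧
              TensorAlgebra.lift K W.subtype t = 0}).comap (tensorEquiv e) by
        have := (TwoSidedIdeal.mem_comap _).1 (hle (h _ hs))
        rwa [AlgEquiv.apply_symm_apply] at this
      refine TwoSidedIdeal.span_le.2 ?_
      rintro t ⟨ht, ht'⟩
      refine (TwoSidedIdeal.mem_comap _).2 (TwoSidedIdeal.subset_span
        ⟨tensorEquiv_mem e ht, ?_⟩)
      rw [hlift, ht']
    · exact (TwoSidedIdeal.mem_ker _).2 hs.2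

end Relations

theorem exists_pairMul {t : TensorAlgebra K V} (ht : t ∈ tpow K V 2) :
    ∃ z, pairMul (TensorAlgebra.ι K) z = t := by
  suffices h : tpow K V 2 ≤ LinearMap.range (pairMul (TensorAlgebra.ι K)) from h ht
  rw [tpow, pow_two]
  refine Submodule.mul_le.2 ?_
  rintro _ ⟨v, rfl⟩ _ ⟨w, rfl⟩
  exact ⟨v ⊗ₜ w, rfl⟩

/-- The relations of degree two of the Nichols algebra are the elements of `E₂`. -/
theorem toNichols_pairMul_eq_zero_iff (z : V ⊗[K] V) :
    toNichols c (pairMul (TensorAlgebra.ι K) z) = 0 ↔ z ∈ E₂ c := by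
  rw [← symmetrizer_eq_zero_iff, symmetrizer_pairMul, map_eq_zero_iff _ pairMul_ι_injective, E₂,
    LinearMap.mem_ker, LinearMap.add_apply, LinearMap.id_apply, add_comm]

theorem UQ.proj_eq_zero_iff (β : QBracket c) (t : TensorAlgebra K V) :
    UQ.proj c β t = 0 ↔ t ∈ uqIdeal c β := by
  have h : UQ.proj c β t = 0 ↔ (uqIdeal c β).ringCon t 0 := by
    rw [← map_zero (UQ.proj c β)]
    exact (uqIdeal c β).ringCon.eq
  rw [h, TwoSidedIdeal.rel_iff, sub_zero]

theorem sqToNichols_injective_iff :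
    Function.Injective (sqToNichols c) ↔ ∀ t, toNichols c t = 0 → t ∈ uqIdeal c 0 := by
  rw [injective_iff_map_eq_zero, (UQ.proj_surjective c 0).forall]
  exact forall_congr' fun t => by rw [sqToNichols_proj, UQ.proj_eq_zero_iff]

/-- For the zero bracket the generators are the elements of `E₂` themselves, and these are all the
relations of the Nichols algebra in degree two. Thus `S_Q` is the quadratic algebra with the same
generators and quadratic relations as `B`. -/
theorem uqIdeal_zero :
    uqIdeal c 0 = TwoSidedIdeal.span {t | t ∈ tpow K V 2 ∧ toNichols c t = 0} := by
  rw [uqIdeal]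
  congr 1
  ext t
  constructor
  · rintro ⟨z, rfl⟩
    simp only [QBracket.zero_map, LinearMap.zero_apply, map_zero, sub_zero]
    exact ⟨pairMul_mem_tpow _, (toNichols_pairMul_eq_zero_iff c _).2 z.2⟩
  · rintro ⟨ht, ht'⟩
    obtain ⟨z, rfl⟩ := exists_pairMul ht
    exact ⟨⟨z, (toNichols_pairMul_eq_zero_iff c z).1 ht'⟩, by simp [QBracket.zero_map]⟩

/-- Every clause in the definition of a quadratic algebra except the one on relations holds for all
Nichols algebras. After identifying the degree one part with `V`, that clause says that `ker Γ` is
contained in the ideal defining `S_Q`, which is injectivity of the always surjective map `S_Q → B`.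
-/
theorem isQuadraticAlgebra_iff :
    IsQuadraticAlgebra (nicholsGrading c) ↔ Function.Bijective (sqToNichols c) := by
  constructor
  · intro h
    exact ⟨(relations_iff (nicholsOne c) (toNichols c) fun v => (nicholsOne_apply c v).symm).1
      h.relations |> fun h => (sqToNichols_injective_iff c).2 ((uqIdeal_zero c).symm ▸ h),
      sqToNichols_surjective c⟩
  · intro h
    refine ⟨nicholsGrading_gradedMonoid c, nicholsGrading_isInternal c, ?_, ?_, ?_, ?_⟩
    · rw [nicholsGrading_eq, tpow, pow_zero, Submodule.map_one]
    · have : Nontrivial (Nichols c) := ⟨1, 0, toNichols_one_ne_zero c⟩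
      exact (algebraMap K (Nichols c)).injective
    · rw [eq_top_iff]
      intro y hy
      obtain ⟨t, rfl⟩ := toNichols_surjective c y
      clear hy
      induction t using TensorAlgebra.induction with
      | algebraMap r => rw [AlgHom.commutes]; exact Subalgebra.algebraMap_mem _ r
      | ι v => exact Algebra.subset_adjoin (toNichols_ι_mem c v)
      | mul a b ha hb => rw [map_mul]; exact Subalgebra.mul_mem _ ha hb
      | add a b ha hb => rw [map_add]; exact Subalgebra.add_mem _ ha hb
    · refine (relations_iff (nicholsOne c) (toNichols c)
        fun v => (nicholsOne_apply c v).symm).2 ?_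
      rw [← uqIdeal_zero]
      exact (sqToNichols_injective_iff c).1 h.1

end NicholsQuadratic

/-! ### The grading of the braided bialgebra `T(V,c)` -/

section Graded

variable (c : Braiding K V)

/-- The image of `V^{⊗ i} ⊗ V^{⊗ j}` in `T ⊗ T`. -/
noncomputable def tpowTens (i j : ℕ) : Submodule K (TensorAlgebra K V ⊗[K] TensorAlgebra K V) :=
  LinearMap.range (TensorProduct.map (tpow K V i).subtype (tpow K V j).subtype)

theorem tmul_mem_tpowTens {i j : ℕ} {a b : TensorAlgebra K V} (ha : a ∈ tpow K V i)
    (hb : b ∈ tpow K V j) : a ⊗ₜ b ∈ tpowTens (K := K) (V := V) i j :=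
  ⟨⟨a, ha⟩ ⊗ₜ ⟨b, hb⟩, rfl⟩

theorem tpowTens_le {i j : ℕ} {P : Submodule K (TensorAlgebra K V ⊗[K] TensorAlgebra K V)}
    (h : ∀ a ∈ tpow K V i, ∀ b ∈ tpow K V j, a ⊗ₜ b ∈ P) : tpowTens i j ≤ P := by
  rintro _ ⟨y, rfl⟩
  induction y with
  | zero => rw [map_zero]; exact P.zero_mem
  | add s t hs ht => rw [map_add]; exact P.add_mem hs ht
  | tmul a b => exact h _ a.2 _ b.2

theorem tpow_succ_induction_right {n : ℕ} {P : Submodule K (TensorAlgebra K V)}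
    (h : ∀ x ∈ tpow K V n, ∀ v, x * TensorAlgebra.ι K v ∈ P) : tpow K V (n + 1) ≤ P := by
  rw [tpow, pow_succ]
  refine Submodule.mul_le.2 ?_
  rintro x hx _ ⟨v, rfl⟩
  exact h x hx v

theorem tpow_zero_le {P : Submodule K (TensorAlgebra K V)} (h : 1 ∈ P) : tpow K V 0 ≤ P := by
  rw [tpow, pow_zero]; exact Submodule.one_le.2 h

/-- The induction adds letters on the right because the braiding of `V` with `T` comes from a right
action: each new letter passes through `c` and contributes one letter to the algebra factor. -/
theorem braidVT_mem (n : ℕ) {a : TensorAlgebra K V} (ha : a ∈ tpow K V n) (v : V) :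
    braidVT c v a ∈ LinearMap.range ((tpow K V n).subtype.rTensor V) := by
  have hmem : ∀ {n : ℕ} {a : TensorAlgebra K V}, a ∈ tpow K V n → ∀ v : V,
      a ⊗ₜ[K] v ∈ LinearMap.range ((tpow K V n).subtype.rTensor V) :=
    fun ha v => ⟨⟨_, ha⟩ ⊗ₜ v, rfl⟩
  suffices h : tpow K V n ≤
      (LinearMap.range ((tpow K V n).subtype.rTensor V)).comap (braidVT c v) from h ha
  clear ha a
  induction n with
  | zero =>
    refine tpow_zero_le ?_
    rw [Submodule.mem_comap, braidVT_one]
    exact hmem one_mem_tpow v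
  | succ n ih =>
    refine tpow_succ_induction_right fun a ha w => ?_
    rw [Submodule.mem_comap, braidVT_mul_ι]
    obtain ⟨y, hy⟩ := ih ha
    rw [← hy]
    clear hy
    induction y with
    | zero => simp
    | add s t hs ht => simp only [map_add]; exact Submodule.add_mem _ hs ht
    | tmul a u =>
      rw [LinearMap.rTensor_tmul, moveV_tmul]
      generalize c.map (u ⊗ₜ w) = q
      induction q with
      | zero => simp
      | add s t hs ht => simp only [TensorProduct.tmul_add, map_add]; exact Submodule.add_mem _ hs ht
      | tmul q₁ q₂ => exact hmem (tpow_mul a.2 (ι_mem_tpow q₁)) q₂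

theorem crossVT_mem (m n : ℕ) (v : V) {a b : TensorAlgebra K V} (ha : a ∈ tpow K V m)
    (hb : b ∈ tpow K V n) :
    absorbRight (TensorAlgebra.ι K) (braidVT c v a ⊗ₜ b) ∈ tpowTens m (n + 1) := by
  obtain ⟨y, hy⟩ := braidVT_mem c m ha v
  rw [← hy]
  clear hy
  induction y with
  | zero => simp
  | add s t hs ht => simp only [map_add, TensorProduct.add_tmul]; exact Submodule.add_mem _ hs ht
  | tmul d u =>
    rw [LinearMap.rTensor_tmul, absorbRight_tmul, add_comm n]
    exact tmul_mem_tpowTens d.2 (tpow_mul (ι_mem_tpow u) hb)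

/-- Here letters are added on the left of `x`, since `crossT` is a left action. Each step preserves
the degree of the first factor of the result and raises that of the second by one. -/
theorem braidT_mem {m n : ℕ} {x y : TensorAlgebra K V} (hx : x ∈ tpow K V m)
    (hy : y ∈ tpow K V n) : braidT c (x ⊗ₜ y) ∈ tpowTens n m := by
  suffices h : tpow K V m ≤ (tpowTens n m).comap
      (LinearMap.applyₗ (y ⊗ₜ[K] (1 : TensorAlgebra K V)) ∘ₗ (crossT c).toLinearMap) from h hx
  clear hx x
  induction m with
  | zero =>
    refine tpow_zero_le ?_
    rw [Submodule.mem_comap, LinearMap.comp_apply, AlgHom.toLinearMap_apply, map_one]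
    exact tmul_mem_tpowTens hy one_mem_tpow
  | succ m ih =>
    refine tpow_succ_induction fun v x hx => ?_
    rw [Submodule.mem_comap, LinearMap.comp_apply, AlgHom.toLinearMap_apply, map_mul]
    nth_rewrite 1 [crossT]
    rw [TensorAlgebra.lift_ι_apply]
    suffices h : tpowTens n m ≤ (tpowTens n (m + 1)).comap
        (crossV (TensorAlgebra.ι K) (braidVT c) v) from h (ih hx)
    exact tpowTens_le fun a ha b hb => crossVT_mem c n m v ha hb

/-- Unlike the filtration estimate in `U_Q`, this is an exact statement on degrees. It supplies the
homogeneous representatives from which the comultiplication of the associated graded object is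
computed. -/
theorem comulT_mem {n : ℕ} {x : TensorAlgebra K V} (hx : x ∈ tpow K V n) :
    comulT c x ∈ ⨆ p ∈ Finset.HasAntidiagonal.antidiagonal n,
      tpowTens (K := K) (V := V) p.1 p.2 := by
  have hle : ∀ i j : ℕ, tpowTens (K := K) (V := V) i j ≤
      ⨆ p ∈ Finset.HasAntidiagonal.antidiagonal (i + j), tpowTens (K := K) (V := V) p.1 p.2 :=
    fun i j => le_iSup₂_of_le (i, j) (Finset.HasAntidiagonal.mem_antidiagonal.2 rfl) le_rfl
  suffices h : tpow K V n ≤ (⨆ p ∈ Finset.HasAntidiagonal.antidiagonal n,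
      tpowTens (K := K) (V := V) p.1 p.2).comap (comulT c) from h hx
  clear hx x
  induction n with
  | zero =>
    refine tpow_zero_le ?_
    rw [Submodule.mem_comap, comulT_one]
    exact hle 0 0 (tmul_mem_tpowTens one_mem_tpow one_mem_tpow)
  | succ n ih =>
    refine tpow_succ_induction fun v x hx => ?_
    rw [Submodule.mem_comap, comulT_ι_mul]
    suffices h : ⨆ p ∈ Finset.HasAntidiagonal.antidiagonal n, tpowTens (K := K) (V := V) p.1 p.2 ≤
        (⨆ p ∈ Finset.HasAntidiagonal.antidiagonal (n + 1),
          tpowTens (K := K) (V := V) p.1 p.2).comap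
        (primV (TensorAlgebra.ι K) (braidVT c) v) from h (ih hx)
    refine iSup₂_le ?_
    rintro ⟨i, j⟩ hij
    obtain rfl := Finset.HasAntidiagonal.mem_antidiagonal.1 hij
    refine tpowTens_le fun a ha b hb => ?_
    rw [Submodule.mem_comap, primV_tmul]
    refine Submodule.add_mem _ ?_ (hle i (j + 1) (crossVT_mem c i j v ha hb))
    rw [show i + j + 1 = (1 + i) + j by omega]
    exact hle (1 + i) j (tmul_mem_tpowTens (tpow_mul (ι_mem_tpow v) ha) hb)

/-- A family of homogeneous components of the comultiplication of a homogeneous element. -/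
theorem exists_comulT {n : ℕ} {x : TensorAlgebra K V} (hx : x ∈ tpow K V n) :
    ∃ w : ∀ p : ℕ × ℕ, tpow K V p.1 ⊗[K] tpow K V p.2,
      ∑ p ∈ Finset.HasAntidiagonal.antidiagonal n,
        TensorProduct.map (tpow K V p.1).subtype (tpow K V p.2).subtype (w p) = comulT c x := by
  obtain ⟨f, hf⟩ := (Submodule.mem_iSup_finset_iff_exists_sum _ _).1 (comulT_mem c hx)
  choose w hw using fun p => (f p).2
  exact ⟨w, by rw [← hf]; exact Finset.sum_congr rfl fun p _ => hw p⟩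

end Graded

/-! ### The canonical map `θ` -/

namespace UQ

variable (c : Braiding K V) (β : QBracket c)

theorem proj_mem_fil {n : ℕ} {t : TensorAlgebra K V} (ht : t ∈ tpow K V n) :
    proj c β t ∈ fil c β n :=
  ⟨t, Submodule.mem_iSup_of_mem n (Submodule.mem_iSup_of_mem le_rfl ht), rfl⟩

/-- The projection `V^{⊗ n} → U'_n`. -/
noncomputable def projFil (n : ℕ) : tpow K V n →ₗ[K] fil c β n :=
  ((proj c β).toLinearMap ∘ₗ (tpow K V n).subtype).codRestrict (fil c β n)
    fun t => proj_mem_fil c β t.2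

theorem theta_proj_ι_mul (v : V) (t : TensorAlgebra K V) :
    theta c β (proj c 0 (TensorAlgebra.ι K v * t)) = theta₁ c β v * theta c β (proj c 0 t) := by
  rw [map_mul, map_mul, proj_ι, theta, lift_incl]

/-- By multiplicativity, `θ` takes the class of a homogeneous tensor to the symbol of its image in
`U_Q`. The symbol is taken in the degree of the tensor, so it is zero when the image lies lower in
the filtration. Every later statement about `θ` is reduced to tensors by this formula. -/
theorem theta_proj {n : ℕ} (t : tpow K V n) :
    theta c β (proj c 0 t) = DirectSum.lof K ℕ (GrPiece c β) n (cls c β n (projFil c β n t)) := by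
  obtain ⟨t, ht⟩ := t
  induction n generalizing t with
  | zero =>
    obtain ⟨r, rfl⟩ := tpow_zero_eq ht
    have h : projFil c β 0 ⟨_, ht⟩ = r • (⟨1, one_mem_fil c β 0⟩ : fil c β 0) := by
      refine Subtype.ext ?_
      change proj c β (algebraMap K _ r) = r • (1 : UQ c β)
      rw [AlgHom.commutes, Algebra.algebraMap_eq_smul_one]
    rw [h, map_smul, map_smul, AlgHom.commutes, AlgHom.commutes, Algebra.algebraMap_eq_smul_one]
    rfl
  | succ n ih =>
    -- The map `projFil` exists only on tensors of the given degree, so the equalizer is formed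
    -- there and then pushed into `T`, where the induction on words applies.
    let P : Submodule K (TensorAlgebra K V) := LinearMap.eqLocus
      ((theta c β).toLinearMap ∘ₗ (proj c 0).toLinearMap ∘ₗ (tpow K V (n + 1)).subtype)
      (DirectSum.lof K ℕ (GrPiece c β) (n + 1) ∘ₗ cls c β (n + 1) ∘ₗ projFil c β (n + 1)) |>.map
        (tpow K V (n + 1)).subtype
    suffices h : tpow K V (n + 1) ≤ P by
      obtain ⟨s, hs, rfl⟩ := h ht
      exact hs
    refine tpow_succ_induction fun v x hx => ?_
    have hvx : TensorAlgebra.ι K v * x ∈ tpow K V (n + 1) := by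
      rw [add_comm]; exact tpow_mul (ι_mem_tpow v) hx
    refine ⟨⟨_, hvx⟩, ?_, rfl⟩
    change theta c β (proj c 0 (TensorAlgebra.ι K v * x)) =
      DirectSum.lof K ℕ (GrPiece c β) (n + 1) (cls c β (n + 1) (projFil c β (n + 1) ⟨_, hvx⟩))
    rw [theta_proj_ι_mul, ih x hx]
    change DirectSum.lof K ℕ (GrPiece c β) 1 (cls c β 1 ⟨_, incl_mem_fil c β v⟩) * _ = _
    rw [lof_mul_lof]
    -- The product lies in degree `1 + n` and the target in degree `n + 1`; these index different
    -- types, so the comparison is made in the graded monoid.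
    refine DirectSum.of_eq_of_gradedMonoid_eq (gr_ext (add_comm 1 n) _ _ ?_)
    exact (map_mul (proj c β) (TensorAlgebra.ι K v) x).symm

/-- `U'_n` is the sum of `U'_{n-1}` and of the image of `V^{⊗ n}`. -/
theorem exists_proj_sub_mem {n : ℕ} {x : UQ c β} (hx : x ∈ fil c β n) :
    ∃ t ∈ tpow K V n, x - proj c β t ∈ filPred c β n := by
  obtain ⟨s, hs, rfl⟩ := hx
  suffices h : (⨆ (t : ℕ) (_ : t ≤ n), LinearMap.range (TensorAlgebra.ι K (M := V)) ^ t) ≤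
      tpow K V n ⊔ (filPred c β n).comap (proj c β).toLinearMap by
    obtain ⟨t, ht, u, hu, rfl⟩ := Submodule.mem_sup.1 (h hs)
    refine ⟨t, ht, ?_⟩
    rw [map_add, AlgHom.toLinearMap_apply, add_sub_cancel_left]
    exact hu
  refine iSup₂_le fun m hm => ?_
  rcases Nat.eq_or_lt_of_le hm with rfl | h
  · exact le_sup_left
  · exact le_sup_of_le_right fun t ht => fil_le_filPred c β h (proj_mem_fil c β ht)

/-- Lower tensors contribute nothing to the symbol, so homogeneous tensors of degree `n` already
exhaust the graded piece. This yields surjectivity of `θ` and lets the symbol of a primitive element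
be lifted to a homogeneous tensor. -/
theorem cls_exists (n : ℕ) (y : GrPiece c β n) :
    ∃ t : tpow K V n, cls c β n (projFil c β n t) = y := by
  obtain ⟨x, rfl⟩ := cls_surjective c β n y
  obtain ⟨t, ht, hx⟩ := exists_proj_sub_mem c β x.2
  refine ⟨⟨t, ht⟩, ?_⟩
  rw [eq_comm, ← sub_eq_zero, ← map_sub]
  exact cls_eq_zero.2 hx

theorem map_component_theta (n : ℕ) :
    (component c 0 n).map (theta c β).toLinearMap = grGrading c β n := by
  ext y
  constructor
  · rintro ⟨_, ⟨t, ht, rfl⟩, rfl⟩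
    exact ⟨_, (theta_proj c β ⟨t, ht⟩).symm⟩
  · rintro ⟨y, rfl⟩
    obtain ⟨t, rfl⟩ := cls_exists c β n y
    exact ⟨_, ⟨t, t.2, rfl⟩, theta_proj c β t⟩

theorem theta_surjective : Function.Surjective (theta c β) := by
  intro y
  induction y using DirectSum.induction_on with
  | zero => exact ⟨0, map_zero _⟩
  | of n y =>
    obtain ⟨t, rfl⟩ := cls_exists c β n y
    exact ⟨_, theta_proj c β t⟩
  | add y z hy hz =>
    obtain ⟨a, rfl⟩ := hy
    obtain ⟨b, rfl⟩ := hz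
    exact ⟨a + b, map_add _ _ _⟩

/-- Linear maps on `U_Q` agree if they agree on the images of the homogeneous tensors. -/
theorem hom_ext_tpow {M : Type*} [AddCommGroup M] [Module K M] {f g : UQ c β →ₗ[K] M}
    (h : ∀ n, ∀ t ∈ tpow K V n, f (proj c β t) = g (proj c β t)) : f = g := by
  refine LinearMap.ext fun x => ?_
  obtain ⟨t, rfl⟩ := proj_surjective c β x
  exact LinearMap.congr_fun (tensor_hom_ext_tpow (f := f ∘ₗ (proj c β).toLinearMap)
    (g := g ∘ₗ (proj c β).toLinearMap) h) t

theorem theta_comp_projSubtype (n : ℕ) :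
    (theta c β).toLinearMap ∘ₗ (proj c 0).toLinearMap ∘ₗ (tpow K V n).subtype =
      (DirectSum.lof K ℕ (GrPiece c β) n ∘ₗ cls c β n) ∘ₗ projFil c β n :=
  LinearMap.ext fun t => theta_proj c β t

/-- The homogeneous components of `Δ(t)` in `T` serve both sides. Their images in `S_Q` compute the
comultiplication there, and their images in `U_Q` form a family of representatives of the kind
`grComul_cls` requires. -/
theorem theta_comul : grComul c β ∘ₗ (theta c β).toLinearMap =
    TensorProduct.map (theta c β).toLinearMap (theta c β).toLinearMap ∘ₗ comul c 0 := by
  refine hom_ext_tpow c 0 fun n t ht => ?_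
  obtain ⟨w, hw⟩ := exists_comulT c ht
  -- Compatibility of the projection with `Δ` is needed for the zero bracket, on the side of `S_Q`,
  -- and for the given one.
  have hc : ∀ β : QBracket c, comul c β (proj c β t) = TensorProduct.map (proj c β).toLinearMap
      (proj c β).toLinearMap (comulT c t) := fun β => LinearMap.congr_fun (comul_proj c β) t
  rw [LinearMap.comp_apply, LinearMap.comp_apply, AlgHom.toLinearMap_apply,
    theta_proj c β ⟨t, ht⟩, hc 0, ← hw,
    grComul_cls c β _ (fun p => TensorProduct.map (projFil c β p.1) (projFil c β p.2) (w p))]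
  · rw [map_sum, map_sum]
    refine Finset.sum_congr rfl fun p _ => ?_
    simp only [← LinearMap.comp_apply, ← TensorProduct.map_comp]
    rw [← theta_comp_projSubtype, ← theta_comp_projSubtype]
  · change _ = comul c β (proj c β t)
    rw [hc β, ← hw, map_sum]
    refine Finset.sum_congr rfl fun p _ => ?_
    simp only [← LinearMap.comp_apply, ← TensorProduct.map_comp]
    rfl

/-- As for the comultiplication, a single homogeneous representative of `c_T(s ⊗ t)` computes the
braiding both in `S_Q` and, by way of `U_Q`, in the associated graded object. -/
theorem theta_braid : grBraid c β ∘ₗ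
      TensorProduct.map (theta c β).toLinearMap (theta c β).toLinearMap =
    TensorProduct.map (theta c β).toLinearMap (theta c β).toLinearMap ∘ₗ braid c 0 := by
  refine TensorProduct.ext ?_
  refine hom_ext_tpow (M := UQ c 0 →ₗ[K] Gr c β ⊗[K] Gr c β) c 0 fun m s hs => ?_
  refine hom_ext_tpow c 0 fun n t ht => ?_
  obtain ⟨w, hw⟩ := braidT_mem c hs ht
  have hc : ∀ β : QBracket c, braid c β (proj c β s ⊗ₜ proj c β t) =
      TensorProduct.map (proj c β).toLinearMap (proj c β).toLinearMap (braidT c (s ⊗ₜ t)) :=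
    fun β => LinearMap.congr_fun (braid_proj c β) (s ⊗ₜ t)
  change grBraid c β (theta c β (proj c 0 s) ⊗ₜ theta c β (proj c 0 t)) =
    TensorProduct.map (theta c β).toLinearMap (theta c β).toLinearMap
      (braid c 0 (proj c 0 s ⊗ₜ proj c 0 t))
  rw [theta_proj c β ⟨t, ht⟩, theta_proj c β ⟨s, hs⟩, hc 0, ← hw]
  have h1 : grBraid c β (DirectSum.lof K ℕ (GrPiece c β) m (cls c β m (projFil c β m ⟨s, hs⟩)) ⊗ₜ
      DirectSum.lof K ℕ (GrPiece c β) n (cls c β n (projFil c β n ⟨t, ht⟩))) =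
      TensorProduct.map (DirectSum.lof K ℕ (GrPiece c β) n) (DirectSum.lof K ℕ (GrPiece c β) m)
        (grBraidPiece c β m n (cls c β m (projFil c β m ⟨s, hs⟩))
          (cls c β n (projFil c β n ⟨t, ht⟩))) := by
    rw [grBraid, TensorProduct.lift.tmul, DirectSum.toModule_lof, LinearMap.flip_apply,
      DirectSum.toModule_lof]
    rfl
  rw [h1, grBraidPiece_cls c β _ _ (TensorProduct.map (projFil c β n) (projFil c β m) w)]
  · simp only [← LinearMap.comp_apply, ← TensorProduct.map_comp]
    rw [theta_comp_projSubtype, theta_comp_projSubtype, LinearMap.comp_assoc,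
      LinearMap.comp_assoc]
  · change _ = braid c β (proj c β s ⊗ₜ proj c β t)
    rw [hc β, ← hw]
    simp only [← LinearMap.comp_apply, ← TensorProduct.map_comp]
    rfl

theorem theta_counit : grCounit c β ∘ₗ (theta c β).toLinearMap = (counit c 0).toLinearMap := by
  refine hom_ext_tpow c 0 fun n t ht => ?_
  rw [LinearMap.comp_apply, AlgHom.toLinearMap_apply, AlgHom.toLinearMap_apply,
    theta_proj c β ⟨t, ht⟩, counit_proj, grCounit, DirectSum.toModule_lof]
  cases n with
  | zero => rfl
  | succ n => rw [counitT_eq_zero c (Nat.succ_ne_zero n) ht]; rfl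

end UQ

/-! ### Injectivity of `θ` when `V` embeds in `U_Q`. -/

namespace UQ

variable (c : Braiding K V) (β : QBracket c)

theorem counit_incl (v : V) : counit c β (incl c β v) = 0 := by
  rw [counit, lift_incl, LinearMap.zero_apply]

/-- The map `V → U'_1 / U'_0`. -/
noncomputable def clsOne : V →ₗ[K] GrPiece c β 1 :=
  cls c β 1 ∘ₗ (incl c β).codRestrict (fil c β 1) (incl_mem_fil c β)

variable {c β} in
-- If `i(v)` lies in `U'_0`, it is a scalar; the counit vanishes on `i(V)`, so that scalar is zero.
theorem clsOne_injective (hi : Function.Injective (incl c β)) :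
    Function.Injective (clsOne c β) := by
  refine (injective_iff_map_eq_zero _).2 fun v hv => ?_
  have h1 : incl c β v ∈ fil c β 0 := cls_eq_zero.1 hv
  rw [fil_zero] at h1
  obtain ⟨r, hr⟩ := Submodule.mem_one.1 h1
  have h2 := counit_incl c β v
  rw [← hr, AlgHom.commutes] at h2
  have h3 : r = 0 := h2
  rw [h3, map_zero] at hr
  exact hi (by rw [← hr, map_zero])

/-- A projection `gr'(U) → V` onto the component of degree one, defined by a left inverse of
`V → U'_1 / U'_0`. -/
noncomputable def grDegOne : Gr c β →ₗ[K] V :=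
  -- The choice requires no hypothesis: `Function.invFun` returns a left inverse when one exists,
  -- and an arbitrary linear map otherwise. It is a retraction onto `V` once `i` is known to be
  -- injective.
  Function.invFun (fun g : GrPiece c β 1 →ₗ[K] V => g ∘ₗ clsOne c β) LinearMap.id ∘ₗ
    DirectSum.component K ℕ (GrPiece c β) 1

variable {c β} in
theorem grDegOne_lof_clsOne (hi : Function.Injective (incl c β)) (v : V) :
    grDegOne c β (DirectSum.lof K ℕ (GrPiece c β) 1 (clsOne c β v)) = v := by
  have h : (Function.invFun (fun g : GrPiece c β 1 →ₗ[K] V => g ∘ₗ clsOne c β) LinearMap.id) ∘ₗ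
      clsOne c β = LinearMap.id :=
    Function.invFun_eq (f := fun g : GrPiece c β 1 →ₗ[K] V => g ∘ₗ clsOne c β)
      (LinearMap.exists_leftInverse_of_injective _
        (LinearMap.ker_eq_bot.2 (clsOne_injective hi)))
  rw [grDegOne, LinearMap.comp_apply, DirectSum.component.lof_self]
  exact LinearMap.congr_fun h v

theorem grDegOne_lof {n : ℕ} (hn : n ≠ 1) (y : GrPiece c β n) :
    grDegOne c β (DirectSum.lof K ℕ (GrPiece c β) n y) = 0 := by
  rw [grDegOne, LinearMap.comp_apply, DirectSum.component.of, dif_neg hn, map_zero]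

variable {c β} in
-- Both maps vanish outside degree one and are the identity on `V`. Thus the retraction chosen on
-- the associated graded side restricts along `θ` to the canonical projection of `T`.
theorem grDegOne_theta (hi : Function.Injective (incl c β)) :
    grDegOne c β ∘ₗ (theta c β).toLinearMap ∘ₗ (proj c 0).toLinearMap = degOne c := by
  refine tensor_hom_ext_tpow fun n t ht => ?_
  rw [LinearMap.comp_apply, LinearMap.comp_apply, AlgHom.toLinearMap_apply,
    AlgHom.toLinearMap_apply]
  by_cases hn : n = 1
  · subst hn
    rw [tpow, pow_one] at ht
    obtain ⟨v, rfl⟩ := ht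
    rw [proj_ι, theta, lift_incl, degOne_ι]
    exact grDegOne_lof_clsOne hi v
  · rw [theta_proj c β ⟨t, ht⟩, grDegOne_lof c β hn, degOne_eq_zero c hn ht]

variable {c β} in
-- The maps `π` and `θ` respect comultiplications, so applying the retraction to the first factor
-- computes `Δ^{1,*}` of the associated graded object by `Δ^{1,*}` of `T`.
theorem grDegOne_grComul_theta (hi : Function.Injective (incl c β)) (t : TensorAlgebra K V) :
    (grDegOne c β).rTensor (Gr c β) (grComul c β (theta c β (proj c 0 t))) =
      ((theta c β).toLinearMap ∘ₗ (proj c 0).toLinearMap).lTensor V (comulOne c t) := by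
  have h1 : grComul c β (theta c β (proj c 0 t)) =
      TensorProduct.map (theta c β).toLinearMap (theta c β).toLinearMap
        (comul c 0 (proj c 0 t)) := LinearMap.congr_fun (theta_comul c β) _
  have h2 : comul c 0 (proj c 0 t) = TensorProduct.map (proj c 0).toLinearMap
      (proj c 0).toLinearMap (comulT c t) := LinearMap.congr_fun (comul_proj c 0) t
  rw [h1, h2, comulOne, ← grDegOne_theta hi]
  simp only [LinearMap.rTensor, LinearMap.lTensor, ← LinearMap.comp_apply,
    ← TensorProduct.map_comp, ← LinearMap.comp_assoc, LinearMap.id_comp, LinearMap.comp_id]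

variable {c β} in
-- Induction on the degree. If `θ` kills `t`, then `V ⊗ θ` kills the image of `Δ^{1,n}(t)` in `V ⊗
-- S_Q`. By induction `θ` is injective in degree `n`, hence so is `V ⊗ θ` there, and
-- `proj_eq_zero_of_comulOne` concludes.
theorem theta_proj_eq_zero (hc : Function.Injective (sqToNichols c))
    (hi : Function.Injective (incl c β)) {n : ℕ} {t : TensorAlgebra K V} (ht : t ∈ tpow K V n)
    (h : theta c β (proj c 0 t) = 0) : proj c 0 t = 0 := by
  induction n generalizing t with
  | zero =>
    obtain ⟨r, rfl⟩ := tpow_zero_eq ht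
    -- In degree zero the counit, which `θ` respects, recovers the scalar.
    have h1 := LinearMap.congr_fun (theta_counit c β) (proj c 0 (algebraMap K _ r))
    rw [LinearMap.comp_apply, AlgHom.toLinearMap_apply, h, map_zero, AlgHom.toLinearMap_apply,
      AlgHom.commutes, AlgHom.commutes] at h1
    have h2 : r = 0 := h1.symm
    rw [h2, map_zero, map_zero]
  | succ n ih =>
    refine proj_eq_zero_of_comulOne c hc ht ?_
    have h1 := grDegOne_grComul_theta hi t
    rw [h, map_zero, map_zero] at h1
    -- The induction hypothesis concerns degree `n` only, so the second factor is first placed in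
    -- that degree. The composite of projection and `θ` then factors through the component of `S_Q`
    -- of degree `n`, where `f` is injective.
    obtain ⟨d, hd⟩ := comulOne_mem c n ht
    let p : tpow K V n →ₗ[K] component c 0 n :=
      ((proj c 0).toLinearMap ∘ₗ (tpow K V n).subtype).codRestrict _ fun t => ⟨t, t.2, rfl⟩
    let f : component c 0 n →ₗ[K] Gr c β := (theta c β).toLinearMap ∘ₗ (component c 0 n).subtype
    have hf : Function.Injective f := by
      refine (injective_iff_map_eq_zero f).2 ?_
      rintro ⟨_, s, hs, rfl⟩ hz
      exact Subtype.ext (ih hs hz)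
    have h2 : f.lTensor V (p.lTensor V d) = 0 := by
      rw [h1, ← hd, ← LinearMap.comp_apply, ← LinearMap.comp_apply, ← LinearMap.lTensor_comp,
        ← LinearMap.lTensor_comp]
      rfl
    have h3 : p.lTensor V d = 0 :=
      -- Over a field `V` is flat, so tensoring with it preserves the injectivity of `f`.
      Module.Flat.lTensor_preserves_injective_linearMap f hf (by rw [h2, map_zero])
    have h4 : (proj c 0).toLinearMap.lTensor V ((tpow K V n).subtype.lTensor V d) =
        (component c 0 n).subtype.lTensor V (p.lTensor V d) := by
      rw [← LinearMap.comp_apply, ← LinearMap.comp_apply, ← LinearMap.lTensor_comp,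
        ← LinearMap.lTensor_comp]
      rfl
    rw [← hd, h4, h3, map_zero]

/-- Since `θ` is graded, the components of a value of `θ` are the values on the homogeneous
components. Hence injectivity may be tested in each degree separately. -/
theorem component_theta_proj (m : ℕ) :
    DirectSum.component K ℕ (GrPiece c β) m ∘ₗ (theta c β).toLinearMap ∘ₗ
      (proj c 0).toLinearMap ∘ₗ DirectSum.coeLinearMap (tpow K V) =
    cls c β m ∘ₗ projFil c β m ∘ₗ DirectSum.component K ℕ (fun n => tpow K V n) m := by
  refine DirectSum.linearMap_ext K fun n => LinearMap.ext fun t => ?_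
  simp only [LinearMap.comp_apply, AlgHom.toLinearMap_apply, DirectSum.coeLinearMap_lof]
  rw [theta_proj]
  by_cases h : n = m
  · subst h
    rw [DirectSum.component.lof_self, DirectSum.component.lof_self]
  · rw [DirectSum.component.of, DirectSum.component.of, dif_neg h, dif_neg h, map_zero, map_zero]

variable {c β} in
theorem theta_injective (hc : Function.Injective (sqToNichols c))
    (hi : Function.Injective (incl c β)) : Function.Injective (theta c β) := by
  classical
  refine (injective_iff_map_eq_zero _).2 fun s hs => ?_
  obtain ⟨t, rfl⟩ := proj_surjective c 0 s
  obtain ⟨y, rfl⟩ : ∃ y, DirectSum.coeLinearMap (tpow K V) y = t :=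
    (tpow_isInternal (K := K) (V := V)).surjective t
  have h1 : ∀ m, proj c 0 (y m : TensorAlgebra K V) = 0 := by
    intro m
    refine theta_proj_eq_zero hc hi (y m).2 ?_
    have := LinearMap.congr_fun (component_theta_proj c β m) y
    simp only [LinearMap.comp_apply, AlgHom.toLinearMap_apply] at this
    rw [hs, map_zero] at this
    rw [theta_proj]
    change _ = cls c β m (projFil c β m (y m)) at this
    rw [← this, map_zero]
  rw [← DirectSum.sum_support_of y, map_sum, map_sum]
  refine Finset.sum_eq_zero fun m _ => ?_
  rw [DirectSum.coeLinearMap_of, h1]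

/-! ### Primitive elements -/

theorem comul_one : comul c β 1 = 1 ⊗ₜ 1 := by
  rw [comul, comulOf_apply, map_one]; rfl

theorem incl_mem_primitives (v : V) : incl c β v ∈ primitives c β := by
  change comul c β (incl c β v) = _
  rw [comul, comulOf_apply, prim, lift_incl, primV_tmul, braidV_one, absorbRight_tmul, mul_one]

/-- The filtration is exhaustive, which gives the descent for primitive elements a starting point.
-/
theorem exists_mem_fil (x : UQ c β) : ∃ n, x ∈ fil c β n := by
  have h := mem_of_mul_right (c := c) (β := β) (⨆ n, fil c β n)
    (Submodule.mem_iSup_of_mem 0 (one_mem_fil c β 0)) (fun a ha v => by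
      suffices hle : ⨆ n, fil c β n ≤
          (⨆ n, fil c β n).comap (LinearMap.mulRight K (incl c β v)) from hle ha
      exact iSup_le fun n a ha =>
        Submodule.mem_iSup_of_mem (n + 1) (fil_mul c β ha (incl_mem_fil c β v))) x
  exact (Submodule.mem_iSup_of_directed _
    (Monotone.directed_le fun _ _ h => fil_mono c β h)).1 h

/-- In degrees greater than one, the component of bidegree `(1, *)` of the comultiplication of
`gr'(U)` vanishes on the classes of primitive elements. -/
theorem grDegOne_grComul_primitive {n : ℕ} (hn : n ≠ 0) (x : fil c β (n + 1))
    (hx : (x : UQ c β) ∈ primitives c β) :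
    (grDegOne c β).rTensor (Gr c β)
      (grComul c β (DirectSum.lof K ℕ (GrPiece c β) (n + 1) (cls c β (n + 1) x))) = 0 := by
  have h1 : grComulPiece c β (n + 1) (cls c β (n + 1) x) =
      (∑ p ∈ Finset.HasAntidiagonal.antidiagonal (n + 1),
      TensorProduct.map (DirectSum.lof K ℕ (GrPiece c β) p.1 ∘ₗ symb c β p.1)
        (DirectSum.lof K ℕ (GrPiece c β) p.2 ∘ₗ symb c β p.2) ∘ₗ
          comul c β ∘ₗ (fil c β (n + 1)).subtype) x := Submodule.liftQ_apply _ _ _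
  have hx' : comul c β (x : UQ c β) = (x : UQ c β) ⊗ₜ 1 + 1 ⊗ₜ (x : UQ c β) := hx
  have hone : ∀ {k : ℕ}, k ≠ 0 → symb c β k 1 = 0 := fun hk =>
    symb_eq_zero c β (fil_le_filPred c β (Nat.pos_of_ne_zero hk) (one_mem_fil c β 0))
  rw [grComul, DirectSum.toModule_lof, h1, LinearMap.sum_apply, map_sum]
  refine Finset.sum_eq_zero ?_
  rintro ⟨i, j⟩ hij
  have hij' : i + j = n + 1 := Finset.HasAntidiagonal.mem_antidiagonal.1 hij
  simp only [LinearMap.comp_apply, Submodule.subtype_apply, hx', map_add, TensorProduct.map_tmul,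
    LinearMap.rTensor_tmul]
  -- The retraction leaves only bidegree `(1, n)`. Both positions are positive, so the symbol of `1`
  -- is zero in each of them, and this kills `x ⊗ 1` as well as `1 ⊗ x`.
  by_cases hi : i = 1
  · subst hi
    rw [hone one_ne_zero, hone (k := j) (by omega)]
    simp
  · rw [grDegOne_lof c β hi, grDegOne_lof c β hi]
    simp

variable {c β} in
-- Descent along the filtration: in filtration degree at least two, the symbol of a primitive
-- element has zero `Δ^{1,*}`, so it vanishes by injectivity of `θ` and of `Δ^{1,*}` on `S_Q`. Below
-- that, only scalars have to be separated from `i(V)`.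
theorem primitives_le (hc : Function.Injective (sqToNichols c))
    (hi : Function.Injective (incl c β)) {x : UQ c β} (hx : x ∈ primitives c β) :
    x ∈ LinearMap.range (incl c β) := by
  have hfil : ∀ n, x ∈ fil c β (n + 1) → x ∈ fil c β 1 := by
    intro n
    induction n with
    | zero => exact id
    | succ n ih =>
      intro hxn
      refine ih ?_
      -- The symbol of `x` is lifted to a homogeneous tensor, so that the question moves to `S_Q`,
      -- where vanishing can be tested by `Δ^{1,*}`.
      obtain ⟨⟨t, ht⟩, hxt⟩ := cls_exists c β (n + 1 + 1) (cls c β _ ⟨x, hxn⟩)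
      have h1 : theta c β (proj c 0 t) =
          DirectSum.lof K ℕ (GrPiece c β) (n + 1 + 1) (cls c β _ ⟨x, hxn⟩) := by
        rw [theta_proj c β ⟨t, ht⟩, hxt]
      have h2 := grDegOne_grComul_theta hi t
      rw [h1, grDegOne_grComul_primitive c β (Nat.succ_ne_zero n) ⟨x, hxn⟩ hx,
        LinearMap.lTensor_comp, LinearMap.comp_apply] at h2
      have h3 : (proj c 0).toLinearMap.lTensor V (comulOne c t) = 0 :=
        Module.Flat.lTensor_preserves_injective_linearMap (theta c β).toLinearMap
          (theta_injective hc hi) (by rw [← h2, map_zero])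
      rw [proj_eq_zero_of_comulOne c hc ht h3, map_zero] at h1
      have h4 : cls c β (n + 1 + 1) ⟨x, hxn⟩ = 0 :=
        DirectSum.of_injective (β := GrPiece c β) (n + 1 + 1) (by
          rw [map_zero, ← DirectSum.lof_eq_of K, ← h1])
      exact cls_eq_zero.1 h4
  obtain ⟨n, hn⟩ := exists_mem_fil c β x
  have h1 := hfil n (fil_mono c β (Nat.le_succ n) hn)
  rw [fil_eq, pow_one] at h1
  obtain ⟨a, ha, b, ⟨v, rfl⟩, rfl⟩ := Submodule.mem_sup.1 h1
  obtain ⟨r, rfl⟩ := Submodule.mem_one.1 ha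
  -- Elements of `i(V)` are primitive, so subtracting the one at hand leaves a primitive scalar.
  have h2 : algebraMap K (UQ c β) r ∈ primitives c β := by
    have := Submodule.sub_mem _ hx (incl_mem_primitives c β v)
    rwa [add_sub_cancel_right] at this
  have h3 : comul c β (algebraMap K (UQ c β) r) =
      algebraMap K (UQ c β) r ⊗ₜ 1 + 1 ⊗ₜ algebraMap K (UQ c β) r := h2
  have h4 := congrArg (TensorProduct.lid K K ∘
    TensorProduct.map (counit c β).toLinearMap (counit c β).toLinearMap) h3
  rw [Algebra.algebraMap_eq_smul_one, map_smul, comul_one] at h4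
  -- Applying the counit to both factors turns primitivity of the scalar into `r = r + r`, which
  -- forces `r = 0` in every characteristic.
  have h5 : r = 0 := by simpa using h4
  rw [h5, map_zero, zero_add]
  exact ⟨v, rfl⟩

variable {c} in
-- The map `Γ` is the identity on `V` and factors through `S_Q`, so `V` embeds in `S_Q` for every
-- braiding.
theorem sq_incl_injective : Function.Injective (incl c 0) := by
  intro v w h
  have := congrArg (sqSymmetrizer c) h
  rw [← proj_ι, ← proj_ι, sqSymmetrizer_proj, sqSymmetrizer_proj, symmetrizer_ι,
    symmetrizer_ι] at this
  exact TensorAlgebra.ι_leftInverse.injective this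

variable {c β} in
-- On `V` the map `θ` is the class of `i(v)`, so it kills the kernel of `i`, while `V` embeds in
-- `S_Q`.
theorem incl_injective_of_theta (h : Function.Injective (theta c β)) :
    Function.Injective (incl c β) := by
  refine (injective_iff_map_eq_zero _).2 fun v hv => ?_
  have h1 : theta c β (incl c 0 v) = 0 := by
    have h2 : (incl c β).codRestrict (fil c β 1) (incl_mem_fil c β) v = 0 := Subtype.ext hv
    rw [theta, lift_incl, theta₁, LinearMap.comp_apply, LinearMap.comp_apply, h2, map_zero,
      map_zero]
  exact sq_incl_injective (h (by rw [h1, map_zero, map_zero]))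

theorem incl_injective_iff : Function.Injective (incl c β) ↔
    LinearMap.range (TensorAlgebra.ι K (M := V)) ⊓ LinearMap.ker (proj c β).toLinearMap = ⊥ := by
  rw [← disjoint_iff, Submodule.disjoint_def, injective_iff_map_eq_zero]
  constructor
  · rintro h _ ⟨v, rfl⟩ hv
    rw [h v hv, map_zero]
  · intro h v hv
    exact (TensorAlgebra.ι_eq_zero_iff (R := K) v).1 (h _ ⟨v, rfl⟩ hv)

end UQ

end QLie

/-! ### The main theorem. -/

theorem mainTheorem6 {K V : Type*} [Field K] [AddCommGroup V] [Module K V]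
    (c : QLie.Braiding K V) (β : QLie.QBracket c) :
    (QLie.IsQuadraticAlgebra (QLie.nicholsGrading c) ↔
      Function.Bijective (QLie.sqToNichols c)) ∧
    (QLie.IsQuadraticAlgebra (QLie.nicholsGrading c) →
      List.TFAE [
        Function.Injective (QLie.UQ.incl c β),
        LinearMap.range (TensorAlgebra.ι K (M := V)) ⊓
          LinearMap.ker (QLie.UQ.proj c β).toLinearMap = ⊥,
        QLie.IsGradedBraidedBialgIso
          (QLie.UQ.comul c 0) (QLie.UQ.counit c 0).toLinearMap (QLie.UQ.braid c 0)
          (QLie.UQ.component c 0)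
          (QLie.UQ.grComul c β) (QLie.UQ.grCounit c β) (QLie.UQ.grBraid c β)
          (QLie.UQ.grGrading c β) (QLie.UQ.theta c β),
        ∃ e : V ≃ₗ[K] QLie.UQ.primitives c β, ∀ v : V, (e v : QLie.UQ c β) = QLie.UQ.incl c β v]) := by
  refine ⟨QLie.isQuadraticAlgebra_iff c, fun hq => ?_⟩
  -- Quadraticity enters only as injectivity of `S_Q → B`, and only in deducing the third and fourth
  -- assertions from the first.
  have hc := ((QLie.isQuadraticAlgebra_iff c).1 hq).1
  tfae_have 1 ↔ 2 := QLie.UQ.incl_injective_iff c β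
  tfae_have 1 → 3 := fun hi =>
    { bijective := ⟨QLie.UQ.theta_injective hc hi, QLie.UQ.theta_surjective c β⟩
      map_comul := QLie.UQ.theta_comul c β
      map_counit := QLie.UQ.theta_counit c β
      map_braid := QLie.UQ.theta_braid c β
      map_grading := QLie.UQ.map_component_theta c β }
  tfae_have 3 → 1 := fun h => QLie.UQ.incl_injective_of_theta h.bijective.1
  tfae_have 1 → 4 := fun hi =>
    ⟨LinearEquiv.ofBijective ((QLie.UQ.incl c β).codRestrict (QLie.UQ.primitives c β)
        (QLie.UQ.incl_mem_primitives c β))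
      ⟨fun v w h => hi (congrArg Subtype.val h), fun x => by
        obtain ⟨v, hv⟩ := QLie.UQ.primitives_le hc hi x.2
        exact ⟨v, Subtype.ext hv⟩⟩, fun _ => rfl⟩
  tfae_have 4 → 1 := by
    -- The isomorphism `e` is required to be given by `i`, so its injectivity is that of `i`.
    rintro ⟨e, he⟩ v w h
    exact e.injective (Subtype.ext (by rw [he, he, h]))
  tfae_finish
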